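/- Let $\Omega=\{(r,z)\in\mathbb{R}^2: r>0\}$ carry the measure $dr\,dz$, let $L^p(\Omega)$ be the corresponding real Lebesgue spaces, and put $\|(f,g)\|_{L^p(\Omega)\times L^p(\Omega)}=\|f\|_{L^p(\Omega)}+\|g\|_{L^p(\Omega)}$. For $s>0$ let $$\mathscr{N}_1(s)=\frac{1}{\sqrt{\pi s}}\int_{-\pi/2}^{\pi/2}e^{-\frac{\sin^2\alpha}{s}}\cos(2\alpha)\,d\alpha,\qquad \mathscr{N}_2(s)=\frac{1}{\sqrt{\pi s}}\int_{-\pi/2}^{\pi/2}e^{-\frac{\sin^2\alpha}{s}}\,d\alpha,$$ and for $i\in\{1,2\}$, $t>0$ and $(r,z),(\tilde r,\tilde z)\in\Omega$ let $$K_i(t;r,z;\tilde r,\tilde z)=\frac{1}{4\pi t}\,\frac{\tilde r^{1/2}}{r^{1/2}}\,\mathscr{N}_i\Big(\frac{t}{r\tilde r}\Big)e^{-\frac{(r-\tilde r)^2+(z-\tilde z)^2}{4t}}.$$ For $f\in L^p(\Omega)$, $1\le p\le\infty$, set $\mathbb{S}_i(0)f=f$ and, for $t>0$, $(\mathbb{S}_i(t)f)(r,z)=\int_\Omega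 K_i(t;r,z;\tilde r,\tilde z)f(\tilde r,\tilde z)\,d\tilde r\,d\tilde z$. For $f=(f^r,f^z)\in L^p(\Omega)\times L^p(\Omega)$ write $\mathrm{div}_\star f=\partial_rf^r+\partial_zf^z$ and $\mathrm{div}f=\partial_rf^r+\partial_zf^z+\frac{f^r}{r}$ (in the sense of distributions on $\Omega$), and for $t>0$ define, by pairing these distributions with the kernels, $$\mathbb{S}_1(t)\mathrm{div}_\star f=-\int_\Omega\big(\partial_{\tilde r}K_1\,f^r+\partial_{\tilde z}K_1\,f^z\big)d\tilde r\,d\tilde z,\qquad \mathbb{S}_2(t)\mathrm{div}f=\int_\Omega\Big(-\partial_{\tilde r}K_2\,f^r-\partial_{\tilde z}K_2\,f^z+K_2\frac{f^r}{\tilde r}\Big)d\tilde r\,d\tilde z.$$ **Proposition.** (a) For $1\le p\le\infty$, $f\in L^p(\Omega)$ and $t>0$, the integrals defining $\mathbb{S}_i(t)f$ converge absolutely at every point of $\Omega$. Moreover $\mathbb{S}_2(t)$ is the heat semigroup $e^{t\Delta}$ of $\mathbb{R}^3$ on axisymmetric functions, and $\mathbb{S}_1(t)$, the semigroup of $\Delta-\frac1{r^2}$,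 is the heat semigroup of $\mathbb{R}^3$ on fields $f\vec e_\theta$ with $f$ axisymmetric. That is, at every point off the axis, $\mathbb{S}_2(t)f=e^{t\Delta}f$ and $(\mathbb{S}_1(t)f)\,\vec e_\theta=e^{t\Delta}(f\vec e_\theta)$, where functions of $(r,z)$ are regarded as axisymmetric functions on $\mathbb{R}^3$ in cylindrical coordinates and $e^{t\Delta}F(x)=(4\pi t)^{-3/2}\int_{\mathbb{R}^3}e^{-|x-y|^2/4t}F(y)\,dy$. (b) For every $p\in[1,\infty]$ the family $(\mathbb{S}_1(t),\mathbb{S}_2(t))_{t\ge0}$ is a semigroup of bounded linear operators on $L^p(\Omega)\times L^p(\Omega)$. For $p<\infty$ it is strongly continuous on $[0,\infty)$; for $p=\infty$ it is strongly continuous on $(0,\infty)$. (c) For $1\le p\le\infty$, $f\in L^p(\Omega)\times L^p(\Omega)$ and $t>0$, the integrals defining $\mathbb{S}_1(t)\mathrm{div}_\star f$ and $\mathbb{S}_2(t)\mathrm{div}f$ converge absolutely at every point of $\Omega$. If the weak divergence $\mathrm{div}_\star f$ (resp. $\mathrm{div}f$) is a function $g\in L^m(\Omega)$ for some $m\in[1,\infty]$,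 then $\mathbb{S}_1(t)\mathrm{div}_\star f=\mathbb{S}_1(t)g$ (resp. $\mathbb{S}_2(t)\mathrm{div}f=\mathbb{S}_2(t)g$) on $\Omega$. (d) There is an absolute constant $C>0$ such that for all $1\le p\le q\le\infty$ and all $t>0$ the functions on the left below lie in $L^q(\Omega)$ and: (i) for $(\omega_0,\rho_0)\in L^p(\Omega)\times L^p(\Omega)$, $$\|(\mathbb{S}_1(t)\omega_0,\mathbb{S}_2(t)\rho_0)\|_{L^q(\Omega)\times L^q(\Omega)}\le\frac{C}{t^{\frac1p-\frac1q}}\|(\omega_0,\rho_0)\|_{L^p(\Omega)\times L^p(\Omega)};$$ (ii) for $f=(f^r,f^z)\in L^p(\Omega)\times L^p(\Omega)$, $$\|\mathbb{S}_1(t)\mathrm{div}_\star f\|_{L^q(\Omega)}\le\frac{C}{t^{\frac12+\frac1p-\frac1q}}\|f\|_{L^p(\Omega)\times L^p(\Omega)};$$ (iii) for $f=(f^r,f^z)\in L^p(\Omega)\times L^p(\Omega)$, $$\|\mathbb{S}_2(t)\mathrm{div}f\|_{L^q(\Omega)}\le\frac{C}{t^{\frac12+\frac1p-\frac1q}}\|f\|_{L^p(\Omega)\times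 L^p(\Omega)}.$$ -/

import Mathlib

open MeasureTheory
open scoped ENNReal NNReal

noncomputable section

namespace AxisymHeat

/-- The half-plane `{(r, z) : r > 0}`. -/
def Omega : Set (ℝ × ℝ) := {x | 0 < x.1}

/-- The measure `dr dz` on the half-plane; `L^p(Ω)` is taken with respect to it. -/
def muOmega : Measure (ℝ × ℝ) := volume.restrict Omega

/-- `N₁(s) = (π s)^{-1/2} ∫_{-π/2}^{π/2} exp (- sin² α / s) cos (2 α) dα`, for `s > 0`. -/
def N1 (s : ℝ) : ℝ :=
  1 / √(Real.pi * s) *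
    ∫ α in (-(Real.pi / 2))..(Real.pi / 2), Real.exp (-(Real.sin α ^ 2) / s) * Real.cos (2 * α)

/-- `N₂(s) = (π s)^{-1/2} ∫_{-π/2}^{π/2} exp (- sin² α / s) dα`, for `s > 0`. -/
def N2 (s : ℝ) : ℝ :=
  1 / √(Real.pi * s) *
    ∫ α in (-(Real.pi / 2))..(Real.pi / 2), Real.exp (-(Real.sin α ^ 2) / s)

/-- The common form of the two kernels, at `x = (r, z)` and `y = (r', z')`. -/
def kernelOf (N : ℝ → ℝ) (t : ℝ) (x y : ℝ × ℝ) : ℝ :=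
  1 / (4 * Real.pi * t) * (√y.1 / √x.1) * N (t / (x.1 * y.1)) *
    Real.exp (-((x.1 - y.1) ^ 2 + (x.2 - y.2) ^ 2) / (4 * t))

/-- The kernel of the semigroup generated by `Δ - 1/r²`. -/
def K1 (t : ℝ) (x y : ℝ × ℝ) : ℝ := kernelOf N1 t x y

/-- The kernel of the semigroup generated by `Δ` (on axisymmetric functions). -/
def K2 (t : ℝ) (x y : ℝ × ℝ) : ℝ := kernelOf N2 t x y

/-- `𝕊₁(t) f`, with `𝕊₁(0)` the identity. -/
def S1 (t : ℝ) (f : ℝ × ℝ → ℝ) (x : ℝ × ℝ) : ℝ :=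
  if t = 0 then f x else ∫ y, K1 t x y * f y ∂muOmega

/-- `𝕊₂(t) f`, with `𝕊₂(0)` the identity. -/
def S2 (t : ℝ) (f : ℝ × ℝ → ℝ) (x : ℝ × ℝ) : ℝ :=
  if t = 0 then f x else ∫ y, K2 t x y * f y ∂muOmega

/-- The derivative with respect to the first variable `r`. -/
def dr (φ : ℝ × ℝ → ℝ) (y : ℝ × ℝ) : ℝ := deriv (fun s => φ (s, y.2)) y.1

/-- The derivative with respect to the second variable `z`. -/
def dz (φ : ℝ × ℝ → ℝ) (y : ℝ × ℝ) : ℝ := deriv (fun s => φ (y.1, s)) y.2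

/-- The integrand of `𝕊₁(t) div⋆ f`, the derivatives being moved to the kernel. -/
def S1divIntegrand (t : ℝ) (fr fz : ℝ × ℝ → ℝ) (x y : ℝ × ℝ) : ℝ :=
  -(dr (K1 t x) y * fr y + dz (K1 t x) y * fz y)

/-- The integrand of `𝕊₂(t) div f`, the derivatives being moved to the kernel. -/
def S2divIntegrand (t : ℝ) (fr fz : ℝ × ℝ → ℝ) (x y : ℝ × ℝ) : ℝ :=
  -(dr (K2 t x) y * fr y + dz (K2 t x) y * fz y) + K2 t x y * (fr y / y.1)

/-- `𝕊₁(t) div⋆ f` for `t > 0` and `f = (fr, fz)` merely in `L^p(Ω)`: the distribution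
`div⋆ f = ∂_r fr + ∂_z fz` is paired with the kernel. -/
def S1div (t : ℝ) (fr fz : ℝ × ℝ → ℝ) (x : ℝ × ℝ) : ℝ :=
  ∫ y, S1divIntegrand t fr fz x y ∂muOmega

/-- `𝕊₂(t) div f` for `t > 0` and `f = (fr, fz)` merely in `L^p(Ω)`: the distribution
`div f = ∂_r fr + ∂_z fz + fr / r` is paired with the kernel. -/
def S2div (t : ℝ) (fr fz : ℝ × ℝ → ℝ) (x : ℝ × ℝ) : ℝ :=
  ∫ y, S2divIntegrand t fr fz x y ∂muOmega

/-- `φ` is a test function on `Ω`: continuously differentiable with compact support in `Ω`.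
(By mollification, the weak divergences below do not change if smoothness is required.) -/
structure IsTest (φ : ℝ × ℝ → ℝ) : Prop where
  contDiff : ContDiff ℝ 1 φ
  compact : HasCompactSupport φ
  support : tsupport φ ⊆ Omega

/-- `g = ∂_r fr + ∂_z fz` in the weak sense in `Ω`. -/
def IsWeakDivStar (fr fz g : ℝ × ℝ → ℝ) : Prop :=
  ∀ φ, IsTest φ →
    ∫ y, g y * φ y ∂muOmega = ∫ y, -(fr y * dr φ y + fz y * dz φ y) ∂muOmega

/-- `g = ∂_r fr + ∂_z fz + fr / r` in the weak sense in `Ω`. -/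
def IsWeakDiv (fr fz g : ℝ × ℝ → ℝ) : Prop :=
  ∀ φ, IsTest φ →
    ∫ y, g y * φ y ∂muOmega =
      ∫ y, (-(fr y * dr φ y + fz y * dz φ y) + fr y / y.1 * φ y) ∂muOmega

/-- A one-parameter semigroup of bounded linear operators. -/
structure IsOperatorSemigroup {E : Type*} [NormedAddCommGroup E] [NormedSpace ℝ E]
    (T : ℝ≥0 → E →L[ℝ] E) : Prop where
  zero : T 0 = ContinuousLinearMap.id ℝ E
  add : ∀ s t, T (s + t) = (T s).comp (T t)

/-- Three-dimensional Euclidean space. -/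
abbrev E3 : Type := EuclideanSpace ℝ (Fin 3)

/-- The heat flow `e^{tΔ} F` in `ℝ³`, for scalar or vector-valued `F`. -/
def heatFlow {V : Type*} [NormedAddCommGroup V] [NormedSpace ℝ V] (t : ℝ) (F : E3 → V) (x : E3) :
    V :=
  ∫ y, (1 / (4 * Real.pi * t) ^ (3 / 2 : ℝ) * Real.exp (-(‖x - y‖ ^ 2) / (4 * t))) • F y

/-- The cylindrical coordinates `(r, z)` of a point of `ℝ³`. -/
def cyl (x : E3) : ℝ × ℝ := (√(x 0 ^ 2 + x 1 ^ 2), x 2)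

/-- The unit vector `e_θ` of the cylindrical frame (away from the axis). -/
def eTheta (x : E3) : E3 := !₂[-(x 1) / (cyl x).1, x 0 / (cyl x).1, 0]

end AxisymHeat

end

noncomputable section

namespace AxisymHeat

open Filter Topology

/-! Substituting `s = t/(r r')` in `N1` and `N2` turns the singular factor `√r'/√r` into `r'`. Both
kernels take the form `kap(t) · r' · A(r r'/t) · exp(-|x-y|²/4t)`, where `A(u)` is the integral of
`exp(-u sin² α) w(α)` and `w = cos 2α` or `w = 1` (`K1_eq`, `K2_eq`). This form is regular in the
whole plane, and differentiating `A` only multiplies the weight by `-sin² α`.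

Estimates. `A(u)` is bounded by a multiple of `min(1, u^(-1/2))`, and `u A'(u)` is controlled in the
same way. Hence `r' |A(r r'/t)|` is at most a constant times `√t + |r - r'|` (`mul_angMass_le`). The
Gaussian absorbs the powers of `|x-y|/√t`, so every kernel is dominated by `C t^(-1-a)
exp(-|x-y|²/8t)`, with `a = 0` for the kernel, `a = 1/2` for its space derivatives and for `K/r'`,
and `a = 1` for its time derivative. Young's inequality for this majorant (`eLpNorm_gaussOp_le`)
gives absolute convergence and all the `L^p`-`L^q` bounds, with a constant independent of `p` and
`q`.

Semigroup. In cylindrical coordinates the squared distance in `ℝ³` is `|x-y|² + 4 r r'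
sin²((θ-φ)/2)`. Integrating the heat kernel over the angle therefore produces exactly `A`, with
weight `1` for scalars and `cos 2α` for multiples of `e_θ` (`heatFlow_cylMap`). The semigroup law
and the unit mass of `K2` are inherited from `ℝ³`.

Continuity. For positive times the bound on the time derivative gives local Lipschitz continuity in
operator norm. At time zero and `p < ∞`, unit mass and density handle `𝕊₂`. The difference of the
two kernels carries the weight `1 - cos 2α = 2 sin² α`, which gains a factor `min(1, √t/r')`, and
dominated convergence transfers the limit to `𝕊₁`.

Divergence. The kernel times a cutoff near the axis and at infinity is a test function. The cutoff's
radial derivative is of size `1/r' + r'` uniformly, and `K/r'` still has a Gaussian majorant, so the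
cutoff can be removed (`integral_divIntegrand_eq`). -/

/-! ### The angular integrals -/

/-- The weighted angular integral `∫_{-π/2}^{π/2} exp (-u sin² α) w(α) dα`. -/
def angInt (w : ℝ → ℝ) (u : ℝ) : ℝ :=
  ∫ α in (-(Real.pi / 2))..(Real.pi / 2), Real.exp (-u * Real.sin α ^ 2) * w α

/-- The weight obtained by differentiating `angInt w`. -/
def dweight (w : ℝ → ℝ) (α : ℝ) : ℝ := -(Real.sin α ^ 2 * w α)

theorem continuous_dweight {w : ℝ → ℝ} (hw : Continuous w) : Continuous (dweight w) := by
  unfold dweight; fun_prop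

theorem abs_dweight_le_sin_sq {w : ℝ → ℝ} (h1 : ∀ α, |w α| ≤ 1) (α : ℝ) :
    |dweight w α| ≤ Real.sin α ^ 2 := by
  rw [dweight, abs_neg, abs_mul, abs_of_nonneg (sq_nonneg _)]
  exact mul_le_of_le_one_right (sq_nonneg _) (h1 α)

theorem abs_dweight_le_one {w : ℝ → ℝ} (h1 : ∀ α, |w α| ≤ 1) (α : ℝ) : |dweight w α| ≤ 1 :=
  (abs_dweight_le_sin_sq h1 α).trans (Real.sin_sq_le_one α)

theorem continuous_angInt {w : ℝ → ℝ} (hw : Continuous w) : Continuous (angInt w) := by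
  unfold angInt
  apply intervalIntegral.continuous_parametric_intervalIntegral_of_continuous'
  simp only [Function.uncurry_def]
  fun_prop

/-- The derivative is again an angular integral whose weight is bounded by one, so kernels and their
derivatives can be estimated by the same lemmas. -/
theorem hasDerivAt_angInt {w : ℝ → ℝ} (hw : Continuous w) (h1 : ∀ α, |w α| ≤ 1) (u : ℝ) :
    HasDerivAt (angInt w) (angInt (dweight w) u) u := by
  refine (intervalIntegral.hasDerivAt_integral_of_dominated_loc_of_deriv_le
    (F := fun u α => Real.exp (-u * Real.sin α ^ 2) * w α)
    (F' := fun u α => Real.exp (-u * Real.sin α ^ 2) * dweight w α)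
    (bound := fun _ => Real.exp (|u| + 1)) (Metric.ball_mem_nhds u one_pos)
    ?_ ?_ ?_ ?_ ?_ ?_).2
  · filter_upwards with v
    exact Continuous.aestronglyMeasurable (by fun_prop)
  · exact Continuous.intervalIntegrable (by fun_prop) _ _
  · have := continuous_dweight hw
    exact Continuous.aestronglyMeasurable (by fun_prop)
  · filter_upwards with α _ v hv
    rw [Real.norm_eq_abs, abs_mul, Real.abs_exp]
    have hv' : |v| ≤ |u| + 1 := by
      have h := abs_sub_abs_le_abs_sub v u
      rw [Metric.mem_ball, Real.dist_eq] at hv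
      linarith
    have h2 : -v * Real.sin α ^ 2 ≤ |u| + 1 := by
      have hs := Real.sin_sq_le_one α
      have := neg_abs_le v
      nlinarith [sq_nonneg (Real.sin α), abs_nonneg v]
    calc _ ≤ Real.exp (|u| + 1) * 1 := by
          gcongr
          exact abs_dweight_le_one h1 α
      _ = _ := mul_one _
  · exact intervalIntegrable_const
  · filter_upwards with α _ v _
    have h : HasDerivAt (fun v : ℝ => -v * Real.sin α ^ 2) (-1 * Real.sin α ^ 2) v :=
      ((hasDerivAt_id v).neg).mul_const _
    refine (h.exp.mul_const (w α)).congr_deriv ?_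
    simp only [dweight]; ring

/-- `angInt` with weight `1`. -/
def angMass (u : ℝ) : ℝ := angInt (fun _ => 1) u

theorem neg_pi_half_le : -(Real.pi / 2) ≤ Real.pi / 2 := by linarith [Real.pi_pos]

theorem abs_angInt_le_of_le {w : ℝ → ℝ} {u v c : ℝ}
    (h : ∀ α, Real.exp (-u * Real.sin α ^ 2) * |w α| ≤ c * Real.exp (-v * Real.sin α ^ 2)) :
    |angInt w u| ≤ c * angMass v := by
  unfold angMass angInt
  rw [← intervalIntegral.integral_const_mul, ← Real.norm_eq_abs]
  refine intervalIntegral.norm_integral_le_of_norm_le neg_pi_half_le ?_ ?_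
  · filter_upwards with α _
    rw [Real.norm_eq_abs, abs_mul, Real.abs_exp, mul_one]
    exact h α
  · exact Continuous.intervalIntegrable (by fun_prop) _ _

/-- Halving the argument is a loss here; it makes the majorant the same as in `mul_abs_angInt_le`,
where half of the exponent is needed. -/
theorem abs_angInt_le {w : ℝ → ℝ} (h1 : ∀ α, |w α| ≤ 1) {u : ℝ} (hu : 0 ≤ u) :
    |angInt w u| ≤ angMass (u / 2) := by
  have := abs_angInt_le_of_le (w := w) (u := u) (v := u / 2) (c := 1) ?_
  · simpa using this
  · intro α
    rw [one_mul]
    calc _ ≤ Real.exp (-(u / 2) * Real.sin α ^ 2) * 1 := by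
          gcongr
          · linarith
          · exact h1 α
      _ = _ := mul_one _

/-- From `v/2 ≤ exp(v/2 - 1)` and `2 < e`. -/
theorem le_exp_half (v : ℝ) : v ≤ Real.exp (v / 2) := by
  have h1 := Real.add_one_le_exp (v / 2 - 1)
  rw [Real.exp_sub] at h1
  have h2 := Real.exp_one_gt_d9
  have h3 : v / 2 ≤ Real.exp (v / 2) / Real.exp 1 := by linarith
  rw [le_div_iff₀ (by positivity)] at h3
  by_cases hv : 0 ≤ v
  · nlinarith
  · linarith [Real.exp_pos (v / 2)]

/-- Half of `exp(-u sin² α)` pays for the factor `u sin² α`. -/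
theorem mul_abs_angInt_le {w : ℝ → ℝ} (h1 : ∀ α, |w α| ≤ Real.sin α ^ 2) {u : ℝ} (hu : 0 ≤ u) :
    u * |angInt w u| ≤ angMass (u / 2) := by
  rcases hu.eq_or_lt with rfl | hu
  · simp only [zero_mul]
    unfold angMass angInt
    exact intervalIntegral.integral_nonneg neg_pi_half_le fun α _ => by positivity
  have := abs_angInt_le_of_le (w := w) (u := u) (v := u / 2) (c := 1 / u) ?_
  · rw [one_div, inv_mul_eq_div, le_div_iff₀ hu] at this
    linarith
  · intro α
    have h2 := le_exp_half (u * Real.sin α ^ 2)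
    have h3 : Real.exp (-u * Real.sin α ^ 2) * Real.exp (u * Real.sin α ^ 2 / 2) =
        Real.exp (-(u / 2) * Real.sin α ^ 2) := by
      rw [← Real.exp_add]; ring_nf
    rw [div_mul_eq_mul_div, le_div_iff₀ hu, one_mul, ← h3, mul_assoc]
    gcongr
    calc _ ≤ Real.sin α ^ 2 * u := by gcongr; exact h1 α
      _ ≤ _ := by rw [mul_comm]; exact h2

theorem angMass_nonneg (u : ℝ) : 0 ≤ angMass u := by
  unfold angMass angInt
  exact intervalIntegral.integral_nonneg neg_pi_half_le fun α _ => by positivity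

theorem angMass_le_pi {u : ℝ} (hu : 0 ≤ u) : angMass u ≤ Real.pi := by
  have : angMass u ≤ ∫ α in (-(Real.pi / 2))..(Real.pi / 2), (1 : ℝ) := by
    unfold angMass angInt
    refine intervalIntegral.integral_mono_on neg_pi_half_le
      (Continuous.intervalIntegrable (by fun_prop) _ _) (by simp) fun α _ => ?_
    rw [mul_one, Real.exp_le_one_iff]
    nlinarith [sq_nonneg (Real.sin α)]
  simpa using this

/-- Jordan's inequality `|sin α| ≥ 2|α|/π` compares the integrand with a Gaussian of total mass
`π^(3/2) / (2√u)`, and `π^(3/2)/2 < 3`. -/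
theorem angMass_mul_sqrt_le {u : ℝ} (hu : 0 < u) : angMass u * √u ≤ 3 := by
  have hb : 0 < 4 * u / Real.pi ^ 2 := by positivity
  have h1 : angMass u ≤ √(Real.pi / (4 * u / Real.pi ^ 2)) := by
    rw [← integral_gaussian]
    unfold angMass angInt
    rw [intervalIntegral.integral_of_le neg_pi_half_le]
    refine (setIntegral_mono_on (g := fun x => Real.exp (-(4 * u / Real.pi ^ 2) * x ^ 2))
      ?_ ?_ measurableSet_Ioc ?_).trans ?_
    · exact (Continuous.integrableOn_Icc (by fun_prop)).mono_set Set.Ioc_subset_Icc_self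
    · exact (integrable_exp_neg_mul_sq hb).integrableOn
    · intro α hα
      rw [mul_one, Real.exp_le_exp]
      have h2 : 2 / Real.pi * |α| ≤ |Real.sin α| :=
        Real.mul_abs_le_abs_sin (abs_le.2 ⟨hα.1.le, hα.2⟩)
      have h3 : (2 / Real.pi * |α|) ^ 2 ≤ |Real.sin α| ^ 2 := by gcongr
      rw [mul_pow, sq_abs, sq_abs] at h3
      have : 4 * u / Real.pi ^ 2 * α ^ 2 = u * ((2 / Real.pi) ^ 2 * α ^ 2) := by ring
      rw [neg_mul, neg_mul, this]
      nlinarith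
    · exact setIntegral_le_integral (integrable_exp_neg_mul_sq hb)
        (Filter.Eventually.of_forall fun _ => by positivity)
  have h2 : √(Real.pi / (4 * u / Real.pi ^ 2)) * √u ≤ 3 := by
    rw [← Real.sqrt_mul (by positivity)]
    apply Real.sqrt_le_iff.2 ⟨by norm_num, ?_⟩
    have : Real.pi / (4 * u / Real.pi ^ 2) * u = Real.pi ^ 3 / 4 := by
      field_simp
    rw [this]
    have := Real.pi_lt_d2
    have h0 := Real.pi_pos
    have : Real.pi ^ 3 ≤ 3.15 ^ 3 := by gcongr
    norm_num at this
    linarith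
  exact (mul_le_mul_of_nonneg_right h1 (Real.sqrt_nonneg _)).trans h2

/-- This is the estimate that makes the factor `r'` of the kernels harmless. If `b ≤ 2a` then `ab ≥
b²/2`, and the decay of `angMass` turns `b` into `√t`. If `b > 2a` then `b ≤ 2|a-b|`, and `angMass ≤
π` is enough. -/
theorem mul_angMass_le {a b t : ℝ} (ha : 0 < a) (hb : 0 < b) (ht : 0 < t) :
    b * angMass (a * b / t / 2) ≤ 7 * (√t + |a - b|) := by
  have hE := angMass_nonneg (a * b / t / 2)
  have hu : 0 < a * b / t / 2 := by positivity
  rcases le_or_gt b (2 * a) with h | h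
  · have h1 := angMass_mul_sqrt_le hu
    have h2 : b ≤ 2 * √t * √(a * b / t / 2) := by
      rw [mul_assoc, ← Real.sqrt_mul ht.le]
      have : t * (a * b / t / 2) = a * b / 2 := by field_simp
      rw [this]
      have : b / 2 ≤ √(a * b / 2) := Real.le_sqrt_of_sq_le (by nlinarith)
      linarith
    have h3 := Real.sqrt_nonneg t
    have h4 := abs_nonneg (a - b)
    calc _ ≤ 2 * √t * √(a * b / t / 2) * angMass (a * b / t / 2) := by gcongr
      _ = 2 * √t * (angMass (a * b / t / 2) * √(a * b / t / 2)) := by ring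
      _ ≤ 2 * √t * 3 := by gcongr
      _ ≤ _ := by linarith
  · have h1 := angMass_le_pi hu.le
    have h2 : b ≤ 2 * |a - b| := by
      have := neg_abs_le (a - b); linarith
    have h3 := Real.sqrt_nonneg t
    have := Real.pi_lt_d2
    calc _ ≤ 2 * |a - b| * 3.15 := by
          gcongr; linarith
      _ ≤ _ := by linarith [abs_nonneg (a - b)]

/-! ### The kernels and their pointwise bounds -/

/-- The squared distance of two points of the plane. -/
def sqDist (x y : ℝ × ℝ) : ℝ := (x.1 - y.1) ^ 2 + (x.2 - y.2) ^ 2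

/-- The planar Gaussian of variance parameter `b`. -/
def gauss (b : ℝ) (x y : ℝ × ℝ) : ℝ := Real.exp (-sqDist x y / b)

/-- The time factor of the kernels. -/
def kap (t : ℝ) : ℝ := 1 / (4 * Real.pi * t * √(Real.pi * t))

/-- The kernel with angular weight `w`, which is smooth in all of the plane. -/
def wKernel (w : ℝ → ℝ) (t : ℝ) (x y : ℝ × ℝ) : ℝ :=
  kap t * y.1 * angInt w (x.1 * y.1 / t) * gauss (4 * t) x y

theorem sqDist_nonneg (x y : ℝ × ℝ) : 0 ≤ sqDist x y := by unfold sqDist; positivity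

theorem gauss_pos (b : ℝ) (x y : ℝ × ℝ) : 0 < gauss b x y := Real.exp_pos _

theorem continuous_wKernel {w : ℝ → ℝ} (hw : Continuous w) (t : ℝ) :
    Continuous fun p : (ℝ × ℝ) × (ℝ × ℝ) => wKernel w t p.1 p.2 := by
  have := continuous_angInt hw
  unfold wKernel gauss sqDist
  fun_prop

theorem continuous_gauss (b : ℝ) :
    Continuous fun p : (ℝ × ℝ) × (ℝ × ℝ) => gauss b p.1 p.2 := by
  unfold gauss sqDist
  fun_prop

/-- The weight `cos (2 α)` of the swirl kernel. -/
def cosWeight (α : ℝ) : ℝ := Real.cos (2 * α)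

theorem continuous_cosWeight : Continuous cosWeight := by unfold cosWeight; fun_prop

theorem abs_cosWeight_le (α : ℝ) : |cosWeight α| ≤ 1 := Real.abs_cos_le_one _

/-- The weight `1` of the scalar kernel. -/
def oneWeight (_ : ℝ) : ℝ := 1

theorem continuous_oneWeight : Continuous oneWeight := continuous_const

theorem abs_oneWeight_le (α : ℝ) : |oneWeight α| ≤ 1 := by simp [oneWeight]

/-- The singularity at the axis is only apparent: `√b/√a` meets `√a√b` from the prefactor of `N1` or
`N2`, and their product is `b`. -/
theorem kernelOf_prefactor {t a b : ℝ} (ht : 0 < t) (ha : 0 < a) (hb : 0 < b) (I e : ℝ) :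
    1 / (4 * Real.pi * t) * (√b / √a) * (1 / √(Real.pi * (t / (a * b))) * I) * e =
      kap t * b * I * e := by
  have h1 : √(Real.pi * (t / (a * b))) = √(Real.pi * t) / (√a * √b) := by
    rw [← mul_div_assoc, Real.sqrt_div (by positivity), Real.sqrt_mul ha.le]
  have h2 : √b * √b = b := Real.mul_self_sqrt hb.le
  have h3 : 0 < √a := Real.sqrt_pos.2 ha
  have h4 : 0 < √b := Real.sqrt_pos.2 hb
  have h5 : 0 < √(Real.pi * t) := Real.sqrt_pos.2 (by positivity)
  rw [h1, kap]
  field_simp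
  rw [pow_two, h2]
  ring

theorem neg_div_div_eq (s t a : ℝ) : -s / (t / a) = -(a / t) * s := by
  rw [div_div_eq_mul_div]; ring

theorem K1_eq {t : ℝ} (ht : 0 < t) {x y : ℝ × ℝ} (hx : x ∈ Omega) (hy : y ∈ Omega) :
    K1 t x y = wKernel cosWeight t x y := by
  unfold K1 kernelOf N1
  rw [kernelOf_prefactor ht hx hy]
  simp only [wKernel, angInt, cosWeight, gauss, sqDist, neg_div_div_eq]

theorem K2_eq {t : ℝ} (ht : 0 < t) {x y : ℝ × ℝ} (hx : x ∈ Omega) (hy : y ∈ Omega) :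
    K2 t x y = wKernel oneWeight t x y := by
  unfold K2 kernelOf N2
  rw [kernelOf_prefactor ht hx hy]
  simp only [wKernel, angInt, oneWeight, gauss, sqDist, neg_div_div_eq, mul_one]

theorem kap_pos {t : ℝ} (ht : 0 < t) : 0 < kap t := by
  unfold kap
  have := Real.pi_pos
  positivity

theorem kap_le {t : ℝ} (ht : 0 < t) : kap t ≤ 1 / (t * √t) := by
  unfold kap
  have h0 := Real.pi_gt_three
  have h1 : √t ≤ √(Real.pi * t) := Real.sqrt_le_sqrt (by nlinarith)
  have : 0 < √t := Real.sqrt_pos.2 ht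
  apply one_div_le_one_div_of_le (by positivity)
  gcongr
  nlinarith

/-- Squaring `1 + v ≤ 16 exp(v/16)` costs `exp(v/8)`, half of the available decay. -/
theorem one_add_sq_mul_exp_le {v : ℝ} (hv : 0 ≤ v) :
    (1 + v) ^ 2 * Real.exp (-v / 4) ≤ 256 * Real.exp (-v / 8) := by
  have h1 : 1 + v ≤ 16 * Real.exp (v / 16) := by
    have := Real.add_one_le_exp (v / 16); linarith
  have h2 : (1 + v) ^ 2 ≤ (16 * Real.exp (v / 16)) ^ 2 := by gcongr
  have h3 : Real.exp (v / 16) ^ 2 * Real.exp (-v / 4) = Real.exp (-v / 8) := by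
    rw [← Real.exp_nat_mul, ← Real.exp_add]; congr 1; push_cast; ring
  calc _ ≤ (16 * Real.exp (v / 16)) ^ 2 * Real.exp (-v / 4) := by gcongr
    _ = 256 * (Real.exp (v / 16) ^ 2 * Real.exp (-v / 4)) := by ring
    _ = _ := by rw [h3]

/-- The Gaussian absorbs quadratic factors, at the price of a larger variance. -/
theorem abs_mul_gauss_le {t : ℝ} (ht : 0 < t) {x y : ℝ × ℝ} {X c : ℝ}
    (hX : |X| ≤ c * (1 + sqDist x y / t) ^ 2) :
    |kap t * X * gauss (4 * t) x y| ≤ 256 * c / (t * √t) * gauss (8 * t) x y := by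
  have hv : 0 ≤ sqDist x y / t := div_nonneg (sqDist_nonneg _ _) ht.le
  have hst : 0 < √t := Real.sqrt_pos.2 ht
  have hc : 0 ≤ c := by
    by_contra h
    push Not at h
    have := abs_nonneg X
    have : 0 < (1 + sqDist x y / t) ^ 2 := by positivity
    nlinarith
  have e1 : gauss (4 * t) x y = Real.exp (-(sqDist x y / t) / 4) := by
    unfold gauss; congr 1; field_simp
  have e2 : gauss (8 * t) x y = Real.exp (-(sqDist x y / t) / 8) := by
    unfold gauss; congr 1; field_simp
  rw [abs_mul, abs_mul, abs_of_pos (kap_pos ht), abs_of_pos (gauss_pos _ _ _), e1, e2]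
  have h := one_add_sq_mul_exp_le hv
  calc _ ≤ 1 / (t * √t) * (c * (1 + sqDist x y / t) ^ 2) * Real.exp (-(sqDist x y / t) / 4) := by
        gcongr
        exact kap_le ht
    _ = c / (t * √t) * ((1 + sqDist x y / t) ^ 2 * Real.exp (-(sqDist x y / t) / 4)) := by ring
    _ ≤ c / (t * √t) * (256 * Real.exp (-(sqDist x y / t) / 8)) := by gcongr
    _ = _ := by ring

/-- With `v = sqDist x y / t` this is `√v ≤ 1 + v`. The wasteful form keeps all factors polynomial
in `v`, ready for `abs_mul_gauss_le`. -/
theorem abs_fst_sub_le {t : ℝ} (ht : 0 < t) (x y : ℝ × ℝ) :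
    |x.1 - y.1| ≤ √t * (1 + sqDist x y / t) := by
  have hv : 0 ≤ sqDist x y / t := div_nonneg (sqDist_nonneg _ _) ht.le
  have hst : 0 ≤ √t := Real.sqrt_nonneg _
  apply abs_le_of_sq_le_sq _ (by positivity)
  rw [mul_pow, Real.sq_sqrt ht.le]
  have : t * (1 + sqDist x y / t) ^ 2 = t * (1 + (sqDist x y / t) ^ 2) + 2 * sqDist x y := by
    field_simp; ring
  rw [this]
  have h2 : 0 ≤ t * (1 + (sqDist x y / t) ^ 2) := by positivity
  unfold sqDist at *
  nlinarith [sq_nonneg (x.1 - y.1), sq_nonneg (x.2 - y.2)]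

theorem abs_snd_sub_le {t : ℝ} (ht : 0 < t) (x y : ℝ × ℝ) :
    |x.2 - y.2| ≤ √t * (1 + sqDist x y / t) := by
  have := abs_fst_sub_le ht x.swap y.swap
  rwa [show sqDist x.swap y.swap = sqDist x y by simp [sqDist, add_comm]] at this

theorem mul_angMass_le_sqDist {t : ℝ} (ht : 0 < t) {x y : ℝ × ℝ} (hx : x ∈ Omega)
    (hy : y ∈ Omega) :
    y.1 * angMass (x.1 * y.1 / t / 2) ≤ 14 * √t * (1 + sqDist x y / t) := by
  have h := mul_angMass_le hx hy ht
  have h1 := abs_fst_sub_le ht x y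
  have hv : 0 ≤ sqDist x y / t := div_nonneg (sqDist_nonneg _ _) ht.le
  have hst : 0 ≤ √t := Real.sqrt_nonneg _
  nlinarith [mul_nonneg hst hv]

theorem mul_abs_angInt_le_sqDist {w : ℝ → ℝ} (h1 : ∀ α, |w α| ≤ 1) {t : ℝ} (ht : 0 < t)
    {x y : ℝ × ℝ} (hx : x ∈ Omega) (hy : y ∈ Omega) :
    y.1 * |angInt w (x.1 * y.1 / t)| ≤ 14 * √t * (1 + sqDist x y / t) := by
  have hy0 : 0 < y.1 := hy
  have hx0 : 0 < x.1 := hx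
  refine le_trans ?_ (mul_angMass_le_sqDist ht hx hy)
  gcongr
  exact abs_angInt_le h1 (by positivity)

theorem abs_angInt_le_four {w : ℝ → ℝ} (h1 : ∀ α, |w α| ≤ 1) {u : ℝ} (hu : 0 ≤ u) :
    |angInt w u| ≤ 3.15 :=
  ((abs_angInt_le h1 hu).trans (angMass_le_pi (by positivity))).trans Real.pi_lt_d2.le

theorem abs_wKernel_le {w : ℝ → ℝ} (h1 : ∀ α, |w α| ≤ 1) {t : ℝ} (ht : 0 < t)
    {x y : ℝ × ℝ} (hx : x ∈ Omega) (hy : y ∈ Omega) :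
    |wKernel w t x y| ≤ 3584 / t * gauss (8 * t) x y := by
  have hy0 : 0 < y.1 := hy
  have hst : 0 < √t := Real.sqrt_pos.2 ht
  have hv : 0 ≤ sqDist x y / t := div_nonneg (sqDist_nonneg _ _) ht.le
  have h := abs_mul_gauss_le ht (x := x) (y := y)
    (X := y.1 * angInt w (x.1 * y.1 / t)) (c := 14 * √t) ?_
  · rw [← mul_assoc] at h
    refine h.trans (le_of_eq ?_)
    field_simp
    ring
  · rw [abs_mul, abs_of_pos hy0]
    refine (mul_abs_angInt_le_sqDist h1 ht hx hy).trans ?_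
    gcongr
    nlinarith

/-- Division removes the explicit factor `r'`, so boundedness of the angular integral suffices. This
serves both the term `f^r / r` of `div` and the derivative of the cutoff near the axis. -/
theorem abs_wKernel_div_le {w : ℝ → ℝ} (h1 : ∀ α, |w α| ≤ 1) {t : ℝ} (ht : 0 < t)
    {x y : ℝ × ℝ} (hx : x ∈ Omega) (hy : y ∈ Omega) :
    |wKernel w t x y / y.1| ≤ 3584 / (t * √t) * gauss (8 * t) x y := by
  have hy0 : 0 < y.1 := hy
  have hx0 : 0 < x.1 := hx
  have hst : 0 < √t := Real.sqrt_pos.2 ht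
  have hv : 0 ≤ sqDist x y / t := div_nonneg (sqDist_nonneg _ _) ht.le
  have h := abs_mul_gauss_le ht (x := x) (y := y)
    (X := angInt w (x.1 * y.1 / t)) (c := 14) ?_
  · have e : wKernel w t x y / y.1 = kap t * angInt w (x.1 * y.1 / t) * gauss (4 * t) x y := by
      unfold wKernel; field_simp
    rw [e]
    refine h.trans (le_of_eq ?_)
    norm_num
  · refine (abs_angInt_le_four h1 (by positivity)).trans ?_
    nlinarith

/-- A weight vanishing like `sin² α` gains the factor `√t/r'`. For `r' ≤ 2r` the gain comes from the
boundedness of `u |angInt w u|` at `u = r r'/t`; for `r' > 2r` it comes from `r'² ≤ 4 |x-y|²`. -/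
theorem abs_wKernel_sq_le {w : ℝ → ℝ} (h1 : ∀ α, |w α| ≤ Real.sin α ^ 2) {t : ℝ} (ht : 0 < t)
    {x y : ℝ × ℝ} (hx : x ∈ Omega) (hy : y ∈ Omega) :
    |wKernel w t x y| ≤ 3584 / t * (√t / y.1) * gauss (8 * t) x y := by
  have hy0 : 0 < y.1 := hy
  have hx0 : 0 < x.1 := hx
  have hst : 0 < √t := Real.sqrt_pos.2 ht
  have hv : 0 ≤ sqDist x y / t := div_nonneg (sqDist_nonneg _ _) ht.le
  have h := abs_mul_gauss_le ht (x := x) (y := y)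
    (X := y.1 * angInt w (x.1 * y.1 / t)) (c := 14 * t / y.1) ?_
  · rw [← mul_assoc] at h
    refine h.trans (le_of_eq ?_)
    have : √t * √t = t := Real.mul_self_sqrt ht.le
    field_simp
    rw [pow_two, this]; ring
  · have h2 : ∀ α, |w α| ≤ 1 := fun α => (h1 α).trans (Real.sin_sq_le_one α)
    have hu : 0 < x.1 * y.1 / t := by positivity
    have h3 := abs_angInt_le_four h2 hu.le
    have h4 := mul_abs_angInt_le h1 hu.le
    have h5 := (h4.trans (angMass_le_pi (by positivity))).trans Real.pi_lt_d2.le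
    rw [abs_mul, abs_of_pos hy0, div_mul_eq_mul_div, le_div_iff₀ hy0]
    rcases le_or_gt y.1 (2 * x.1) with h | h
    · calc _ = y.1 * y.1 * |angInt w (x.1 * y.1 / t)| := by ring
        _ ≤ 2 * x.1 * y.1 * |angInt w (x.1 * y.1 / t)| := by gcongr
        _ = 2 * t * (x.1 * y.1 / t * |angInt w (x.1 * y.1 / t)|) := by field_simp
        _ ≤ 2 * t * 3.15 := by gcongr
        _ ≤ 14 * t * 1 := by linarith
        _ ≤ _ := by gcongr; nlinarith
    · have h6 : y.1 * y.1 ≤ 4 * sqDist x y := by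
        unfold sqDist
        nlinarith [sq_nonneg (x.2 - y.2)]
      have h7 : sqDist x y = t * (sqDist x y / t) := by field_simp
      calc _ = y.1 * y.1 * |angInt w (x.1 * y.1 / t)| := by ring
        _ ≤ (4 * sqDist x y) * 3.15 := by
          have := sqDist_nonneg x y
          gcongr
        _ ≤ 14 * sqDist x y := by linarith [sqDist_nonneg x y]
        _ = 14 * t * (sqDist x y / t) := by rw [mul_assoc, ← h7]
        _ ≤ _ := by gcongr; nlinarith

/-! ### Derivatives of the kernels -/

/-- The derivative of `wKernel w t x` in the radial variable. -/
def drKernel (w : ℝ → ℝ) (t : ℝ) (x y : ℝ × ℝ) : ℝ :=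
  kap t * (angInt w (x.1 * y.1 / t) + x.1 * y.1 / t * angInt (dweight w) (x.1 * y.1 / t) +
    y.1 * angInt w (x.1 * y.1 / t) * ((x.1 - y.1) / (2 * t))) * gauss (4 * t) x y

/-- The derivative of `wKernel w t x` in the vertical variable. -/
def dzKernel (w : ℝ → ℝ) (t : ℝ) (x y : ℝ × ℝ) : ℝ :=
  kap t * (y.1 * angInt w (x.1 * y.1 / t) * ((x.2 - y.2) / (2 * t))) * gauss (4 * t) x y

/-- The time derivative of the kernel. -/
def dtKernel (w : ℝ → ℝ) (t : ℝ) (x y : ℝ × ℝ) : ℝ :=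
  kap t * (y.1 * (-(3 / 2) * angInt w (x.1 * y.1 / t) -
    x.1 * y.1 / t * angInt (dweight w) (x.1 * y.1 / t) +
    angInt w (x.1 * y.1 / t) * (sqDist x y / t / 4)) / t) * gauss (4 * t) x y

theorem continuous_drKernel {w : ℝ → ℝ} (hw : Continuous w) (t : ℝ) :
    Continuous fun p : (ℝ × ℝ) × (ℝ × ℝ) => drKernel w t p.1 p.2 := by
  have := continuous_angInt hw
  have := continuous_angInt (continuous_dweight hw)
  unfold drKernel gauss sqDist
  fun_prop

theorem continuous_dzKernel {w : ℝ → ℝ} (hw : Continuous w) (t : ℝ) :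
    Continuous fun p : (ℝ × ℝ) × (ℝ × ℝ) => dzKernel w t p.1 p.2 := by
  have := continuous_angInt hw
  unfold dzKernel gauss sqDist
  fun_prop

theorem contDiff_angInt {w : ℝ → ℝ} (hw : Continuous w) (h1 : ∀ α, |w α| ≤ 1) :
    ContDiff ℝ 1 (angInt w) := by
  rw [contDiff_one_iff_deriv]
  refine ⟨fun u => (hasDerivAt_angInt hw h1 u).differentiableAt, ?_⟩
  rw [show deriv (angInt w) = angInt (dweight w) from
    funext fun u => (hasDerivAt_angInt hw h1 u).deriv]
  exact continuous_angInt (continuous_dweight hw)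

theorem contDiff_wKernel {w : ℝ → ℝ} (hw : Continuous w) (h1 : ∀ α, |w α| ≤ 1) (t : ℝ)
    (x : ℝ × ℝ) : ContDiff ℝ 1 (wKernel w t x) := by
  have := contDiff_angInt hw h1
  unfold wKernel gauss sqDist
  fun_prop

theorem hasDerivAt_wKernel_fst {w : ℝ → ℝ} (hw : Continuous w) (h1 : ∀ α, |w α| ≤ 1) {t : ℝ}
    (ht : 0 < t) (x y : ℝ × ℝ) :
    HasDerivAt (fun s => wKernel w t x (s, y.2)) (drKernel w t x y) y.1 := by
  have hu : HasDerivAt (fun s : ℝ => x.1 * s / t) (x.1 * 1 / t) y.1 :=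
    ((hasDerivAt_id y.1).const_mul x.1).div_const t
  have hA := (hasDerivAt_angInt hw h1 (x.1 * y.1 / t)).comp y.1 hu
  have hg : HasDerivAt (fun s : ℝ => -((x.1 - s) ^ 2 + (x.2 - y.2) ^ 2) / (4 * t))
      ((x.1 - y.1) / (2 * t)) y.1 := by
    refine ((((((hasDerivAt_id y.1).const_sub x.1).pow 2).add_const _).neg).div_const
      (4 * t)).congr_deriv ?_
    simp only [id]
    field_simp
    ring
  refine ((((hasDerivAt_id y.1).const_mul (kap t)).mul hA).mul hg.exp).congr_deriv ?_
  simp only [drKernel, gauss, sqDist, id, Function.comp, Pi.mul_apply]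
  ring

theorem hasDerivAt_wKernel_snd (w : ℝ → ℝ) {t : ℝ} (ht : 0 < t) (x y : ℝ × ℝ) :
    HasDerivAt (fun s => wKernel w t x (y.1, s)) (dzKernel w t x y) y.2 := by
  have hg : HasDerivAt (fun s : ℝ => -((x.1 - y.1) ^ 2 + (x.2 - s) ^ 2) / (4 * t))
      ((x.2 - y.2) / (2 * t)) y.2 := by
    refine ((((((hasDerivAt_id y.2).const_sub x.2).pow 2).const_add _).neg).div_const
      (4 * t)).congr_deriv ?_
    simp only [id]
    field_simp
    ring
  refine (hg.exp.const_mul (kap t * y.1 * angInt w (x.1 * y.1 / t))).congr_deriv ?_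
  simp only [dzKernel, gauss, sqDist]
  ring

theorem hasDerivAt_kap {t : ℝ} (ht : 0 < t) : HasDerivAt kap (-(3 / 2) * kap t / t) t := by
  have h0 : 0 < Real.pi * t := by positivity
  have h1 : HasDerivAt (fun s : ℝ => √(Real.pi * s)) (Real.pi * 1 / (2 * √(Real.pi * t))) t :=
    ((hasDerivAt_id t).const_mul Real.pi).sqrt h0.ne'
  have h2 := ((hasDerivAt_id t).const_mul (4 * Real.pi)).mul h1
  have h3 : 0 < √(Real.pi * t) := Real.sqrt_pos.2 h0
  have hne : 4 * Real.pi * t * √(Real.pi * t) ≠ 0 := by positivity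
  refine ((hasDerivAt_const t (1 : ℝ)).div h2 hne).congr_deriv ?_
  have h4 : √(Real.pi * t) ^ 2 = Real.pi * t := Real.sq_sqrt h0.le
  simp only [kap, id, Pi.mul_apply]
  field_simp
  rw [h4]
  ring

theorem hasDerivAt_wKernel_time {w : ℝ → ℝ} (hw : Continuous w) (h1 : ∀ α, |w α| ≤ 1) {t : ℝ}
    (ht : 0 < t) (x y : ℝ × ℝ) :
    HasDerivAt (fun s => wKernel w s x y) (dtKernel w t x y) t := by
  have hu : HasDerivAt (fun s : ℝ => x.1 * y.1 / s) (-(x.1 * y.1 / t / t)) t := by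
    refine ((hasDerivAt_const t (x.1 * y.1)).div (hasDerivAt_id t) ht.ne').congr_deriv ?_
    simp only [id]
    field_simp
    ring
  have hA := (hasDerivAt_angInt hw h1 (x.1 * y.1 / t)).comp t hu
  have hg : HasDerivAt (fun s : ℝ => -sqDist x y / (4 * s)) (sqDist x y / t / 4 / t) t := by
    refine ((hasDerivAt_const t (-sqDist x y)).div ((hasDerivAt_id t).const_mul 4)
      (by simp [ht.ne'])).congr_deriv ?_
    simp only [id]
    field_simp
    ring
  refine ((((hasDerivAt_kap ht).mul_const y.1).mul hA).mul hg.exp).congr_deriv ?_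
  simp only [dtKernel, gauss, Function.comp, Pi.mul_apply]
  ring

theorem abs_drKernel_le {w : ℝ → ℝ} (h1 : ∀ α, |w α| ≤ 1) {t : ℝ} (ht : 0 < t)
    {x y : ℝ × ℝ} (hx : x ∈ Omega) (hy : y ∈ Omega) :
    |drKernel w t x y| ≤ 3584 / (t * √t) * gauss (8 * t) x y := by
  have hy0 : 0 < y.1 := hy
  have hx0 : 0 < x.1 := hx
  have hst : 0 < √t := Real.sqrt_pos.2 ht
  have hu : 0 < x.1 * y.1 / t := by positivity
  have hv : 0 ≤ sqDist x y / t := div_nonneg (sqDist_nonneg _ _) ht.le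
  -- The three terms of the derivative contribute at most `3.15 + 3.15 + 7 ≤ 14` times `(1 + v)²`,
  -- where `v = sqDist x y / t`.
  refine (abs_mul_gauss_le ht (c := 14) ?_).trans (le_of_eq (by norm_num))
  have a1 := abs_angInt_le_four h1 hu.le
  have a2 := ((mul_abs_angInt_le (abs_dweight_le_sin_sq h1) hu.le).trans
    (angMass_le_pi (by positivity))).trans Real.pi_lt_d2.le
  have a3 : |y.1 * angInt w (x.1 * y.1 / t) * ((x.1 - y.1) / (2 * t))| ≤
      7 * (1 + sqDist x y / t) ^ 2 := by
    rw [abs_mul, abs_mul, abs_of_pos hy0, abs_div, abs_of_pos (show 0 < 2 * t by positivity)]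
    calc _ ≤ 14 * √t * (1 + sqDist x y / t) * (√t * (1 + sqDist x y / t) / (2 * t)) := by
          refine mul_le_mul (mul_abs_angInt_le_sqDist h1 ht hx hy) ?_ (by positivity) (by positivity)
          gcongr
          exact abs_fst_sub_le ht x y
      _ = 7 * (√t * √t / t) * (1 + sqDist x y / t) ^ 2 := by field_simp; ring
      _ = _ := by rw [Real.mul_self_sqrt ht.le, div_self ht.ne', mul_one]
  refine (abs_add_three _ _ _).trans ?_
  rw [abs_mul (x.1 * y.1 / t), abs_of_pos hu]
  nlinarith

theorem abs_dzKernel_le {w : ℝ → ℝ} (h1 : ∀ α, |w α| ≤ 1) {t : ℝ} (ht : 0 < t)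
    {x y : ℝ × ℝ} (hx : x ∈ Omega) (hy : y ∈ Omega) :
    |dzKernel w t x y| ≤ 3584 / (t * √t) * gauss (8 * t) x y := by
  have hy0 : 0 < y.1 := hy
  have hst : 0 < √t := Real.sqrt_pos.2 ht
  have hv : 0 ≤ sqDist x y / t := div_nonneg (sqDist_nonneg _ _) ht.le
  refine (abs_mul_gauss_le ht (c := 14) ?_).trans (le_of_eq (by norm_num))
  rw [abs_mul, abs_mul, abs_of_pos hy0, abs_div, abs_of_pos (show 0 < 2 * t by positivity)]
  calc _ ≤ 14 * √t * (1 + sqDist x y / t) * (√t * (1 + sqDist x y / t) / (2 * t)) := by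
        refine mul_le_mul (mul_abs_angInt_le_sqDist h1 ht hx hy) ?_ (by positivity) (by positivity)
        gcongr
        exact abs_snd_sub_le ht x y
    _ = 7 * (√t * √t / t) * (1 + sqDist x y / t) ^ 2 := by field_simp; ring
    _ ≤ 14 * (√t * √t / t) * (1 + sqDist x y / t) ^ 2 := by gcongr; norm_num
    _ = _ := by rw [Real.mul_self_sqrt ht.le, div_self ht.ne', mul_one]

theorem abs_dtKernel_le {w : ℝ → ℝ} (h1 : ∀ α, |w α| ≤ 1) {t : ℝ} (ht : 0 < t)
    {x y : ℝ × ℝ} (hx : x ∈ Omega) (hy : y ∈ Omega) :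
    |dtKernel w t x y| ≤ 10752 / t ^ 2 * gauss (8 * t) x y := by
  have hy0 : 0 < y.1 := hy
  have hx0 : 0 < x.1 := hx
  have hst : 0 < √t := Real.sqrt_pos.2 ht
  have hu : 0 < x.1 * y.1 / t := by positivity
  have hv : 0 ≤ sqDist x y / t := div_nonneg (sqDist_nonneg _ _) ht.le
  -- `42 = 14 · 3`: with `v = sqDist x y / t`, the terms add up to `14√t (1 + v)(5/2 + v/4)`, and
  -- the product of brackets is at most `3(1 + v)²`.
  refine (abs_mul_gauss_le ht (c := 42 * √t / t) ?_).trans (le_of_eq (by field_simp; ring))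
  have a1 := mul_abs_angInt_le_sqDist h1 ht hx hy
  have a2 : y.1 * (x.1 * y.1 / t * |angInt (dweight w) (x.1 * y.1 / t)|) ≤
      14 * √t * (1 + sqDist x y / t) := by
    refine le_trans ?_ (mul_angMass_le_sqDist ht hx hy)
    gcongr
    exact mul_abs_angInt_le (abs_dweight_le_sin_sq h1) hu.le
  set A := angInt w (x.1 * y.1 / t)
  set B := angInt (dweight w) (x.1 * y.1 / t)
  set v := sqDist x y / t
  set u := x.1 * y.1 / t
  have a3 : |-(3 / 2) * A - u * B + A * (v / 4)| ≤ 3 / 2 * |A| + u * |B| + |A| * (v / 4) := by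
    refine (abs_add_le _ _).trans ?_
    refine (add_le_add_left (abs_sub _ _) _).trans (le_of_eq ?_)
    rw [abs_mul, abs_mul, abs_mul, abs_of_pos hu, abs_of_nonneg (show 0 ≤ v / 4 by positivity)]
    norm_num
  rw [abs_div, abs_mul, abs_of_pos hy0, abs_of_pos ht,
    show 42 * √t / t * (1 + v) ^ 2 = 42 * √t * (1 + v) ^ 2 / t by ring]
  refine div_le_div_of_nonneg_right ?_ ht.le
  calc _ ≤ y.1 * (3 / 2 * |A| + u * |B| + |A| * (v / 4)) := by gcongr
    _ = 3 / 2 * (y.1 * |A|) + y.1 * (u * |B|) + (y.1 * |A|) * (v / 4) := by ring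
    _ ≤ 3 / 2 * (14 * √t * (1 + v)) + 14 * √t * (1 + v) + (14 * √t * (1 + v)) * (v / 4) := by
        have := mul_le_mul_of_nonneg_right a1 (show 0 ≤ v / 4 by positivity)
        linarith
    _ = 14 * √t * ((1 + v) * (5 / 2 + v / 4)) := by ring
    _ ≤ 14 * √t * (3 * (1 + v) ^ 2) :=
        mul_le_mul_of_nonneg_left (by nlinarith) (by positivity)
    _ = _ := by ring

/-! ### Young's inequality for kernels with a Gaussian majorant -/

instance : SFinite muOmega := by unfold muOmega; infer_instance

theorem measurableSet_Omega : MeasurableSet Omega :=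
  measurableSet_lt measurable_const measurable_fst

theorem ae_mem_Omega : ∀ᵐ x ∂muOmega, x ∈ Omega := ae_restrict_mem measurableSet_Omega

theorem one_div_toReal_le_one {p : ℝ≥0∞} (hp : 1 ≤ p) : 1 / p.toReal ≤ 1 := by
  rcases eq_or_ne p ∞ with rfl | hp'
  · simp
  · have : 1 ≤ p.toReal := by
      rw [← ENNReal.toReal_one]; exact ENNReal.toReal_mono hp' hp
    rw [div_le_one (by linarith)]; exact this

/-- The planar Gaussian with values in `ℝ≥0∞`. -/
def egauss (b : ℝ) (x y : ℝ × ℝ) : ℝ≥0∞ := ENNReal.ofReal (gauss b x y)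

theorem measurable_egauss (b : ℝ) :
    Measurable fun p : (ℝ × ℝ) × (ℝ × ℝ) => egauss b p.1 p.2 :=
  (continuous_gauss b).measurable.ennreal_ofReal

theorem measurable_egauss_right (b : ℝ) (x : ℝ × ℝ) : Measurable (egauss b x) := by
  unfold egauss gauss sqDist; fun_prop

theorem egauss_comm (b : ℝ) (x y : ℝ × ℝ) : egauss b x y = egauss b y x := by
  unfold egauss gauss sqDist; rw [show (x.1 - y.1) ^ 2 + (x.2 - y.2) ^ 2 = (y.1 - x.1) ^ 2 + (y.2 - x.2) ^ 2 by ring]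

theorem egauss_le_one {b : ℝ} (hb : 0 < b) (x y : ℝ × ℝ) : egauss b x y ≤ 1 := by
  rw [egauss, ENNReal.ofReal_le_one, gauss, Real.exp_le_one_iff]
  have := sqDist_nonneg x y
  exact div_nonpos_of_nonpos_of_nonneg (by linarith) hb.le

theorem lintegral_gauss_line {b : ℝ} (hb : 0 < b) (a : ℝ) :
    ∫⁻ s : ℝ, ENNReal.ofReal (Real.exp (-(1 / b) * (a - s) ^ 2)) =
      ENNReal.ofReal √(Real.pi * b) := by
  have hb' : 0 < 1 / b := by positivity
  have h := integral_gaussian (1 / b)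
  rw [lintegral_sub_left_eq_self (fun s => ENNReal.ofReal (Real.exp (-(1 / b) * s ^ 2))) a,
    ← ofReal_integral_eq_lintegral_ofReal (integrable_exp_neg_mul_sq hb')
      (Filter.Eventually.of_forall fun _ => by positivity), h]
  congr 2
  field_simp

theorem lintegral_egauss_plane {b : ℝ} (hb : 0 < b) (x : ℝ × ℝ) :
    ∫⁻ y, egauss b x y = ENNReal.ofReal (Real.pi * b) := by
  have h : ∀ y, egauss b x y = ENNReal.ofReal (Real.exp (-(1 / b) * (x.1 - y.1) ^ 2)) *
      ENNReal.ofReal (Real.exp (-(1 / b) * (x.2 - y.2) ^ 2)) := by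
    intro y
    rw [← ENNReal.ofReal_mul (by positivity), ← Real.exp_add]
    unfold egauss gauss sqDist
    congr 2
    field_simp
    ring
  simp_rw [h]
  rw [Measure.volume_eq_prod, lintegral_prod_mul
      (f := fun s : ℝ => ENNReal.ofReal (Real.exp (-(1 / b) * (x.1 - s) ^ 2)))
      (g := fun s : ℝ => ENNReal.ofReal (Real.exp (-(1 / b) * (x.2 - s) ^ 2)))
      (by fun_prop) (by fun_prop),
    lintegral_gauss_line hb, lintegral_gauss_line hb, ← ENNReal.ofReal_mul (by positivity),
    Real.mul_self_sqrt (by positivity)]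

theorem lintegral_egauss_le {b : ℝ} (hb : 0 < b) (x : ℝ × ℝ) :
    ∫⁻ y, egauss b x y ∂muOmega ≤ ENNReal.ofReal (Real.pi * b) :=
  (lintegral_mono' Measure.restrict_le_self le_rfl).trans (lintegral_egauss_plane hb x).le

/-- The integral operator with kernel `egauss b` on nonnegative functions. -/
def gaussOp (b : ℝ) (φ : ℝ × ℝ → ℝ≥0∞) (x : ℝ × ℝ) : ℝ≥0∞ := ∫⁻ y, egauss b x y * φ y ∂muOmega

theorem aemeasurable_gaussOp {b : ℝ} {φ : ℝ × ℝ → ℝ≥0∞} (hφ : AEMeasurable φ muOmega) :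
    AEMeasurable (gaussOp b φ) muOmega := by
  have h : AEMeasurable (fun p : (ℝ × ℝ) × (ℝ × ℝ) => egauss b p.1 p.2 * φ p.2)
      (muOmega.prod muOmega) :=
    (measurable_egauss b).aemeasurable.mul hφ.comp_snd
  exact h.lintegral_prod_right'

/-- Hölder's inequality against the constant one, for the finite measure with density `egauss b x`,
whose mass is at most `π b`. -/
theorem gaussOp_rpow_le {b : ℝ} (hb : 0 < b) {φ : ℝ × ℝ → ℝ≥0∞} (hφ : AEMeasurable φ muOmega)
    {p : ℝ} (hp : 1 ≤ p) (x : ℝ × ℝ) :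
    gaussOp b φ x ^ p ≤
      ENNReal.ofReal (Real.pi * b) ^ (p - 1) * gaussOp b (fun y => φ y ^ p) x := by
  set ν := muOmega.withDensity (egauss b x)
  have hν : ν ≪ muOmega := withDensity_absolutelyContinuous _ _
  have hg := (measurable_egauss_right b x).aemeasurable (μ := muOmega)
  have h := eLpNorm'_le_eLpNorm'_mul_rpow_measure_univ (μ := ν) one_pos hp
    (hφ.mono_ac hν).aestronglyMeasurable
  have e1 : eLpNorm' φ 1 ν = gaussOp b φ x := by
    simp only [eLpNorm', enorm_eq_self, ENNReal.rpow_one, div_one]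
    rw [lintegral_withDensity_eq_lintegral_mul₀ hg hφ]; rfl
  have e2 : eLpNorm' φ p ν = gaussOp b (fun y => φ y ^ p) x ^ (1 / p) := by
    simp only [eLpNorm', enorm_eq_self]
    rw [lintegral_withDensity_eq_lintegral_mul₀ hg (hφ.pow_const p)]; rfl
  have e3 : ν Set.univ ≤ ENNReal.ofReal (Real.pi * b) := by
    rw [withDensity_apply _ MeasurableSet.univ, Measure.restrict_univ]
    exact lintegral_egauss_le hb x
  have hp0 : 0 < p := by linarith
  rw [e1, e2] at h
  calc _ ≤ (gaussOp b (fun y => φ y ^ p) x ^ (1 / p) *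
        ENNReal.ofReal (Real.pi * b) ^ (1 / 1 - 1 / p)) ^ p := by
        gcongr
        refine h.trans ?_
        gcongr
        rw [sub_nonneg, div_one, div_le_one hp0]; exact hp
    _ = _ := by
        rw [ENNReal.mul_rpow_of_nonneg _ _ hp0.le, ← ENNReal.rpow_mul, ← ENNReal.rpow_mul,
          one_div_mul_cancel hp0.ne', ENNReal.rpow_one, mul_comm]
        congr 2
        field_simp

theorem lintegral_gaussOp_le {b : ℝ} (hb : 0 < b) {φ : ℝ × ℝ → ℝ≥0∞}
    (hφ : AEMeasurable φ muOmega) :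
    ∫⁻ x, gaussOp b φ x ∂muOmega ≤ ENNReal.ofReal (Real.pi * b) * ∫⁻ y, φ y ∂muOmega := by
  unfold gaussOp
  rw [lintegral_lintegral_swap, ← lintegral_const_mul'' _ hφ]
  · refine lintegral_mono fun y => ?_
    dsimp only
    rw [lintegral_mul_const'' _ ?_]
    · gcongr
      simp_rw [fun x => egauss_comm b x y]
      exact lintegral_egauss_le hb y
    · exact ((measurable_egauss b).comp measurable_prodMk_right).aemeasurable
  · exact (measurable_egauss b).aemeasurable.mul hφ.comp_snd

/-- The endpoint `q = ∞` of Young's inequality: after Hölder, the remaining Gaussian is bounded by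
one. -/
theorem gaussOp_le_eLpNorm {b : ℝ} (hb : 0 < b) {φ : ℝ × ℝ → ℝ≥0∞} (hφ : AEMeasurable φ muOmega)
    {p : ℝ≥0∞} (hp : 1 ≤ p) (x : ℝ × ℝ) :
    gaussOp b φ x ≤
      ENNReal.ofReal (Real.pi * b) ^ (1 - 1 / p.toReal) * eLpNorm φ p muOmega := by
  rcases eq_or_ne p ∞ with rfl | hp'
  · simp only [ENNReal.toReal_top, div_zero, sub_zero, ENNReal.rpow_one, eLpNorm_exponent_top]
    unfold gaussOp
    calc _ ≤ ∫⁻ y, egauss b x y * eLpNormEssSup φ muOmega ∂muOmega := by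
          refine lintegral_mono_ae ?_
          filter_upwards [enorm_ae_le_eLpNormEssSup φ muOmega] with y hy
          rw [enorm_eq_self] at hy
          gcongr
      _ ≤ _ := by
          rw [lintegral_mul_const _ (measurable_egauss_right b x)]
          gcongr
          exact lintegral_egauss_le hb x
  have hp1 : 1 ≤ p.toReal := by
    rw [← ENNReal.toReal_one]; exact ENNReal.toReal_mono hp' hp
  have hp0 : 0 < p.toReal := by linarith
  rw [← ENNReal.rpow_le_rpow_iff hp0]
  refine (gaussOp_rpow_le hb hφ hp1 x).trans ?_
  rw [ENNReal.mul_rpow_of_nonneg _ _ hp0.le, ← ENNReal.rpow_mul,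
    eLpNorm_eq_lintegral_rpow_enorm_toReal (by positivity) hp', ← ENNReal.rpow_mul,
    one_div_mul_cancel hp0.ne', ENNReal.rpow_one, sub_mul, one_mul, one_div_mul_cancel hp0.ne']
  gcongr
  unfold gaussOp
  refine lintegral_mono fun y => ?_
  rw [enorm_eq_self]
  exact mul_le_of_le_one_left (by positivity) (egauss_le_one hb x y)

/-- Young's convolution inequality for the Gaussian. -/
theorem eLpNorm_gaussOp_le {b : ℝ} (hb : 0 < b) {φ : ℝ × ℝ → ℝ≥0∞} (hφ : AEMeasurable φ muOmega)
    {p q : ℝ≥0∞} (hp : 1 ≤ p) (hpq : p ≤ q) :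
    eLpNorm (gaussOp b φ) q muOmega ≤
      ENNReal.ofReal (Real.pi * b) ^ (1 - (1 / p.toReal - 1 / q.toReal)) *
        eLpNorm φ p muOmega := by
  have hN0 : ENNReal.ofReal (Real.pi * b) ≠ 0 := by
    rw [Ne, ENNReal.ofReal_eq_zero, not_le]; positivity
  have hNt : ENNReal.ofReal (Real.pi * b) ≠ ∞ := ENNReal.ofReal_ne_top
  set N := ENNReal.ofReal (Real.pi * b)
  rcases eq_or_ne q ∞ with rfl | hq'
  · rw [eLpNorm_exponent_top]
    refine eLpNormEssSup_le_of_ae_enorm_bound (Filter.Eventually.of_forall fun x => ?_)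
    rw [enorm_eq_self]
    simpa using gaussOp_le_eLpNorm hb hφ hp x
  have hp' : p ≠ ∞ := fun h => hq' (top_le_iff.1 (h ▸ hpq))
  have hp1 : 1 ≤ p.toReal := by
    rw [← ENNReal.toReal_one]; exact ENNReal.toReal_mono hp' hp
  have hp0 : 0 < p.toReal := by linarith
  have hpqr : p.toReal ≤ q.toReal := ENNReal.toReal_mono hq' hpq
  have hq0 : 0 < q.toReal := by linarith
  have hqne : q ≠ 0 := (lt_of_lt_of_le one_pos (hp.trans hpq)).ne'
  set r := p.toReal
  set s := q.toReal
  set A := eLpNorm φ p muOmega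
  have hI : ∫⁻ y, φ y ^ r ∂muOmega = A ^ r := by
    simp only [A]
    rw [eLpNorm_eq_lintegral_rpow_enorm_toReal (by positivity) hp', ← ENNReal.rpow_mul,
      one_div_mul_cancel hp0.ne', ENNReal.rpow_one]
    simp only [enorm_eq_self, r]
  have hL : ∫⁻ x, gaussOp b φ x ^ r ∂muOmega ≤ N ^ r * A ^ r := by
    calc _ ≤ ∫⁻ x, N ^ (r - 1) * gaussOp b (fun y => φ y ^ r) x ∂muOmega :=
          lintegral_mono fun x => gaussOp_rpow_le hb hφ hp1 x
      _ = N ^ (r - 1) * ∫⁻ x, gaussOp b (fun y => φ y ^ r) x ∂muOmega :=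
          lintegral_const_mul'' _ (aemeasurable_gaussOp (hφ.pow_const r))
      _ ≤ N ^ (r - 1) * (N * A ^ r) := by
          gcongr
          rw [← hI]
          exact lintegral_gaussOp_le hb (hφ.pow_const r)
      _ = N ^ r * A ^ r := by
          rw [← mul_assoc]
          congr 1
          nth_rewrite 2 [← ENNReal.rpow_one N]
          rw [← ENNReal.rpow_add _ _ hN0 hNt, sub_add_cancel]
  rw [eLpNorm_eq_lintegral_rpow_enorm_toReal hqne hq',
    ← ENNReal.rpow_le_rpow_iff hq0, ← ENNReal.rpow_mul, one_div_mul_cancel hq0.ne', ENNReal.rpow_one]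
  simp only [enorm_eq_self]
  -- Interpolation between `L^p` and `L^∞`: `s - r` of the `s` powers are bounded pointwise, and the
  -- other `r` are integrated.
  calc ∫⁻ x, gaussOp b φ x ^ s ∂muOmega
      ≤ ∫⁻ x, (N ^ (1 - 1 / r) * A) ^ (s - r) * gaussOp b φ x ^ r ∂muOmega := by
        refine lintegral_mono fun x => ?_
        dsimp only
        have : gaussOp b φ x ^ s = gaussOp b φ x ^ (s - r) * gaussOp b φ x ^ r := by
          rw [← ENNReal.rpow_add_of_nonneg _ _ (sub_nonneg.2 hpqr) hp0.le, sub_add_cancel]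
        rw [this]
        gcongr
        exact gaussOp_le_eLpNorm hb hφ hp x
    _ = (N ^ (1 - 1 / r) * A) ^ (s - r) * ∫⁻ x, gaussOp b φ x ^ r ∂muOmega :=
        lintegral_const_mul'' _ ((aemeasurable_gaussOp hφ).pow_const r)
    _ ≤ (N ^ (1 - 1 / r) * A) ^ (s - r) * (N ^ r * A ^ r) := by gcongr
    _ = (N ^ (1 - (1 / r - 1 / s)) * A) ^ s := by
        rw [ENNReal.mul_rpow_of_nonneg _ _ (sub_nonneg.2 hpqr),
          ENNReal.mul_rpow_of_nonneg _ _ hq0.le, ← ENNReal.rpow_mul, ← ENNReal.rpow_mul,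
          mul_mul_mul_comm, ← ENNReal.rpow_add _ _ hN0 hNt,
          ← ENNReal.rpow_add_of_nonneg _ _ (sub_nonneg.2 hpqr) hp0.le, sub_add_cancel]
        congr 2
        field_simp
        ring

/-! ### Signed kernels with a Gaussian majorant -/

/-- The kernel `k` is measurable and dominated on `Ω × Ω` by `M` times the Gaussian. -/
structure GaussBound (k : ℝ × ℝ → ℝ × ℝ → ℝ) (M b : ℝ) : Prop where
  meas : Measurable fun p : (ℝ × ℝ) × (ℝ × ℝ) => k p.1 p.2
  nonneg : 0 ≤ M
  pos : 0 < b
  le : ∀ x ∈ Omega, ∀ y ∈ Omega, |k x y| ≤ M * gauss b x y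

theorem GaussBound.lintegral_enorm_le {k : ℝ × ℝ → ℝ × ℝ → ℝ} {M b : ℝ} (hk : GaussBound k M b)
    {f : ℝ × ℝ → ℝ} {x : ℝ × ℝ} (hx : x ∈ Omega) :
    ∫⁻ y, ‖k x y * f y‖ₑ ∂muOmega ≤ ENNReal.ofReal M * gaussOp b (fun y => ‖f y‖ₑ) x := by
  unfold gaussOp
  rw [← lintegral_const_mul' _ _ ENNReal.ofReal_ne_top]
  refine lintegral_mono_ae ?_
  filter_upwards [ae_mem_Omega] with y hy
  rw [enorm_mul, ← mul_assoc]
  gcongr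
  rw [egauss, ← ENNReal.ofReal_mul hk.nonneg, Real.enorm_eq_ofReal_abs]
  exact ENNReal.ofReal_le_ofReal (hk.le x hx y hy)

theorem GaussBound.integrable {k : ℝ × ℝ → ℝ × ℝ → ℝ} {M b : ℝ} (hk : GaussBound k M b)
    {p : ℝ≥0∞} (hp : 1 ≤ p) {f : ℝ × ℝ → ℝ} (hf : MemLp f p muOmega) {x : ℝ × ℝ}
    (hx : x ∈ Omega) : Integrable (fun y => k x y * f y) muOmega := by
  refine ⟨(hk.meas.comp measurable_prodMk_left).aestronglyMeasurable.mul hf.1, ?_⟩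
  rw [hasFiniteIntegral_iff_enorm]
  refine (hk.lintegral_enorm_le hx).trans_lt (ENNReal.mul_lt_top ENNReal.ofReal_lt_top ?_)
  refine (gaussOp_le_eLpNorm hk.pos hf.1.enorm hp x).trans_lt (ENNReal.mul_lt_top ?_ ?_)
  · exact ENNReal.rpow_lt_top_of_nonneg (sub_nonneg.2 (one_div_toReal_le_one hp))
      ENNReal.ofReal_ne_top
  · rw [eLpNorm_enorm f]; exact hf.2

theorem GaussBound.eLpNorm_le {k : ℝ × ℝ → ℝ × ℝ → ℝ} {M b : ℝ} (hk : GaussBound k M b)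
    {p q : ℝ≥0∞} (hp : 1 ≤ p) (hpq : p ≤ q) {f : ℝ × ℝ → ℝ} (hf : MemLp f p muOmega) :
    eLpNorm (fun x => ∫ y, k x y * f y ∂muOmega) q muOmega ≤
      ENNReal.ofReal (M * (Real.pi * b) ^ (1 - (1 / p.toReal - 1 / q.toReal))) *
        eLpNorm f p muOmega := by
  have hb := hk.pos
  have hN : 0 < Real.pi * b := by positivity
  calc _ ≤ ENNReal.ofReal M * eLpNorm (gaussOp b (fun y => ‖f y‖ₑ)) q muOmega := by
        refine eLpNorm_le_mul_eLpNorm_of_ae_le_mul' (c := M.toNNReal) ?_ q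
        filter_upwards [ae_mem_Omega] with x hx
        rw [enorm_eq_self]
        exact (enorm_integral_le_lintegral_enorm _).trans (hk.lintegral_enorm_le hx)
    _ ≤ ENNReal.ofReal M * (ENNReal.ofReal (Real.pi * b) ^
          (1 - (1 / p.toReal - 1 / q.toReal)) * eLpNorm f p muOmega) := by
        gcongr
        refine (eLpNorm_gaussOp_le hk.pos hf.1.enorm hp hpq).trans ?_
        rw [eLpNorm_enorm f]
    _ = _ := by
        rw [← mul_assoc, ENNReal.ofReal_rpow_of_pos hN, ← ENNReal.ofReal_mul hk.nonneg]

theorem GaussBound.memLp {k : ℝ × ℝ → ℝ × ℝ → ℝ} {M b : ℝ} (hk : GaussBound k M b)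
    {p q : ℝ≥0∞} (hp : 1 ≤ p) (hpq : p ≤ q) {f : ℝ × ℝ → ℝ} (hf : MemLp f p muOmega) :
    MemLp (fun x => ∫ y, k x y * f y ∂muOmega) q muOmega := by
  refine ⟨?_, (hk.eLpNorm_le hp hpq hf).trans_lt (ENNReal.mul_lt_top ENNReal.ofReal_lt_top hf.2)⟩
  exact (hk.meas.aestronglyMeasurable.mul hf.1.comp_snd).integral_prod_right'

/-- The scaling form of the estimate for kernels of heat type. -/
theorem GaussBound.eLpNorm_le_of_scaling {k : ℝ × ℝ → ℝ × ℝ → ℝ} {A a t : ℝ} (hA : 0 ≤ A)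
    (ht : 0 < t) (hk : GaussBound k (A / t ^ (1 + a)) (8 * t))
    {p q : ℝ≥0∞} (hp : 1 ≤ p) (hpq : p ≤ q) {f : ℝ × ℝ → ℝ} (hf : MemLp f p muOmega) :
    eLpNorm (fun x => ∫ y, k x y * f y ∂muOmega) q muOmega ≤
      ENNReal.ofReal (26 * A / t ^ (a + 1 / p.toReal - 1 / q.toReal)) * eLpNorm f p muOmega := by
  refine (hk.eLpNorm_le hp hpq hf).trans ?_
  gcongr
  have hq1 := hp.trans hpq
  have h1 : 1 / p.toReal - 1 / q.toReal ≤ 1 := by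
    have h3 : 0 ≤ 1 / q.toReal := by positivity
    have h2 := one_div_toReal_le_one hp
    linarith
  have h2 : 0 ≤ 1 / p.toReal - 1 / q.toReal := by
    rcases eq_or_ne q ∞ with rfl | hq'
    · simp
    · have hp' : p ≠ ∞ := fun h => hq' (top_le_iff.1 (h ▸ hpq))
      have : 1 ≤ p.toReal := by
        rw [← ENNReal.toReal_one]; exact ENNReal.toReal_mono hp' hp
      rw [sub_nonneg]
      exact one_div_le_one_div_of_le (by linarith) (ENNReal.toReal_mono hq' hpq)
  have h3 : (1 + a) - (1 - (1 / p.toReal - 1 / q.toReal)) = a + 1 / p.toReal - 1 / q.toReal := by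
    ring
  rw [← h3, Real.rpow_sub ht, show Real.pi * (8 * t) = (Real.pi * 8) * t by ring,
    Real.mul_rpow (by positivity) ht.le]
  set θ := 1 / p.toReal - 1 / q.toReal
  -- Since `0 ≤ θ ≤ 1` and `8π < 26`, the constant does not depend on `p` and `q`.
  have h4 : (Real.pi * 8) ^ (1 - θ) ≤ 26 := by
    have := Real.pi_lt_d2
    have := Real.pi_gt_three
    calc _ ≤ (Real.pi * 8) ^ (1 : ℝ) :=
          Real.rpow_le_rpow_of_exponent_le (by linarith) (by linarith)
      _ ≤ _ := by rw [Real.rpow_one]; linarith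
  calc _ = (Real.pi * 8) ^ (1 - θ) * A / (t ^ (1 + a) / t ^ (1 - θ)) := by field_simp
    _ ≤ _ := by gcongr

/-! ### Cylindrical coordinates -/

/-- The point of `ℝ³` with cylindrical coordinates `(r, z)` and angle `θ`. -/
def cylMap (q : (ℝ × ℝ) × ℝ) : E3 := !₂[q.1.1 * Real.cos q.2, q.1.1 * Real.sin q.2, q.1.2]

/-- The measure `dθ` on `(-π, π)`. -/
def angMeasure : Measure ℝ := volume.restrict (Set.Ioo (-Real.pi) Real.pi)

instance : IsFiniteMeasure angMeasure := by unfold angMeasure; infer_instance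

theorem continuous_cylMap : Continuous cylMap := by unfold cylMap; fun_prop

theorem measurable_cyl : Measurable cyl := by unfold cyl; fun_prop

theorem measurable_eTheta : Measurable eTheta := by unfold eTheta cyl; fun_prop

theorem cyl_cylMap {y : ℝ × ℝ} (hy : y ∈ Omega) (θ : ℝ) : cyl (cylMap (y, θ)) = y := by
  have hy0 : 0 < y.1 := hy
  have : (y.1 * Real.cos θ) ^ 2 + (y.1 * Real.sin θ) ^ 2 = y.1 ^ 2 := by
    rw [mul_pow, mul_pow, ← mul_add, Real.cos_sq_add_sin_sq, mul_one]
  simp [cyl, cylMap, this, Real.sqrt_sq hy0.le]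

/-- The vector `e_θ` at the angle `θ`. -/
def angVec (θ : ℝ) : E3 := !₂[-Real.sin θ, Real.cos θ, 0]

theorem continuous_angVec : Continuous angVec := by unfold angVec; fun_prop

theorem eTheta_cylMap {y : ℝ × ℝ} (hy : y ∈ Omega) (θ : ℝ) :
    eTheta (cylMap (y, θ)) = angVec θ := by
  have hy0 : y.1 ≠ 0 := ne_of_gt hy
  have h := cyl_cylMap hy θ
  unfold eTheta
  rw [h]
  ext i
  fin_cases i <;> simp [cylMap, angVec, hy0, neg_div]

/-- The angle is the argument of the complex number `x₀ + i x₁`; on the axis its value is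
irrelevant. -/
theorem exists_cylMap_eq (x : E3) : ∃ φ, x = cylMap (cyl x, φ) := by
  set ζ : ℂ := ⟨x 0, x 1⟩
  have h1 : ‖ζ‖ = (cyl x).1 := by
    rw [Complex.norm_def, Complex.normSq_apply]
    simp [cyl, ζ, pow_two]
  refine ⟨ζ.arg, ?_⟩
  have h2 := Complex.norm_mul_cos_arg ζ
  have h3 := Complex.norm_mul_sin_arg ζ
  rw [h1] at h2 h3
  ext i
  fin_cases i
  · simp [cylMap, h2, ζ]
  · simp [cylMap, h3, ζ]
  · simp [cylMap, cyl]

/-- The height is put first so that, once it is frozen, the remaining plane is in the shape required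
by polar coordinates. -/
theorem measurePreserving_cartesian :
    MeasurePreserving (fun q : ℝ × (ℝ × ℝ) => (!₂[q.2.1, q.2.2, q.1] : E3)) := by
  have h1 := ((MeasurePreserving.id (volume : Measure ℝ)).prod
    (volume_preserving_finTwoArrow ℝ).symm)
  have h2 := (volume_preserving_piFinSuccAbove (fun _ : Fin 3 => ℝ) 2).symm
  have h3 := PiLp.volume_preserving_toLp (Fin 3)
  have h : (fun q : ℝ × (ℝ × ℝ) => (!₂[q.2.1, q.2.2, q.1] : E3)) =
      (WithLp.toLp 2 ∘ (MeasurableEquiv.piFinSuccAbove (fun _ : Fin 3 => ℝ) 2).symm) ∘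
        Prod.map id (MeasurableEquiv.finTwoArrow (α := ℝ)).symm := by
    funext q
    ext i
    fin_cases i <;> rfl
  rw [h]
  exact (h3.comp h2).comp h1

theorem muOmega_eq_prod :
    muOmega = (volume.restrict (Set.Ioi (0 : ℝ))).prod (volume : Measure ℝ) := by
  have : Omega = Set.Ioi (0 : ℝ) ×ˢ Set.univ := by
    ext x; simp [Omega]
  rw [muOmega, this, Measure.volume_eq_prod, ← Measure.prod_restrict, Measure.restrict_univ]

/-- Cylindrical coordinates turn `r dr dz dθ` into the Lebesgue measure of `ℝ³`. -/
theorem volume_eq_map_cylMap :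
    (volume : Measure E3) = ((muOmega.prod angMeasure).withDensity
      fun q => ENNReal.ofReal q.1.1).map cylMap := by
  refine Measure.ext_of_lintegral _ fun g hg => ?_
  have hc := continuous_cylMap.measurable
  have hd : Measurable fun q : (ℝ × ℝ) × ℝ => ENNReal.ofReal q.1.1 := by fun_prop
  have hm : Measurable fun q : ℝ × (ℝ × ℝ) => g !₂[q.2.1, q.2.2, q.1] :=
    hg.comp (by fun_prop)
  have hm2 : Measurable fun q : (ℝ × ℝ) × ℝ => ENNReal.ofReal q.1.1 * g (cylMap q) :=
    hd.mul (hg.comp hc)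
  rw [lintegral_map hg hc, lintegral_withDensity_eq_lintegral_mul _ hd (g := fun q => g (cylMap q)) (hg.comp hc),
    ← measurePreserving_cartesian.lintegral_comp hg, Measure.volume_eq_prod,
    lintegral_prod _ hm.aemeasurable]
  simp only [Pi.mul_apply]
  rw [lintegral_prod _ hm2.aemeasurable, muOmega_eq_prod, lintegral_prod_symm]
  · refine lintegral_congr fun z => ?_
    rw [← lintegral_comp_polarCoord_symm, polarCoord_target, Measure.volume_eq_prod,
      ← Measure.prod_restrict, lintegral_prod]
    · rfl
    · refine Measurable.aemeasurable ?_
      have : Measurable fun p : ℝ × ℝ => ENNReal.ofReal p.1 *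
          g !₂[p.1 * Real.cos p.2, p.1 * Real.sin p.2, z] :=
        Measurable.mul (by fun_prop) (hg.comp (by fun_prop))
      exact this
  · exact (hm2.lintegral_prod_right').aemeasurable

section integrals

variable {V : Type*} [NormedAddCommGroup V] [NormedSpace ℝ V]

theorem ae_prod_fst_mem_Omega : ∀ᵐ q ∂(muOmega.prod angMeasure), q.1 ∈ Omega :=
  Measure.quasiMeasurePreserving_fst.ae ae_mem_Omega

theorem integrable_iff_cylMap {F : E3 → V} (hF : AEStronglyMeasurable F) :
    Integrable F ↔ Integrable (fun q => q.1.1 • F (cylMap q)) (muOmega.prod angMeasure) := by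
  have hd : Measurable fun q : (ℝ × ℝ) × ℝ => ENNReal.ofReal q.1.1 := by fun_prop
  rw [volume_eq_map_cylMap] at hF ⊢
  rw [integrable_map_measure hF continuous_cylMap.aemeasurable,
    integrable_withDensity_iff_integrable_smul' hd (by simp)]
  refine integrable_congr ?_
  filter_upwards [ae_prod_fst_mem_Omega] with q hq
  rw [ENNReal.toReal_ofReal (le_of_lt hq)]
  rfl

theorem integral_eq_cylMap {F : E3 → V} (hF : AEStronglyMeasurable F) :
    ∫ x, F x = ∫ q, q.1.1 • F (cylMap q) ∂(muOmega.prod angMeasure) := by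
  have hd : Measurable fun q : (ℝ × ℝ) × ℝ => ENNReal.ofReal q.1.1 := by fun_prop
  rw [volume_eq_map_cylMap] at hF ⊢
  rw [integral_map continuous_cylMap.aemeasurable hF,
    integral_withDensity_eq_integral_toReal_smul hd (by simp)]
  refine integral_congr_ae ?_
  filter_upwards [ae_prod_fst_mem_Omega] with q hq
  rw [ENNReal.toReal_ofReal (le_of_lt hq)]

/-- Null sets of the half-plane lift to null sets of `ℝ³`, so composing with `cyl` makes sense for
functions known only almost everywhere. -/
theorem quasiMeasurePreserving_cyl :
    Measure.QuasiMeasurePreserving cyl (volume : Measure E3) muOmega := by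
  refine ⟨measurable_cyl, ?_⟩
  rw [volume_eq_map_cylMap, Measure.map_map measurable_cyl continuous_cylMap.measurable]
  have h : cyl ∘ cylMap =ᵐ[(muOmega.prod angMeasure).withDensity
      fun q => ENNReal.ofReal q.1.1] Prod.fst := by
    refine (withDensity_absolutelyContinuous _ _).ae_le ?_
    filter_upwards [ae_prod_fst_mem_Omega] with q hq
    exact cyl_cylMap hq q.2
  rw [Measure.map_congr h]
  exact ((withDensity_absolutelyContinuous _ _).map measurable_fst).trans
    Measure.quasiMeasurePreserving_fst.absolutelyContinuous

theorem ae_cyl_mem_Omega : ∀ᵐ x : E3, cyl x ∈ Omega :=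
  quasiMeasurePreserving_cyl.ae ae_mem_Omega

end integrals

/-! ### The angular part of the heat kernel of `ℝ³` -/

/-- The law of cosines, with `1 - cos` written as `2 sin²` of the half angle; this is the origin of
`sin² α` in `N1` and `N2`. -/
theorem norm_sub_cylMap_sq (x y : ℝ × ℝ) (φ θ : ℝ) :
    ‖cylMap (x, φ) - cylMap (y, θ)‖ ^ 2 =
      sqDist x y + 4 * (x.1 * y.1) * Real.sin ((θ - φ) / 2) ^ 2 := by
  have h : 4 * Real.sin ((θ - φ) / 2) ^ 2 = 2 * (1 - Real.cos (θ - φ)) := by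
    rw [Real.sin_sq_eq_half_sub]
    rw [show 2 * ((θ - φ) / 2) = θ - φ by ring]; ring
  rw [EuclideanSpace.norm_sq_eq, Fin.sum_univ_three]
  simp only [cylMap, sqDist, Real.norm_eq_abs, sq_abs, PiLp.sub_apply]
  simp only [Matrix.cons_val_zero, Matrix.cons_val_one, Matrix.cons_val]
  rw [show 4 * (x.1 * y.1) * Real.sin ((θ - φ) / 2) ^ 2 =
    (x.1 * y.1) * (4 * Real.sin ((θ - φ) / 2) ^ 2) by ring, h, Real.cos_sub]
  have h1 := Real.cos_sq_add_sin_sq φ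
  have h2 := Real.cos_sq_add_sin_sq θ
  linear_combination x.1 ^ 2 * h1 + y.1 ^ 2 * h2

/-- The heat kernel of `ℝ³`. -/
def heatKernel (t : ℝ) (x : E3) : ℝ :=
  1 / (4 * Real.pi * t) ^ (3 / 2 : ℝ) * Real.exp (-(‖x‖ ^ 2) / (4 * t))

theorem continuous_heatKernel (t : ℝ) : Continuous (heatKernel t) := by
  unfold heatKernel; fun_prop

theorem rpow_three_halves {a : ℝ} (ha : 0 < a) : a ^ (3 / 2 : ℝ) = a * √a := by
  rw [show (3 / 2 : ℝ) = 1 + 1 / 2 by norm_num, Real.rpow_add ha, Real.rpow_one,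
    Real.sqrt_eq_rpow]

/-- The factor `1/2` is compensated by `dθ = 2 dα` in `integral_exp_sin_half`. -/
theorem heatKernel_prefactor {t : ℝ} (ht : 0 < t) :
    1 / (4 * Real.pi * t) ^ (3 / 2 : ℝ) = kap t / 2 := by
  have h : √(4 * Real.pi * t) = 2 * √(Real.pi * t) := by
    rw [show 4 * Real.pi * t = 2 ^ 2 * (Real.pi * t) by ring, Real.sqrt_mul (by positivity),
      Real.sqrt_sq (by norm_num)]
  rw [rpow_three_halves (by positivity), h, kap]
  field_simp

theorem heatKernel_cylMap {t : ℝ} (ht : 0 < t) (x y : ℝ × ℝ) (φ θ : ℝ) :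
    heatKernel t (cylMap (x, φ) - cylMap (y, θ)) =
      kap t / 2 * gauss (4 * t) x y *
        Real.exp (-(x.1 * y.1 / t) * Real.sin ((θ - φ) / 2) ^ 2) := by
  rw [heatKernel, norm_sub_cylMap_sq, heatKernel_prefactor ht, mul_assoc (kap t / 2), gauss, ← Real.exp_add]
  congr 2
  field_simp
  ring

theorem heatKernel_cylMap_le {t : ℝ} (ht : 0 < t) {x y : ℝ × ℝ} (hx : x ∈ Omega)
    (hy : y ∈ Omega) (φ θ : ℝ) :
    heatKernel t (cylMap (x, φ) - cylMap (y, θ)) ≤ kap t * gauss (4 * t) x y := by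
  rw [heatKernel_cylMap ht]
  have hk := kap_pos ht
  have hg := gauss_pos (4 * t) x y
  have hx0 : 0 < x.1 := hx
  have hy0 : 0 < y.1 := hy
  have h : Real.exp (-(x.1 * y.1 / t) * Real.sin ((θ - φ) / 2) ^ 2) ≤ 1 := by
    rw [Real.exp_le_one_iff]
    have : 0 ≤ x.1 * y.1 / t * Real.sin ((θ - φ) / 2) ^ 2 := by positivity
    linarith
  calc _ ≤ kap t / 2 * gauss (4 * t) x y * 1 := by gcongr
    _ ≤ _ := by nlinarith [mul_pos hk hg]

theorem heatKernel_nonneg {t : ℝ} (ht : 0 < t) (x : E3) : 0 ≤ heatKernel t x := by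
  unfold heatKernel; positivity

theorem integral_angMeasure_eq {V : Type*} [NormedAddCommGroup V] [NormedSpace ℝ V]
    (h : ℝ → V) : ∫ θ, h θ ∂angMeasure = ∫ θ in (-Real.pi)..Real.pi, h θ := by
  rw [angMeasure, intervalIntegral.integral_of_le (by linarith [Real.pi_pos]),
    integral_Ioc_eq_integral_Ioo]

theorem intervalIntegral_shift {V : Type*} [NormedAddCommGroup V] [NormedSpace ℝ V]
    {h : ℝ → V} (hp : Function.Periodic h (2 * Real.pi)) (φ : ℝ) :
    ∫ θ in (-Real.pi)..Real.pi, h (θ - φ) = ∫ θ in (-Real.pi)..Real.pi, h θ := by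
  rw [intervalIntegral.integral_comp_sub_right h φ]
  have h1 := hp.intervalIntegral_add_eq (-Real.pi - φ) (-Real.pi)
  rw [show -Real.pi - φ + 2 * Real.pi = Real.pi - φ by ring,
    show -Real.pi + 2 * Real.pi = Real.pi by ring] at h1
  exact h1

theorem sin_half_sq_periodic :
    Function.Periodic (fun β => Real.sin (β / 2) ^ 2) (2 * Real.pi) := by
  intro β
  simp only
  rw [show (β + 2 * Real.pi) / 2 = β / 2 + Real.pi by ring, Real.sin_add_pi, neg_sq]

theorem integral_exp_sin_half (w : ℝ → ℝ) (u : ℝ) :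
    ∫ β in (-Real.pi)..Real.pi, Real.exp (-u * Real.sin (β / 2) ^ 2) * w (β / 2) =
      2 * angInt w u := by
  have := intervalIntegral.integral_comp_div (a := -Real.pi) (b := Real.pi)
    (fun α => Real.exp (-u * Real.sin α ^ 2) * w α) (two_ne_zero)
  rw [this, angInt, smul_eq_mul, neg_div]

theorem integral_angMass (u φ : ℝ) :
    ∫ θ, Real.exp (-u * Real.sin ((θ - φ) / 2) ^ 2) • (1 : ℝ) ∂angMeasure =
      (2 * angInt oneWeight u) • (1 : ℝ) := by
  rw [integral_angMeasure_eq, ← integral_exp_sin_half]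
  simp only [smul_eq_mul, oneWeight, mul_one]
  refine intervalIntegral_shift (h := fun β => Real.exp (-u * Real.sin (β / 2) ^ 2)) ?_ φ
  intro β
  have := sin_half_sq_periodic β
  simp only at this
  simp only [this]

theorem angVec_eq (θ φ : ℝ) :
    angVec θ = Real.cos (θ - φ) • angVec φ -
      Real.sin (θ - φ) • !₂[Real.cos φ, Real.sin φ, 0] := by
  have h1 : Real.sin θ = Real.sin (θ - φ) * Real.cos φ + Real.cos (θ - φ) * Real.sin φ := by
    rw [← Real.sin_add, sub_add_cancel]
  have h2 : Real.cos θ = Real.cos (θ - φ) * Real.cos φ - Real.sin (θ - φ) * Real.sin φ := by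
    rw [← Real.cos_add, sub_add_cancel]
  ext i
  fin_cases i
  · simp [angVec, h1]; ring
  · simp [angVec, h2]
  · simp [angVec]

/-- In the frame at the angle `φ`, the `e_θ` component of `angVec θ` is `cos(θ - φ)`, which becomes
`cos 2α`. The radial component is odd in `θ - φ` and integrates to zero. -/
theorem integral_angVec (u φ : ℝ) :
    ∫ θ, Real.exp (-u * Real.sin ((θ - φ) / 2) ^ 2) • angVec θ ∂angMeasure =
      (2 * angInt cosWeight u) • angVec φ := by
  have hc : ∫ θ in (-Real.pi)..Real.pi,
      Real.exp (-u * Real.sin ((θ - φ) / 2) ^ 2) * Real.cos (θ - φ) = 2 * angInt cosWeight u := by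
    rw [intervalIntegral_shift
      (h := fun β => Real.exp (-u * Real.sin (β / 2) ^ 2) * Real.cos β), ← integral_exp_sin_half]
    · refine intervalIntegral.integral_congr fun β _ => ?_
      simp only [cosWeight]
      rw [show 2 * (β / 2) = β by ring]
    · intro β
      have := sin_half_sq_periodic β
      simp only at this
      simp only [this, Real.cos_add_two_pi]
  have hs : ∫ θ in (-Real.pi)..Real.pi,
      Real.exp (-u * Real.sin ((θ - φ) / 2) ^ 2) * Real.sin (θ - φ) = 0 := by
    rw [intervalIntegral_shift
      (h := fun β => Real.exp (-u * Real.sin (β / 2) ^ 2) * Real.sin β)]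
    · have := intervalIntegral.integral_comp_neg (a := -Real.pi) (b := Real.pi)
        (fun β => Real.exp (-u * Real.sin (β / 2) ^ 2) * Real.sin β)
      simp only [Real.sin_neg, neg_div, neg_sq, mul_neg, intervalIntegral.integral_neg,
        neg_neg] at this
      linarith
    · intro β
      have := sin_half_sq_periodic β
      simp only at this
      simp only [this, Real.sin_add_two_pi]
  rw [integral_angMeasure_eq]
  have e : ∀ θ, Real.exp (-u * Real.sin ((θ - φ) / 2) ^ 2) • angVec θ =
      (Real.exp (-u * Real.sin ((θ - φ) / 2) ^ 2) * Real.cos (θ - φ)) • angVec φ -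
      (Real.exp (-u * Real.sin ((θ - φ) / 2) ^ 2) * Real.sin (θ - φ)) •
        (!₂[Real.cos φ, Real.sin φ, 0] : E3) := by
    intro θ
    rw [angVec_eq θ φ, smul_sub, smul_smul, smul_smul]
  simp_rw [e]
  rw [intervalIntegral.integral_sub, intervalIntegral.integral_smul_const,
    intervalIntegral.integral_smul_const, hc, hs, zero_smul, sub_zero]
  · exact Continuous.intervalIntegrable (by fun_prop) _ _
  · exact Continuous.intervalIntegrable (by fun_prop) _ _

/-! ### The heat flow of `ℝ³` in cylindrical coordinates -/

theorem gaussBound_gauss {b : ℝ} (hb : 0 < b) : GaussBound (gauss b) 1 b where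
  meas := (continuous_gauss b).measurable
  nonneg := zero_le_one
  pos := hb
  le x _ y _ := by rw [one_mul, abs_of_pos (gauss_pos _ _ _)]

theorem integrable_gauss_mul {b : ℝ} (hb : 0 < b) {p : ℝ≥0∞} (hp : 1 ≤ p) {f : ℝ × ℝ → ℝ}
    (hf : MemLp f p muOmega) {x : ℝ × ℝ} (hx : x ∈ Omega) :
    Integrable (fun y => gauss b x y * |f y|) muOmega :=
  (gaussBound_gauss hb).integrable hp hf.abs hx

/-- Before the angular integration there is no decay in `r r'/t` to use, so the Jacobian `r'` costs
a constant depending on `x`. This is harmless for integrability at a fixed `x`. -/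
theorem mul_kap_gauss_le {t : ℝ} (ht : 0 < t) {x y : ℝ × ℝ} (hx : x ∈ Omega) (hy : y ∈ Omega) :
    y.1 * (kap t * gauss (4 * t) x y) ≤
      256 * (x.1 + √t) / (t * √t) * gauss (8 * t) x y := by
  have hy0 : 0 < y.1 := hy
  have hx0 : 0 < x.1 := hx
  have hst : 0 < √t := Real.sqrt_pos.2 ht
  have hv : 0 ≤ sqDist x y / t := div_nonneg (sqDist_nonneg _ _) ht.le
  have h := abs_mul_gauss_le ht (x := x) (y := y) (X := y.1) (c := x.1 + √t) ?_
  · have h2 := le_abs_self (kap t * y.1 * gauss (4 * t) x y)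
    linarith
  · rw [abs_of_pos hy0]
    have h1 := abs_fst_sub_le ht x y
    have h2 := neg_abs_le (x.1 - y.1)
    have h3 : 1 + sqDist x y / t ≤ (1 + sqDist x y / t) ^ 2 := by nlinarith
    nlinarith

/-- Scalars (`ε = 1`) and swirl fields (`ε = angVec`) are treated together: the two cases differ
only in the angular average `hw`, and the rest is Fubini. -/
theorem heatFlow_cylMap {V : Type*} [NormedAddCommGroup V] [NormedSpace ℝ V] [CompleteSpace V]
    {p : ℝ≥0∞} (hp : 1 ≤ p) {f : ℝ × ℝ → ℝ} (hf : MemLp f p muOmega) {t : ℝ} (ht : 0 < t)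
    {F : E3 → V} (hF : AEStronglyMeasurable F) {ε : ℝ → V} (hε : Continuous ε)
    (hε1 : ∀ θ, ‖ε θ‖ ≤ 1) (hFε : ∀ y ∈ Omega, ∀ θ, F (cylMap (y, θ)) = f y • ε θ)
    {w : ℝ → ℝ} {v : V} {φ : ℝ}
    (hw : ∀ u, ∫ θ, Real.exp (-u * Real.sin ((θ - φ) / 2) ^ 2) • ε θ ∂angMeasure =
      (2 * angInt w u) • v) {x : ℝ × ℝ} (hx : x ∈ Omega) :
    Integrable (fun y => heatKernel t (cylMap (x, φ) - y) • F y) ∧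
      heatFlow t F (cylMap (x, φ)) = (∫ y, wKernel w t x y * f y ∂muOmega) • v := by
  have hmeas : AEStronglyMeasurable (fun y => heatKernel t (cylMap (x, φ) - y) • F y) :=
    ((continuous_heatKernel t).comp (by fun_prop)).aestronglyMeasurable.smul hF
  have heq : (fun q : (ℝ × ℝ) × ℝ =>
      q.1.1 • (heatKernel t (cylMap (x, φ) - cylMap q) • F (cylMap q))) =ᵐ[muOmega.prod angMeasure]
      fun q => (q.1.1 * heatKernel t (cylMap (x, φ) - cylMap q)) • (f q.1 • ε q.2) := by
    filter_upwards [ae_prod_fst_mem_Omega] with q hq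
    rw [smul_smul, ← hFε q.1 hq q.2]
  have hint : Integrable (fun q : (ℝ × ℝ) × ℝ =>
      (q.1.1 * heatKernel t (cylMap (x, φ) - cylMap q)) • (f q.1 • ε q.2))
      (muOmega.prod angMeasure) := by
    have hdom := ((integrable_gauss_mul (b := 8 * t) (by positivity) hp hf hx).const_mul
      (256 * (x.1 + √t) / (t * √t))).mul_prod (integrable_const (μ := angMeasure) (1 : ℝ))
    refine hdom.mono' ?_ ?_
    · refine AEStronglyMeasurable.smul ?_ (hf.1.comp_fst.smul ?_)
      · have := continuous_heatKernel t
        have := continuous_cylMap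
        exact Continuous.aestronglyMeasurable (by fun_prop)
      · exact (hε.comp continuous_snd).aestronglyMeasurable
    · filter_upwards [ae_prod_fst_mem_Omega] with q hq
      have hq0 : 0 < q.1.1 := hq
      have h1 := heatKernel_cylMap_le ht hx hq φ q.2
      have h2 := heatKernel_nonneg ht (cylMap (x, φ) - cylMap q)
      rw [norm_smul, norm_smul, Real.norm_eq_abs, abs_of_nonneg (by positivity), Real.norm_eq_abs,
        mul_one, ← mul_assoc (_ / _)]
      have h3 := mul_kap_gauss_le ht hx hq
      calc _ ≤ (q.1.1 * (kap t * gauss (4 * t) x q.1)) * (|f q.1| * 1) := by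
            have h4 := kap_pos ht
            have h5 := gauss_pos (4 * t) x q.1
            gcongr
            exact hε1 _
        _ ≤ _ := by
            rw [mul_one]
            gcongr
  refine ⟨(integrable_iff_cylMap hmeas).2 ((integrable_congr heq).2 hint), ?_⟩
  change ∫ y, heatKernel t (cylMap (x, φ) - y) • F y = _
  rw [integral_eq_cylMap hmeas, integral_congr_ae heq, integral_prod _ hint, ← integral_smul_const]
  refine integral_congr_ae (Filter.Eventually.of_forall fun y => ?_)
  simp only
  have e : ∀ θ, (y.1 * heatKernel t (cylMap (x, φ) - cylMap (y, θ))) • (f y • ε θ) =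
      (y.1 * (kap t / 2 * gauss (4 * t) x y) * f y) •
        (Real.exp (-(x.1 * y.1 / t) * Real.sin ((θ - φ) / 2) ^ 2) • ε θ) := by
    intro θ
    rw [heatKernel_cylMap ht, smul_smul, smul_smul]
    congr 1; ring
  simp_rw [e]
  rw [integral_smul, hw, smul_smul]
  congr 1
  unfold wKernel
  ring

theorem norm_angVec (θ : ℝ) : ‖angVec θ‖ ≤ 1 := by
  have h : ‖angVec θ‖ ^ 2 = 1 := by
    rw [EuclideanSpace.norm_sq_eq, Fin.sum_univ_three]
    simp [angVec]
  nlinarith [norm_nonneg (angVec θ)]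

theorem aestronglyMeasurable_comp_cyl {f : ℝ × ℝ → ℝ} (hf : AEStronglyMeasurable f muOmega) :
    AEStronglyMeasurable (fun y : E3 => f (cyl y)) :=
  hf.comp_quasiMeasurePreserving quasiMeasurePreserving_cyl

theorem S1_eq {t : ℝ} (ht : 0 < t) (f : ℝ × ℝ → ℝ) {x : ℝ × ℝ} (hx : x ∈ Omega) :
    S1 t f x = ∫ y, wKernel cosWeight t x y * f y ∂muOmega := by
  rw [S1, if_neg ht.ne']
  refine integral_congr_ae ?_
  filter_upwards [ae_mem_Omega] with y hy
  rw [K1_eq ht hx hy]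

theorem S2_eq {t : ℝ} (ht : 0 < t) (f : ℝ × ℝ → ℝ) {x : ℝ × ℝ} (hx : x ∈ Omega) :
    S2 t f x = ∫ y, wKernel oneWeight t x y * f y ∂muOmega := by
  rw [S2, if_neg ht.ne']
  refine integral_congr_ae ?_
  filter_upwards [ae_mem_Omega] with y hy
  rw [K2_eq ht hx hy]

theorem heatFlow_swirl {p : ℝ≥0∞} (hp : 1 ≤ p) {f : ℝ × ℝ → ℝ} (hf : MemLp f p muOmega) {t : ℝ}
    (ht : 0 < t) {x : E3} (hx : cyl x ∈ Omega) :
    Integrable (fun y => heatKernel t (x - y) • (f (cyl y) • eTheta y)) ∧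
      S1 t f (cyl x) • eTheta x = heatFlow t (fun y => f (cyl y) • eTheta y) x := by
  obtain ⟨φ, hφ⟩ := exists_cylMap_eq x
  have h := heatFlow_cylMap hp hf ht
    ((aestronglyMeasurable_comp_cyl hf.1).smul measurable_eTheta.aestronglyMeasurable)
    continuous_angVec norm_angVec (fun y hy θ => by
      simp only [Pi.smul_apply', cyl_cylMap hy, eTheta_cylMap hy])
    (integral_angVec · φ) hx
  rw [← hφ] at h
  refine ⟨h.1, ?_⟩
  rw [S1_eq ht f hx, show eTheta x = angVec φ by rw [hφ]; exact eTheta_cylMap hx φ]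
  exact h.2.symm

theorem heatFlow_scalar {p : ℝ≥0∞} (hp : 1 ≤ p) {f : ℝ × ℝ → ℝ} (hf : MemLp f p muOmega) {t : ℝ}
    (ht : 0 < t) {x : E3} (hx : cyl x ∈ Omega) :
    Integrable (fun y => heatKernel t (x - y) • f (cyl y)) ∧
      S2 t f (cyl x) = heatFlow t (fun y => f (cyl y)) x := by
  obtain ⟨φ, hφ⟩ := exists_cylMap_eq x
  have h := heatFlow_cylMap hp hf ht (aestronglyMeasurable_comp_cyl hf.1) (ε := fun _ => (1 : ℝ))
    continuous_const (by simp) (fun y hy θ => by simp [cyl_cylMap hy])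
    (integral_angMass · φ) hx
  rw [← hφ] at h
  refine ⟨h.1, ?_⟩
  rw [S2_eq ht f hx, h.2, smul_eq_mul, mul_one]

/-! ### The semigroup property -/

/-- Completing the square in `y`: the product is a Gaussian about a weighted mean of `x` and `z`,
which makes the convolution identity immediate. -/
theorem heatKernel_mul {s t : ℝ} (hs : 0 < s) (ht : 0 < t) (x y z : E3) :
    heatKernel s (x - y) * heatKernel t (y - z) =
      heatKernel (s + t) (x - z) * heatKernel (s * t / (s + t))
        (y - ((t / (s + t)) • x + (s / (s + t)) • z)) := by
  have hst : 0 < s + t := by positivity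
  have e1 : ‖x - y‖ ^ 2 / (4 * s) + ‖y - z‖ ^ 2 / (4 * t) = ‖x - z‖ ^ 2 / (4 * (s + t)) +
      ‖y - ((t / (s + t)) • x + (s / (s + t)) • z)‖ ^ 2 / (4 * (s * t / (s + t))) := by
    simp only [EuclideanSpace.norm_sq_eq, Fin.sum_univ_three, PiLp.sub_apply, PiLp.add_apply,
      PiLp.smul_apply, Real.norm_eq_abs, sq_abs, smul_eq_mul]
    field_simp
    ring
  have e2 : 1 / (4 * Real.pi * s) ^ (3 / 2 : ℝ) * (1 / (4 * Real.pi * t) ^ (3 / 2 : ℝ)) =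
      1 / (4 * Real.pi * (s + t)) ^ (3 / 2 : ℝ) *
        (1 / (4 * Real.pi * (s * t / (s + t))) ^ (3 / 2 : ℝ)) := by
    rw [one_div_mul_one_div, one_div_mul_one_div, ← Real.mul_rpow (by positivity) (by positivity),
      ← Real.mul_rpow (by positivity) (by positivity)]
    congr 2
    field_simp
  unfold heatKernel
  have e3 : ∀ a b c d : ℝ, a * b * (c * d) = a * c * (b * d) := fun a b c d => by ring
  rw [e3, e2, e3 _ (Real.exp _), ← Real.exp_add, ← Real.exp_add, neg_div, neg_div, neg_div,
    neg_div, ← neg_add, ← neg_add, e1]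

theorem integral_heatKernel {t : ℝ} (ht : 0 < t) : ∫ y, heatKernel t y = 1 := by
  have hb : 0 < 1 / (4 * t) := by positivity
  have h := GaussianFourier.integral_rexp_neg_mul_sq_norm (V := E3) hb
  unfold heatKernel
  rw [integral_const_mul]
  have e : ∀ y : E3, -(‖y‖ ^ 2) / (4 * t) = -(1 / (4 * t)) * ‖y‖ ^ 2 := by
    intro y; ring
  simp_rw [e]
  rw [h, finrank_euclideanSpace_fin, show Real.pi / (1 / (4 * t)) = 4 * Real.pi * t by field_simp]
  push_cast
  exact one_div_mul_cancel (by positivity)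

theorem integrable_heatKernel {t : ℝ} (ht : 0 < t) : Integrable (heatKernel t) := by
  -- The integral of a non-integrable function is `0` by convention, whereas this one equals `1`.
  by_contra h
  have := integral_heatKernel ht
  rw [integral_undef h] at this
  exact zero_ne_one this

theorem integrable_heatKernel_mul {s t : ℝ} (hs : 0 < s) (ht : 0 < t) (x z : E3) :
    Integrable fun y => heatKernel s (x - y) * heatKernel t (y - z) := by
  simp_rw [heatKernel_mul hs ht]
  exact ((integrable_heatKernel (by positivity)).comp_sub_right _).const_mul _

theorem integral_heatKernel_mul {s t : ℝ} (hs : 0 < s) (ht : 0 < t) (x z : E3) :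
    ∫ y, heatKernel s (x - y) * heatKernel t (y - z) = heatKernel (s + t) (x - z) := by
  simp_rw [heatKernel_mul hs ht]
  rw [integral_const_mul, integral_sub_right_eq_self (heatKernel (s * t / (s + t))),
    integral_heatKernel (by positivity), mul_one]

/-- Integrability at the single time `s + t` justifies Fubini: the kernels are nonnegative, so
integrating the norm in the middle variable reproduces the kernel at time `s + t`. -/
theorem heatFlow_heatFlow {V : Type*} [NormedAddCommGroup V] [NormedSpace ℝ V]
    [CompleteSpace V] {F : E3 → V} (hF : AEStronglyMeasurable F) {s t : ℝ} (hs : 0 < s) (ht : 0 < t) (x : E3)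
    (hint : Integrable fun y => heatKernel (s + t) (x - y) • F y) :
    heatFlow s (heatFlow t F) x = heatFlow (s + t) F x := by
  have hm : AEStronglyMeasurable (fun q : E3 × E3 =>
      (heatKernel s (x - q.1) * heatKernel t (q.1 - q.2)) • F q.2) (volume.prod volume) := by
    refine AEStronglyMeasurable.smul ?_ hF.comp_snd
    have := continuous_heatKernel s
    have := continuous_heatKernel t
    exact Continuous.aestronglyMeasurable (by fun_prop)
  have hi : Integrable (fun q : E3 × E3 =>
      (heatKernel s (x - q.1) * heatKernel t (q.1 - q.2)) • F q.2) (volume.prod volume) := by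
    rw [integrable_prod_iff' hm]
    constructor
    · exact Filter.Eventually.of_forall fun z =>
        (integrable_heatKernel_mul hs ht x z).smul_const (F z)
    · refine hint.norm.congr (Filter.Eventually.of_forall fun z => ?_)
      simp only [norm_smul, Real.norm_eq_abs, abs_mul, abs_of_nonneg (heatKernel_nonneg hs _),
        abs_of_nonneg (heatKernel_nonneg ht _)]
      rw [integral_mul_const, integral_heatKernel_mul hs ht,
        abs_of_nonneg (heatKernel_nonneg (by positivity) _)]
  calc heatFlow s (heatFlow t F) x
      = ∫ y, ∫ z, (heatKernel s (x - y) * heatKernel t (y - z)) • F z := by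
        refine integral_congr_ae (Filter.Eventually.of_forall fun y => ?_)
        change heatKernel s (x - y) • (∫ z, heatKernel t (y - z) • F z) = _
        rw [← integral_smul]
        simp only [mul_smul]
    _ = ∫ z, ∫ y, (heatKernel s (x - y) * heatKernel t (y - z)) • F z := integral_integral_swap hi
    _ = _ := by
        refine integral_congr_ae (Filter.Eventually.of_forall fun z => ?_)
        simp only
        rw [integral_smul_const, integral_heatKernel_mul hs ht]
        rfl

theorem heatFlow_congr_ae {V : Type*} [NormedAddCommGroup V] [NormedSpace ℝ V] {F G : E3 → V}
    (h : F =ᵐ[volume] G) (t : ℝ) (x : E3) : heatFlow t F x = heatFlow t G x := by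
  refine integral_congr_ae ?_
  filter_upwards [h] with y hy
  rw [hy]

theorem gaussBound_wKernel {w : ℝ → ℝ} (hw : Continuous w) (h1 : ∀ α, |w α| ≤ 1) {t : ℝ}
    (ht : 0 < t) : GaussBound (wKernel w t) (3584 / t) (8 * t) where
  meas := (continuous_wKernel hw t).measurable
  nonneg := by positivity
  pos := by positivity
  le _ hx _ hy := abs_wKernel_le h1 ht hx hy

theorem S1_ae_eq {t : ℝ} (ht : 0 < t) (f : ℝ × ℝ → ℝ) :
    S1 t f =ᵐ[muOmega] fun x => ∫ y, wKernel cosWeight t x y * f y ∂muOmega := by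
  filter_upwards [ae_mem_Omega] with x hx using S1_eq ht f hx

theorem S2_ae_eq {t : ℝ} (ht : 0 < t) (f : ℝ × ℝ → ℝ) :
    S2 t f =ᵐ[muOmega] fun x => ∫ y, wKernel oneWeight t x y * f y ∂muOmega := by
  filter_upwards [ae_mem_Omega] with x hx using S2_eq ht f hx

theorem memLp_S1 {t : ℝ} (ht : 0 < t) {p q : ℝ≥0∞} (hp : 1 ≤ p) (hpq : p ≤ q) {f : ℝ × ℝ → ℝ}
    (hf : MemLp f p muOmega) : MemLp (S1 t f) q muOmega :=
  (memLp_congr_ae (S1_ae_eq ht f)).2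
    ((gaussBound_wKernel continuous_cosWeight abs_cosWeight_le ht).memLp hp hpq hf)

theorem memLp_S2 {t : ℝ} (ht : 0 < t) {p q : ℝ≥0∞} (hp : 1 ≤ p) (hpq : p ≤ q) {f : ℝ × ℝ → ℝ}
    (hf : MemLp f p muOmega) : MemLp (S2 t f) q muOmega :=
  (memLp_congr_ae (S2_ae_eq ht f)).2
    ((gaussBound_wKernel continuous_oneWeight abs_oneWeight_le ht).memLp hp hpq hf)

theorem S2_add {s t : ℝ} (hs : 0 < s) (ht : 0 < t) {p : ℝ≥0∞} (hp : 1 ≤ p) {f : ℝ × ℝ → ℝ}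
    (hf : MemLp f p muOmega) {x : ℝ × ℝ} (hx : x ∈ Omega) :
    S2 s (S2 t f) x = S2 (s + t) f x := by
  have hxc : cyl (cylMap (x, 0)) ∈ Omega := by rwa [cyl_cylMap hx]
  have h1 := (heatFlow_scalar hp (memLp_S2 ht hp le_rfl hf) hs hxc).2
  have h2 := heatFlow_scalar hp hf (add_pos hs ht) hxc
  rw [cyl_cylMap hx] at h1
  have h2' := h2.2
  rw [cyl_cylMap hx] at h2'
  rw [h1, h2', ← heatFlow_heatFlow (aestronglyMeasurable_comp_cyl hf.1) hs ht _ h2.1]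
  refine heatFlow_congr_ae ?_ s _
  filter_upwards [ae_cyl_mem_Omega] with y hy using (heatFlow_scalar hp hf ht hy).2

theorem S1_add {s t : ℝ} (hs : 0 < s) (ht : 0 < t) {p : ℝ≥0∞} (hp : 1 ≤ p) {f : ℝ × ℝ → ℝ}
    (hf : MemLp f p muOmega) {x : ℝ × ℝ} (hx : x ∈ Omega) :
    S1 s (S1 t f) x = S1 (s + t) f x := by
  have hxc : cyl (cylMap (x, 0)) ∈ Omega := by rwa [cyl_cylMap hx]
  have h1 := (heatFlow_swirl hp (memLp_S1 ht hp le_rfl hf) hs hxc).2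
  have h2 := heatFlow_swirl hp hf (add_pos hs ht) hxc
  have h3 : S1 s (S1 t f) x • eTheta (cylMap (x, 0)) =
      S1 (s + t) f x • eTheta (cylMap (x, 0)) := by
    have h2' := h2.2
    rw [cyl_cylMap hx] at h1 h2'
    have hF : AEStronglyMeasurable (fun y => f (cyl y) • eTheta y) :=
      (aestronglyMeasurable_comp_cyl hf.1).smul measurable_eTheta.aestronglyMeasurable
    rw [h1, h2', ← heatFlow_heatFlow hF hs ht _ h2.1]
    refine heatFlow_congr_ae ?_ s _
    filter_upwards [ae_cyl_mem_Omega] with y hy using (heatFlow_swirl hp hf ht hy).2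
  rw [eTheta_cylMap hx] at h3
  -- At the angle `0` the component of index `1` of `e_θ` is `cos 0 = 1`, so the scalar identity can
  -- be read off.
  have h4 := congrArg (fun v : E3 => v 1) h3
  simpa [angVec] using h4

/-- The heat flow of `ℝ³` preserves constants. This makes `K2` an approximate identity without any
computation on `N2`. -/
theorem S2_one {t : ℝ} (ht : 0 < t) {x : ℝ × ℝ} (hx : x ∈ Omega) :
    ∫ y, wKernel oneWeight t x y ∂muOmega = 1 := by
  have hxc : cyl (cylMap (x, 0)) ∈ Omega := by rwa [cyl_cylMap hx]
  have h := (heatFlow_scalar (p := ∞) le_top (f := fun _ => 1) (memLp_top_const 1) ht hxc).2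
  rw [cyl_cylMap hx, S2_eq ht _ hx] at h
  simp only [mul_one] at h
  rw [h]
  change ∫ y, heatKernel t (cylMap (x, 0) - y) • (1 : ℝ) = 1
  simp only [smul_eq_mul, mul_one]
  rw [integral_sub_left_eq_self (heatKernel t), integral_heatKernel ht]

/-! ### The operators on `L^p(Ω)` -/

instance : IsFiniteMeasureOnCompacts muOmega := by unfold muOmega; infer_instance

/-- The bounded operator on `L^p(Ω)` with a kernel that has a Gaussian majorant. -/
def kernelOp {k : ℝ × ℝ → ℝ × ℝ → ℝ} {M b : ℝ} (hk : GaussBound k M b) (p : ℝ≥0∞)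
    [hp : Fact (1 ≤ p)] : Lp ℝ p muOmega →L[ℝ] Lp ℝ p muOmega :=
  LinearMap.mkContinuous
    { toFun := fun u => (hk.memLp hp.out le_rfl (Lp.memLp u)).toLp _
      map_add' := fun u v => by
        rw [← MemLp.toLp_add]
        refine MemLp.toLp_congr _ _ ?_
        filter_upwards [ae_mem_Omega] with x hx
        rw [Pi.add_apply, ← integral_add (hk.integrable hp.out (Lp.memLp u) hx)
          (hk.integrable hp.out (Lp.memLp v) hx)]
        refine integral_congr_ae ?_
        filter_upwards [Lp.coeFn_add u v] with y hy
        rw [hy, Pi.add_apply, mul_add]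
      map_smul' := fun c u => by
        rw [RingHom.id_apply, ← MemLp.toLp_const_smul]
        refine MemLp.toLp_congr _ _ ?_
        refine Eventually.of_forall fun x => ?_
        rw [Pi.smul_apply, ← integral_smul]
        refine integral_congr_ae ?_
        filter_upwards [Lp.coeFn_smul c u] with y hy
        rw [hy, Pi.smul_apply, smul_eq_mul, smul_eq_mul]
        ring }
    (M * (Real.pi * b)) fun u => by
      have h := hk.eLpNorm_le hp.out le_rfl (Lp.memLp u)
      rw [sub_self, sub_zero, Real.rpow_one] at h
      have hnn : 0 ≤ M * (Real.pi * b) := by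
        have := hk.nonneg
        have := hk.pos
        positivity
      simp only [LinearMap.coe_mk, AddHom.coe_mk]
      rw [Lp.norm_toLp, Lp.norm_def, ← ENNReal.toReal_ofReal hnn, ← ENNReal.toReal_mul]
      exact ENNReal.toReal_mono
        (ENNReal.mul_ne_top ENNReal.ofReal_ne_top (Lp.memLp u).eLpNorm_ne_top) h

section

variable {p : ℝ≥0∞} [hp : Fact (1 ≤ p)]

theorem kernelOp_ae_eq {k : ℝ × ℝ → ℝ × ℝ → ℝ} {M b : ℝ} (hk : GaussBound k M b)
    (u : Lp ℝ p muOmega) :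
    kernelOp hk p u =ᵐ[muOmega] fun x => ∫ y, k x y * u y ∂muOmega :=
  MemLp.coeFn_toLp (hk.memLp hp.out le_rfl (Lp.memLp u))

theorem norm_kernelOp_le {k : ℝ × ℝ → ℝ × ℝ → ℝ} {M b : ℝ} (hk : GaussBound k M b)
    (u : Lp ℝ p muOmega) : ‖kernelOp hk p u‖ ≤ M * (Real.pi * b) * ‖u‖ := by
  have hnn : 0 ≤ M * (Real.pi * b) := by
    have := hk.nonneg
    have := hk.pos
    positivity
  refine ContinuousLinearMap.le_of_opNorm_le _ ?_ u
  exact LinearMap.mkContinuous_norm_le _ hnn _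

/-- An admissible angular weight. -/
structure IsWeight (w : ℝ → ℝ) : Prop where
  cont : Continuous w
  le_one : ∀ α, |w α| ≤ 1

theorem isWeight_oneWeight : IsWeight oneWeight := ⟨continuous_oneWeight, abs_oneWeight_le⟩

theorem isWeight_cosWeight : IsWeight cosWeight := ⟨continuous_cosWeight, abs_cosWeight_le⟩

theorem IsWeight.gaussBound {w : ℝ → ℝ} (hw : IsWeight w) {t : ℝ} (ht : 0 < t) :
    GaussBound (wKernel w t) (3584 / t) (8 * t) :=
  gaussBound_wKernel hw.cont hw.le_one ht

/-- The operator on `L^p(Ω)` with kernel `wKernel w t`, and the identity for `t ≤ 0`. -/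
def evolOp {w : ℝ → ℝ} (hw : IsWeight w) (p : ℝ≥0∞) [Fact (1 ≤ p)] (t : ℝ) :
    Lp ℝ p muOmega →L[ℝ] Lp ℝ p muOmega :=
  if ht : 0 < t then kernelOp (hw.gaussBound ht) p else ContinuousLinearMap.id ℝ _

variable {w : ℝ → ℝ} (hw : IsWeight w)

theorem evolOp_of_pos {t : ℝ} (ht : 0 < t) : evolOp hw p t = kernelOp (hw.gaussBound ht) p :=
  dif_pos ht

theorem evolOp_of_nonpos {t : ℝ} (ht : t ≤ 0) : evolOp hw p t = ContinuousLinearMap.id ℝ _ :=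
  dif_neg (not_lt.2 ht)

theorem evolOp_ae_eq {t : ℝ} (ht : 0 < t) (u : Lp ℝ p muOmega) :
    evolOp hw p t u =ᵐ[muOmega] fun x => ∫ y, wKernel w t x y * u y ∂muOmega := by
  rw [evolOp_of_pos hw ht]
  exact kernelOp_ae_eq _ u

theorem norm_evolOp_le (t : ℝ) (u : Lp ℝ p muOmega) : ‖evolOp hw p t u‖ ≤ 90317 * ‖u‖ := by
  rcases lt_or_ge 0 t with ht | ht
  · rw [evolOp_of_pos hw ht]
    refine (norm_kernelOp_le _ u).trans ?_
    gcongr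
    -- The time cancels, and `28672 · 3.15 < 90317`.
    have : 3584 / t * (Real.pi * (8 * t)) = 28672 * Real.pi := by field_simp; ring
    rw [this]
    have := Real.pi_lt_d2
    linarith
  · rw [evolOp_of_nonpos hw ht, ContinuousLinearMap.id_apply]
    linarith [norm_nonneg u]

/-! ### Continuity at positive times. -/

theorem gauss_mono {x y : ℝ × ℝ} {b c : ℝ} (hb : 0 < b) (hbc : b ≤ c) :
    gauss b x y ≤ gauss c x y := by
  unfold gauss
  rw [Real.exp_le_exp, neg_div, neg_div, neg_le_neg_iff]
  exact div_le_div_of_nonneg_left (sqDist_nonneg x y) hb hbc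

include hw in
-- Mean value inequality in time. On `[s/2, 2s]` the bound for `dtKernel` is uniform: the variance
-- is at most `16 s` and the prefactor is largest at `s/2`.
theorem abs_wKernel_sub_le {s t : ℝ} (hs : 0 < s) (ht : t ∈ Set.Icc (s / 2) (2 * s))
    {x y : ℝ × ℝ} (hx : x ∈ Omega) (hy : y ∈ Omega) :
    |wKernel w t x y - wKernel w s x y| ≤
      10752 / (s / 2) ^ 2 * |t - s| * gauss (16 * s) x y := by
  have h := (convex_Icc (s / 2) (2 * s)).norm_image_sub_le_of_norm_hasDerivWithin_le
    (f := fun t => wKernel w t x y) (f' := fun t => dtKernel w t x y)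
    (C := 10752 / (s / 2) ^ 2 * gauss (16 * s) x y) (x := s) (y := t) ?_ ?_ ?_ ht
  · simp only [Real.norm_eq_abs] at h
    linarith
  · intro r hr
    have hr0 : 0 < r := lt_of_lt_of_le (by positivity) hr.1
    exact (hasDerivAt_wKernel_time hw.cont hw.le_one hr0 x y).hasDerivWithinAt
  · intro r hr
    have hr0 : 0 < r := lt_of_lt_of_le (by positivity) hr.1
    have hr1 := hr.1
    refine (abs_dtKernel_le hw.le_one hr0 hx hy).trans ?_
    have h1 := gauss_mono (x := x) (y := y) (show 0 < 8 * r by positivity)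
      (show 8 * r ≤ 16 * s by linarith [hr.2])
    gcongr
    exact (gauss_pos _ _ _).le
  · exact ⟨by linarith, by linarith⟩

include hw in
theorem gaussBound_sub {s t : ℝ} (hs : 0 < s) (ht : t ∈ Set.Icc (s / 2) (2 * s)) :
    GaussBound (fun x y => wKernel w t x y - wKernel w s x y)
      (10752 / (s / 2) ^ 2 * |t - s|) (16 * s) where
  meas := (continuous_wKernel hw.cont t).measurable.sub (continuous_wKernel hw.cont s).measurable
  nonneg := by positivity
  pos := by positivity
  le _ hx _ hy := abs_wKernel_sub_le hw hs ht hx hy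

theorem norm_evolOp_sub_le {s t : ℝ} (hs : 0 < s) (ht : t ∈ Set.Icc (s / 2) (2 * s))
    (u : Lp ℝ p muOmega) :
    ‖evolOp hw p t u - evolOp hw p s u‖ ≤
      10752 / (s / 2) ^ 2 * |t - s| * (Real.pi * (16 * s)) * ‖u‖ := by
  have ht0 : 0 < t := lt_of_lt_of_le (by positivity) ht.1
  have e : evolOp hw p t u - evolOp hw p s u = kernelOp (gaussBound_sub hw hs ht) p u := by
    apply Lp.ext
    filter_upwards [Lp.coeFn_sub (evolOp hw p t u) (evolOp hw p s u), evolOp_ae_eq hw ht0 u,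
      evolOp_ae_eq hw hs u, kernelOp_ae_eq (gaussBound_sub hw hs ht) u, ae_mem_Omega]
      with x h1 h2 h3 h4 hx
    rw [h1, Pi.sub_apply, h2, h3, h4, ← integral_sub
      ((hw.gaussBound ht0).integrable hp.out (Lp.memLp u) hx)
      ((hw.gaussBound hs).integrable hp.out (Lp.memLp u) hx)]
    simp only [sub_mul]
  rw [e]
  exact norm_kernelOp_le _ u

theorem continuousAt_evolOp {s : ℝ} (hs : 0 < s) (u : Lp ℝ p muOmega) :
    ContinuousAt (fun t => evolOp hw p t u) s := by
  rw [ContinuousAt, tendsto_iff_norm_sub_tendsto_zero]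
  refine squeeze_zero' (g := fun t => 10752 / (s / 2) ^ 2 * |t - s| * (Real.pi * (16 * s)) * ‖u‖)
    (Eventually.of_forall fun t => norm_nonneg _) ?_ ?_
  · filter_upwards [Icc_mem_nhds (show s / 2 < s by linarith) (show s < 2 * s by linarith)]
      with t ht
    exact norm_evolOp_sub_le hw hs ht u
  · have : Continuous fun t : ℝ =>
        10752 / (s / 2) ^ 2 * |t - s| * (Real.pi * (16 * s)) * ‖u‖ := by fun_prop
    have h := this.tendsto s
    simpa using h

/-! ### Strong continuity at the origin -/

theorem integral_gauss_le {b : ℝ} (hb : 0 < b) (x : ℝ × ℝ) :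
    ∫ y, gauss b x y ∂muOmega ≤ Real.pi * b := by
  rw [integral_eq_lintegral_of_nonneg_ae (Eventually.of_forall fun y => (gauss_pos _ _ _).le)
    ((continuous_gauss b).comp (Continuous.prodMk_right x)).aestronglyMeasurable]
  refine ENNReal.toReal_le_of_le_ofReal (by positivity) ?_
  exact lintegral_egauss_le hb x

theorem integrable_gauss {b : ℝ} (hb : 0 < b) {x : ℝ × ℝ} (hx : x ∈ Omega) :
    Integrable (gauss b x) muOmega := by
  simpa using (gaussBound_gauss hb).integrable (p := ∞) le_top (memLp_top_const (1 : ℝ)) hx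

theorem norm_sub_le_sqDist {t : ℝ} (ht : 0 < t) (x y : ℝ × ℝ) :
    ‖x - y‖ ≤ √t * (1 + sqDist x y / t) := by
  rw [Prod.norm_def]
  exact max_le (abs_fst_sub_le ht x y) (abs_snd_sub_le ht x y)

theorem one_add_mul_gauss_le {t : ℝ} (ht : 0 < t) (x y : ℝ × ℝ) :
    (1 + sqDist x y / t) * gauss (8 * t) x y ≤ 16 * gauss (16 * t) x y := by
  have hv : 0 ≤ sqDist x y / t := div_nonneg (sqDist_nonneg _ _) ht.le
  have h := Real.add_one_le_exp (sqDist x y / t / 16)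
  have e : gauss (16 * t) x y = Real.exp (sqDist x y / t / 16) * gauss (8 * t) x y := by
    unfold gauss
    rw [← Real.exp_add]
    congr 1
    field_simp
    ring
  rw [e, ← mul_assoc]
  have := gauss_pos (8 * t) x y
  gcongr
  linarith

/-- By `S2_one` the difference is the integral of `K2 · (g y - g x)`, and the Lipschitz bound gains
`√t`. The integrand vanishes unless `x` or `y` lies in the support of `g`; the two indicators record
this and keep the `L^p` norm finite. -/
theorem abs_scalar_sub_le {g : ℝ × ℝ → ℝ} {L : ℝ} (hL : 0 ≤ L)
    (hg : ∀ x y, |g x - g y| ≤ L * ‖x - y‖) (hgc : Continuous g) (hgs : HasCompactSupport g)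
    {t : ℝ} (ht : 0 < t) {x : ℝ × ℝ} (hx : x ∈ Omega) :
    |∫ y, wKernel oneWeight t x y * g y ∂muOmega - g x| ≤
      (∫ y, (57344 * L * √t / t * gauss (16 * t) x y) * (tsupport g).indicator 1 y ∂muOmega) +
        57344 * L * √t / t * (Real.pi * (16 * t)) * (tsupport g).indicator 1 x := by
  set S := tsupport g
  set M := 57344 * L * √t / t
  have hM : 0 ≤ M := by positivity
  have hb : 0 < 16 * t := by positivity
  have hSm : MeasurableSet S := (isClosed_tsupport g).measurableSet
  have hgm : MemLp g ∞ muOmega := hgc.memLp_of_hasCompactSupport hgs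
  have hK := isWeight_oneWeight.gaussBound ht
  have i1 := hK.integrable le_top hgm hx
  have i2 : Integrable (fun y => wKernel oneWeight t x y * g x) muOmega :=
    hK.integrable (p := ∞) le_top (memLp_top_const (g x)) hx
  have hind : MemLp (S.indicator (1 : ℝ × ℝ → ℝ)) ∞ muOmega :=
    (memLp_top_const (1 : ℝ)).indicator hSm
  have i3 : Integrable (fun y => (M * gauss (16 * t) x y) * S.indicator 1 y) muOmega := by
    have := ((gaussBound_gauss hb).integrable le_top hind hx).const_mul M
    simpa only [mul_assoc] using this
  have i4 : Integrable (fun y => (M * gauss (16 * t) x y) * S.indicator 1 x) muOmega :=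
    ((integrable_gauss hb hx).const_mul M).mul_const _
  have e : ∫ y, wKernel oneWeight t x y * g y ∂muOmega - g x =
      ∫ y, (wKernel oneWeight t x y * g y - wKernel oneWeight t x y * g x) ∂muOmega := by
    rw [integral_sub i1 i2, integral_mul_const, S2_one ht hx, one_mul]
  have hind0 : ∀ z, (0 : ℝ) ≤ S.indicator 1 z := fun z =>
    Set.indicator_nonneg (fun _ _ => zero_le_one) z
  calc _ = ‖∫ y, (wKernel oneWeight t x y * g y - wKernel oneWeight t x y * g x) ∂muOmega‖ := by
        rw [e, Real.norm_eq_abs]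
    _ ≤ ∫ y, ((M * gauss (16 * t) x y) * S.indicator 1 y +
          (M * gauss (16 * t) x y) * S.indicator 1 x) ∂muOmega := by
        refine norm_integral_le_of_norm_le (i3.add i4) ?_
        filter_upwards [ae_mem_Omega] with y hy
        rw [← mul_sub, ← mul_add, Real.norm_eq_abs, abs_mul]
        by_cases hxy : y ∈ S ∨ x ∈ S
        · have h1 : (1 : ℝ) ≤ S.indicator 1 y + S.indicator 1 x := by
            rcases hxy with h | h
            · rw [Set.indicator_of_mem h, Pi.one_apply]; linarith [hind0 x]
            · rw [Set.indicator_of_mem h, Pi.one_apply]; linarith [hind0 y]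
          have h2 := abs_wKernel_le abs_oneWeight_le ht hx hy
          have h3 := hg y x
          have h4 := norm_sub_le_sqDist ht x y
          rw [norm_sub_rev] at h3
          have h5 := one_add_mul_gauss_le ht x y
          have hg8 := gauss_pos (8 * t) x y
          have hg16 := gauss_pos (16 * t) x y
          calc _ ≤ (3584 / t * gauss (8 * t) x y) * (L * (√t * (1 + sqDist x y / t))) := by
                gcongr
                exact h3.trans (by gcongr)
            _ = 3584 / t * L * √t * ((1 + sqDist x y / t) * gauss (8 * t) x y) := by ring
            _ ≤ 3584 / t * L * √t * (16 * gauss (16 * t) x y) := by gcongr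
            _ = M * gauss (16 * t) x y * 1 := by simp only [M]; ring
            _ ≤ _ := by gcongr
        · push Not at hxy
          rw [image_eq_zero_of_notMem_tsupport hxy.1, image_eq_zero_of_notMem_tsupport hxy.2,
            sub_zero, abs_zero, mul_zero]
          have := gauss_pos (16 * t) x y
          have := hind0 x
          have := hind0 y
          positivity
    _ ≤ _ := by
        rw [integral_add i3 i4, integral_mul_const, integral_const_mul]
        have := hind0 x
        have := integral_gauss_le hb x
        gcongr

theorem eLpNorm_scalar_sub_le {g : ℝ × ℝ → ℝ} {L : ℝ} (hL : 0 ≤ L)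
    (hg : ∀ x y, |g x - g y| ≤ L * ‖x - y‖) (hgc : Continuous g) (hgs : HasCompactSupport g)
    {t : ℝ} (ht : 0 < t) :
    eLpNorm (fun x => ∫ y, wKernel oneWeight t x y * g y ∂muOmega - g x) p muOmega ≤
      2 * ENNReal.ofReal (57344 * L * 16 * Real.pi * √t) *
        eLpNorm ((tsupport g).indicator (1 : ℝ × ℝ → ℝ)) p muOmega := by
  have hb : 0 < 16 * t := by positivity
  have hM : 0 ≤ 57344 * L * √t / t := by positivity
  have hk : GaussBound (fun x y => 57344 * L * √t / t * gauss (16 * t) x y)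
      (57344 * L * √t / t) (16 * t) :=
    ⟨(continuous_gauss _).measurable.const_mul _, hM, hb, fun x _ y _ => by
      rw [abs_mul, abs_of_nonneg hM, abs_of_pos (gauss_pos _ _ _)]⟩
  have hS : MeasurableSet (tsupport g) := (isClosed_tsupport g).measurableSet
  have hfin : muOmega (tsupport g) ≠ ∞ := by
    refine ((Measure.restrict_apply_le _ _).trans_lt ?_).ne
    exact hgs.isCompact.measure_lt_top
  have hind : MemLp ((tsupport g).indicator (1 : ℝ × ℝ → ℝ)) p muOmega :=
    memLp_indicator_const p hS (1 : ℝ) (Or.inr hfin)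
  have e : 57344 * L * √t / t * (Real.pi * (16 * t)) = 57344 * L * 16 * Real.pi * √t := by
    field_simp
  have h1 := hk.eLpNorm_le hp.out le_rfl hind
  rw [sub_self, sub_zero, Real.rpow_one, e] at h1
  have m1 := (hk.memLp hp.out le_rfl hind).1
  have m2 := (hind.const_mul (57344 * L * √t / t * (Real.pi * (16 * t)))).1
  refine (eLpNorm_mono_ae (g := (fun x => ∫ y, (57344 * L * √t / t * gauss (16 * t) x y) *
    (tsupport g).indicator 1 y ∂muOmega) + fun x => 57344 * L * √t / t * (Real.pi * (16 * t)) *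
      (tsupport g).indicator 1 x) ?_).trans ?_
  · filter_upwards [ae_mem_Omega] with x hx
    exact (abs_scalar_sub_le hL hg hgc hgs ht hx).trans (le_abs_self _)
  · refine (eLpNorm_add_le m1 m2 hp.out).trans ?_
    rw [two_mul, add_mul]
    gcongr
    refine (eLpNorm_le_mul_eLpNorm_of_ae_le_mul (Eventually.of_forall fun x => ?_) p).trans
      (le_of_eq (by rw [← e]))
    rw [norm_mul, Real.norm_of_nonneg (by positivity)]

theorem tendsto_of_dense {E : Type*} [NormedAddCommGroup E] [NormedSpace ℝ E]
    {ι : Type*} {l : Filter ι} {T : ι → E →L[ℝ] E} {C : ℝ} (hT : ∀ t u, ‖T t u‖ ≤ C * ‖u‖)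
    {D : Set E} (hD : Dense D) (h : ∀ u ∈ D, Tendsto (fun t => T t u) l (𝓝 u)) (u : E) :
    Tendsto (fun t => T t u) l (𝓝 u) := by
  rw [Metric.tendsto_nhds]
  intro ε hε
  have hδ : 0 < ε / (2 * (|C| + 1)) := by positivity
  obtain ⟨v, hvD, hv⟩ := Metric.dense_iff.1 hD u _ hδ
  filter_upwards [Metric.tendsto_nhds.1 (h v hv) (ε / 2) (by positivity)] with t ht
  rw [Metric.mem_ball, dist_eq_norm] at hvD
  rw [dist_eq_norm] at ht ⊢
  have e : T t u - u = (T t v - v) - T t (v - u) + (v - u) := by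
    rw [map_sub]; abel
  have h1 := hT t (v - u)
  have h2 : C * ‖v - u‖ + ‖v - u‖ ≤ (|C| + 1) * ‖v - u‖ := by
    have := mul_le_mul_of_nonneg_right (le_abs_self C) (norm_nonneg (v - u))
    linarith
  have h3 : (|C| + 1) * ‖v - u‖ < ε / 2 := by
    rw [lt_div_iff₀ (by positivity)] at hvD
    linarith
  calc _ ≤ ‖T t v - v‖ + ‖T t (v - u)‖ + ‖v - u‖ := by
        rw [e]
        exact (norm_add_le _ _).trans (add_le_add_left (norm_sub_le _ _) _)
    _ < _ := by linarith

theorem tendsto_evolOp_oneWeight (hp' : p ≠ ∞) (u : Lp ℝ p muOmega) :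
    Tendsto (fun t => evolOp isWeight_oneWeight p t u) (𝓝[>] 0) (𝓝 u) := by
  -- The approximants are smooth on the whole plane and need not vanish at the axis; since `𝕊₂`
  -- preserves constants, no boundary condition is needed.
  refine tendsto_of_dense (norm_evolOp_le isWeight_oneWeight)
    (Lp.dense_hasCompactSupport_contDiff hp') ?_ u
  rintro v ⟨g, hvg, hgs, hgd⟩
  have hgc := hgd.continuous
  obtain ⟨L, hL⟩ := ContDiff.lipschitzWith_of_hasCompactSupport hgs hgd (by simp)
  have hL' : ∀ x y, |g x - g y| ≤ L * ‖x - y‖ := fun x y => hL.norm_sub_le x y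
  rw [Lp.tendsto_Lp_iff_tendsto_eLpNorm']
  have hfin : eLpNorm ((tsupport g).indicator (1 : ℝ × ℝ → ℝ)) p muOmega ≠ ∞ := by
    refine (memLp_indicator_const p (isClosed_tsupport g).measurableSet (1 : ℝ)
      (Or.inr ?_)).eLpNorm_ne_top
    exact hgs.isCompact.measure_lt_top.ne
  have hlim : Tendsto (fun t : ℝ => 2 * ENNReal.ofReal (57344 * L * 16 * Real.pi * √t) *
      eLpNorm ((tsupport g).indicator (1 : ℝ × ℝ → ℝ)) p muOmega) (𝓝[>] 0) (𝓝 0) := by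
    have h1 : Continuous fun t : ℝ => 57344 * L * 16 * Real.pi * √t := by fun_prop
    have h2 := ENNReal.tendsto_ofReal (h1.tendsto 0)
    rw [Real.sqrt_zero, mul_zero, ENNReal.ofReal_zero] at h2
    have h3 := ENNReal.Tendsto.mul_const (ENNReal.Tendsto.const_mul h2
      (Or.inr (by norm_num : (2 : ℝ≥0∞) ≠ ∞))) (Or.inr hfin)
    rw [mul_zero, zero_mul] at h3
    exact h3.mono_left nhdsWithin_le_nhds
  refine tendsto_of_tendsto_of_tendsto_of_le_of_le' tendsto_const_nhds hlim
    (Eventually.of_forall fun _ => zero_le) ?_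
  filter_upwards [self_mem_nhdsWithin] with t ht
  refine le_trans (le_of_eq (eLpNorm_congr_ae ?_)) (eLpNorm_scalar_sub_le L.2 hL' hgc hgs ht)
  filter_upwards [evolOp_ae_eq isWeight_oneWeight ht v, hvg] with x h1 h2
  rw [Pi.sub_apply, h1, h2]
  congr 1
  refine integral_congr_ae ?_
  filter_upwards [hvg] with y hy
  rw [hy]

/-! ### Comparison of the swirl kernel with the scalar kernel. -/

/-- The damping factor controlling the difference of the two kernels. -/
def damp (t : ℝ) (y : ℝ × ℝ) : ℝ := min 1 (√t / y.1)

theorem damp_pos {t : ℝ} (ht : 0 < t) {y : ℝ × ℝ} (hy : y ∈ Omega) : 0 < damp t y :=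
  lt_min one_pos (div_pos (Real.sqrt_pos.2 ht) hy)

theorem measurable_damp (t : ℝ) : Measurable (damp t) := by unfold damp; fun_prop

/-- `1 - cos 2α = 2 sin² α`, and the minus sign belongs to `dweight`. -/
theorem angInt_sub (u : ℝ) :
    angInt oneWeight u - angInt cosWeight u = -2 * angInt (dweight oneWeight) u := by
  unfold angInt
  rw [← intervalIntegral.integral_sub, ← intervalIntegral.integral_const_mul]
  · refine intervalIntegral.integral_congr fun α _ => ?_
    simp only [oneWeight, cosWeight, dweight, Real.cos_two_mul, Real.cos_sq']
    ring
  · have := continuous_oneWeight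
    exact Continuous.intervalIntegrable (by fun_prop) _ _
  · have := continuous_cosWeight
    exact Continuous.intervalIntegrable (by fun_prop) _ _

theorem wKernel_sub (t : ℝ) (x y : ℝ × ℝ) :
    wKernel oneWeight t x y - wKernel cosWeight t x y = -2 * wKernel (dweight oneWeight) t x y := by
  unfold wKernel
  linear_combination kap t * y.1 * gauss (4 * t) x y * angInt_sub (x.1 * y.1 / t)

/-- The gain is moved from the kernel to the function: the difference of the operators acts on `f`
as a uniformly bounded operator on `damp t * f`. -/
theorem gaussBound_sub_div {t : ℝ} (ht : 0 < t) :
    GaussBound (fun x y => (wKernel oneWeight t x y - wKernel cosWeight t x y) / damp t y)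
      (7168 / t) (8 * t) where
  meas := ((continuous_wKernel continuous_oneWeight t).measurable.sub
    (continuous_wKernel continuous_cosWeight t).measurable).div
      ((measurable_damp t).comp measurable_snd)
  nonneg := by positivity
  pos := by positivity
  le x hx y hy := by
    have hd := damp_pos ht hy
    rw [wKernel_sub, abs_div, abs_mul, abs_of_pos hd, div_le_iff₀ hd]
    have h1 := abs_wKernel_le (abs_dweight_le_one abs_oneWeight_le) ht hx hy
    have h2 := abs_wKernel_sq_le (abs_dweight_le_sin_sq abs_oneWeight_le) ht hx hy
    have hg := gauss_pos (8 * t) x y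
    norm_num
    rcases min_choice 1 (√t / y.1) with h | h
    · rw [damp, h]
      calc _ ≤ 2 * (3584 / t * gauss (8 * t) x y) := by gcongr
        _ = _ := by ring
    · rw [damp, h]
      calc _ ≤ 2 * (3584 / t * (√t / y.1) * gauss (8 * t) x y) := by gcongr
        _ = _ := by ring

/-- Dominated convergence, since `damp t` is at most one and tends to zero at every point off the
axis. -/
theorem tendsto_eLpNorm_damp_mul (hp' : p ≠ ∞) {f : ℝ × ℝ → ℝ} (hf : MemLp f p muOmega) :
    Tendsto (fun t => eLpNorm (fun y => damp t y * f y) p muOmega) (𝓝[>] 0) (𝓝 0) := by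
  have hp0 : p ≠ 0 := (lt_of_lt_of_le one_pos hp.out).ne'
  have hpr : 0 < p.toReal := ENNReal.toReal_pos hp0 hp'
  have hle : ∀ t > 0, ∀ y ∈ Omega, |damp t y| ≤ 1 := fun t ht y hy => by
    rw [abs_of_pos (damp_pos ht hy)]; exact min_le_left _ _
  simp only [eLpNorm_eq_lintegral_rpow_enorm_toReal hp0 hp']
  have h : Tendsto (fun t => ∫⁻ y, ‖damp t y * f y‖ₑ ^ p.toReal ∂muOmega) (𝓝[>] 0)
      (𝓝 (∫⁻ _, 0 ∂muOmega)) := by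
    refine tendsto_lintegral_filter_of_dominated_convergence' (fun y => ‖f y‖ₑ ^ p.toReal) ?_ ?_
      ?_ ?_
    · exact Eventually.of_forall fun t =>
        ((measurable_damp t).aestronglyMeasurable.mul hf.1).enorm.pow_const _
    · filter_upwards [self_mem_nhdsWithin] with t ht
      filter_upwards [ae_mem_Omega] with y hy
      gcongr
      rw [enorm_mul]
      refine mul_le_of_le_one_left (by positivity) ?_
      rw [Real.enorm_eq_ofReal_abs, ENNReal.ofReal_le_one]
      exact hle t ht y hy
    · exact (lintegral_rpow_enorm_lt_top_of_eLpNorm_lt_top hp0 hp' hf.2).ne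
    · filter_upwards [ae_mem_Omega] with y hy
      -- `damp 0 y = 0` because `√0 = 0`, so the limit is the value at zero of a continuous
      -- function.
      have h1 : Continuous fun t => damp t y * f y := by unfold damp; fun_prop
      have h2 := (ENNReal.continuous_rpow_const (y := p.toReal)).comp
        (continuous_enorm.comp h1)
      have h3 := (h2.tendsto 0).mono_left (nhdsWithin_le_nhds (s := Set.Ioi 0))
      simpa [damp, hpr, Function.comp_def, enorm_mul] using h3
  rw [lintegral_zero] at h
  have h2 := (ENNReal.continuous_rpow_const (y := 1 / p.toReal)).tendsto 0 |>.comp h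
  rw [ENNReal.zero_rpow_of_pos (by positivity)] at h2
  exact h2

theorem tendsto_evolOp_cosWeight (hp' : p ≠ ∞) (u : Lp ℝ p muOmega) :
    Tendsto (fun t => evolOp isWeight_cosWeight p t u) (𝓝[>] 0) (𝓝 u) := by
  have h1 := tendsto_evolOp_oneWeight hp' u
  rw [Lp.tendsto_Lp_iff_tendsto_eLpNorm'] at h1 ⊢
  have h2 := ENNReal.Tendsto.const_mul (tendsto_eLpNorm_damp_mul hp' (Lp.memLp u))
    (Or.inr (ENNReal.ofReal_ne_top (r := 7168 * 8 * Real.pi)))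
  rw [mul_zero] at h2
  have h3 := h1.add h2
  rw [add_zero] at h3
  refine tendsto_of_tendsto_of_tendsto_of_le_of_le' tendsto_const_nhds h3
    (Eventually.of_forall fun _ => zero_le) ?_
  filter_upwards [self_mem_nhdsWithin] with t ht
  have ht0 : 0 < t := ht
  have hk := gaussBound_sub_div ht0
  have hdu : MemLp (fun y => damp t y * u y) p muOmega := by
    refine MemLp.of_le (Lp.memLp u)
      ((measurable_damp t).aestronglyMeasurable.mul (Lp.memLp u).1) ?_
    filter_upwards [ae_mem_Omega] with y hy
    rw [norm_mul]
    refine mul_le_of_le_one_left (norm_nonneg _) ?_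
    rw [Real.norm_eq_abs, abs_of_pos (damp_pos ht hy)]
    exact min_le_left _ _
  have hb := hk.eLpNorm_le hp.out le_rfl hdu
  rw [sub_self, sub_zero, Real.rpow_one,
    show 7168 / t * (Real.pi * (8 * t)) = 7168 * 8 * Real.pi by field_simp] at hb
  have m1 : AEStronglyMeasurable (⇑(evolOp isWeight_oneWeight p t u) - ⇑u) muOmega :=
    (Lp.aestronglyMeasurable _).sub (Lp.aestronglyMeasurable _)
  have m2 := (hk.memLp hp.out le_rfl hdu).1
  refine le_trans (le_of_eq (eLpNorm_congr_ae ?_)) ((eLpNorm_sub_le m1 m2 hp.out).trans ?_)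
  · filter_upwards [evolOp_ae_eq isWeight_oneWeight ht u, evolOp_ae_eq isWeight_cosWeight ht u,
      ae_mem_Omega] with x e1 e2 hx
    rw [Pi.sub_apply, Pi.sub_apply, Pi.sub_apply, e1, e2]
    have e3 : ∫ y, (wKernel oneWeight t x y - wKernel cosWeight t x y) / damp t y *
        (damp t y * u y) ∂muOmega = ∫ y, (wKernel oneWeight t x y * u y -
          wKernel cosWeight t x y * u y) ∂muOmega := by
      refine integral_congr_ae ?_
      filter_upwards [ae_mem_Omega] with y hy
      have := (damp_pos ht hy).ne'
      field_simp
    rw [e3, integral_sub ((isWeight_oneWeight.gaussBound ht).integrable hp.out (Lp.memLp u) hx)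
      ((isWeight_cosWeight.gaussBound ht).integrable hp.out (Lp.memLp u) hx)]
    ring
  · gcongr

/-- Extension by the identity to negative times makes the left limit at zero trivial; only the right
limit is an assumption. -/
theorem continuous_evolOp_of_tendsto {u : Lp ℝ p muOmega}
    (h : Tendsto (fun t => evolOp hw p t u) (𝓝[>] 0) (𝓝 u)) :
    Continuous fun t => evolOp hw p t u := by
  rw [continuous_iff_continuousAt]
  intro s
  rcases lt_trichotomy s 0 with hs | rfl | hs
  · have : (fun t => evolOp hw p t u) =ᶠ[𝓝 s] fun _ => u := by
      filter_upwards [Iio_mem_nhds hs] with t ht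
      rw [evolOp_of_nonpos hw (le_of_lt ht), ContinuousLinearMap.id_apply]
    exact (continuousAt_congr this).2 continuousAt_const
  · have e0 : evolOp hw p 0 u = u := by
      rw [evolOp_of_nonpos hw le_rfl, ContinuousLinearMap.id_apply]
    rw [continuousAt_iff_continuous_left'_right']
    refine ⟨?_, by rw [ContinuousWithinAt, e0]; exact h⟩
    rw [ContinuousWithinAt, e0]
    refine tendsto_const_nhds.congr' ?_
    filter_upwards [self_mem_nhdsWithin] with t ht
    rw [evolOp_of_nonpos hw (le_of_lt ht), ContinuousLinearMap.id_apply]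
  · exact continuousAt_evolOp hw hs u

end

/-! ### The operators with a divergence -/

/-- The original and the regular form of the kernels agree only on `Ω`; as `Ω` is open, this is
enough to identify their derivatives there. -/
theorem dr_congr_of_eqOn {φ ψ : ℝ × ℝ → ℝ} (h : Set.EqOn φ ψ Omega) {y : ℝ × ℝ} (hy : y ∈ Omega) :
    dr φ y = dr ψ y := by
  refine Filter.EventuallyEq.deriv_eq ?_
  filter_upwards [Ioi_mem_nhds (show (0 : ℝ) < y.1 from hy)] with s hs
  exact h (show (s, y.2) ∈ Omega from hs)

theorem dz_congr_of_eqOn {φ ψ : ℝ × ℝ → ℝ} (h : Set.EqOn φ ψ Omega) {y : ℝ × ℝ} (hy : y ∈ Omega) :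
    dz φ y = dz ψ y := by
  unfold dz
  congr 1
  funext s
  exact h (show (y.1, s) ∈ Omega from hy)

theorem dr_wKernel {w : ℝ → ℝ} (hw : IsWeight w) {t : ℝ} (ht : 0 < t) (x y : ℝ × ℝ) :
    dr (wKernel w t x) y = drKernel w t x y :=
  (hasDerivAt_wKernel_fst hw.cont hw.le_one ht x y).deriv

theorem dz_wKernel (w : ℝ → ℝ) {t : ℝ} (ht : 0 < t) (x y : ℝ × ℝ) :
    dz (wKernel w t x) y = dzKernel w t x y :=
  (hasDerivAt_wKernel_snd w ht x y).deriv

/-- The kernel acting on the radial component; `κ = 0` for `div⋆` and `κ = 1` for `div`. -/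
def radKernel (w : ℝ → ℝ) (κ t : ℝ) (x y : ℝ × ℝ) : ℝ :=
  -drKernel w t x y + κ * (wKernel w t x y / y.1)

theorem S1divIntegrand_ae_eq {t : ℝ} (ht : 0 < t) (fr fz : ℝ × ℝ → ℝ) {x : ℝ × ℝ}
    (hx : x ∈ Omega) : S1divIntegrand t fr fz x =ᵐ[muOmega]
      fun y => radKernel cosWeight 0 t x y * fr y + -dzKernel cosWeight t x y * fz y := by
  have h : Set.EqOn (K1 t x) (wKernel cosWeight t x) Omega := fun y hy => K1_eq ht hx hy
  filter_upwards [ae_mem_Omega] with y hy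
  rw [S1divIntegrand, dr_congr_of_eqOn h hy, dz_congr_of_eqOn h hy, dr_wKernel isWeight_cosWeight ht,
    dz_wKernel _ ht, radKernel]
  ring

theorem S2divIntegrand_ae_eq {t : ℝ} (ht : 0 < t) (fr fz : ℝ × ℝ → ℝ) {x : ℝ × ℝ}
    (hx : x ∈ Omega) : S2divIntegrand t fr fz x =ᵐ[muOmega]
      fun y => radKernel oneWeight 1 t x y * fr y + -dzKernel oneWeight t x y * fz y := by
  have h : Set.EqOn (K2 t x) (wKernel oneWeight t x) Omega := fun y hy => K2_eq ht hx hy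
  filter_upwards [ae_mem_Omega] with y hy
  rw [S2divIntegrand, dr_congr_of_eqOn h hy, dz_congr_of_eqOn h hy, dr_wKernel isWeight_oneWeight ht,
    dz_wKernel _ ht, radKernel, K2_eq ht hx hy]
  ring

theorem mul_sqrt_eq_rpow {t : ℝ} (ht : 0 < t) : t * √t = t ^ (1 + 1 / 2 : ℝ) := by
  rw [Real.rpow_add ht, Real.rpow_one, Real.sqrt_eq_rpow]

theorem gaussBound_radKernel {w : ℝ → ℝ} (hw : IsWeight w) {κ : ℝ} (hκ : |κ| ≤ 1) {t : ℝ}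
    (ht : 0 < t) : GaussBound (radKernel w κ t) (7168 / t ^ (1 + 1 / 2 : ℝ)) (8 * t) where
  meas := (continuous_drKernel hw.cont t).measurable.neg.add
    (((continuous_wKernel hw.cont t).measurable.div (by fun_prop)).const_mul κ)
  nonneg := by positivity
  pos := by positivity
  le x hx y hy := by
    have h1 := abs_drKernel_le hw.le_one ht hx hy
    have h2 := abs_wKernel_div_le hw.le_one ht hx hy
    have h3 : |κ| * |wKernel w t x y / y.1| ≤ 1 * (3584 / (t * √t) * gauss (8 * t) x y) := by
      gcongr
    rw [← mul_sqrt_eq_rpow ht]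
    refine (abs_add_le _ _).trans ?_
    rw [abs_neg, abs_mul]
    refine (add_le_add h1 h3).trans (le_of_eq ?_)
    ring

theorem gaussBound_dzKernel {w : ℝ → ℝ} (hw : IsWeight w) {t : ℝ} (ht : 0 < t) :
    GaussBound (fun x y => -dzKernel w t x y) (7168 / t ^ (1 + 1 / 2 : ℝ)) (8 * t) where
  meas := (continuous_dzKernel hw.cont t).measurable.neg
  nonneg := by positivity
  pos := by positivity
  le x hx y hy := by
    rw [← mul_sqrt_eq_rpow ht, abs_neg]
    refine (abs_dzKernel_le hw.le_one ht hx hy).trans ?_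
    have := gauss_pos (8 * t) x y
    have : 0 < √t := Real.sqrt_pos.2 ht
    gcongr
    norm_num

section estimates

variable {w : ℝ → ℝ} (hw : IsWeight w) {κ : ℝ} (hκ : |κ| ≤ 1) {t : ℝ} (ht : 0 < t)
  {p : ℝ≥0∞} (hp : 1 ≤ p) {fr fz : ℝ × ℝ → ℝ} (hr : MemLp fr p muOmega) (hz : MemLp fz p muOmega)

include hw hκ ht hp hr hz

theorem integrable_divIntegrand {x : ℝ × ℝ} (hx : x ∈ Omega) :
    Integrable (fun y => radKernel w κ t x y * fr y + -dzKernel w t x y * fz y) muOmega :=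
  ((gaussBound_radKernel hw hκ ht).integrable hp hr hx).add
    ((gaussBound_dzKernel hw ht).integrable hp hz hx)

theorem divOp_estimate {G : ℝ × ℝ → ℝ}
    (hG : ∀ x ∈ Omega, G x = ∫ y, (radKernel w κ t x y * fr y + -dzKernel w t x y * fz y) ∂muOmega)
    {q : ℝ≥0∞} (hpq : p ≤ q) :
    MemLp G q muOmega ∧ eLpNorm G q muOmega ≤
      ENNReal.ofReal (186368 / t ^ (1 / 2 + 1 / p.toReal - 1 / q.toReal)) *
        (eLpNorm fr p muOmega + eLpNorm fz p muOmega) := by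
  have k1 := gaussBound_radKernel hw hκ ht
  have k2 := gaussBound_dzKernel hw ht
  have m1 := k1.memLp hp hpq hr
  have m2 := k2.memLp hp hpq hz
  have e : G =ᵐ[muOmega] (fun x => ∫ y, radKernel w κ t x y * fr y ∂muOmega) +
      fun x => ∫ y, -dzKernel w t x y * fz y ∂muOmega := by
    filter_upwards [ae_mem_Omega] with x hx
    rw [hG x hx, Pi.add_apply, integral_add (k1.integrable hp hr hx) (k2.integrable hp hz hx)]
  refine ⟨(memLp_congr_ae e).2 (m1.add m2), ?_⟩
  rw [eLpNorm_congr_ae e, mul_add]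
  refine (eLpNorm_add_le m1.1 m2.1 (hp.trans hpq)).trans (add_le_add ?_ ?_)
  · refine (k1.eLpNorm_le_of_scaling (by norm_num) ht hp hpq hr).trans (le_of_eq ?_)
    norm_num
  · refine (k2.eLpNorm_le_of_scaling (by norm_num) ht hp hpq hz).trans (le_of_eq ?_)
    norm_num

end estimates

theorem wOp_estimate {w : ℝ → ℝ} (hw : IsWeight w) {t : ℝ} (ht : 0 < t) {p q : ℝ≥0∞} (hp : 1 ≤ p)
    (hpq : p ≤ q) {f : ℝ × ℝ → ℝ} (hf : MemLp f p muOmega) :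
    eLpNorm (fun x => ∫ y, wKernel w t x y * f y ∂muOmega) q muOmega ≤
      ENNReal.ofReal (186368 / t ^ (1 / p.toReal - 1 / q.toReal)) * eLpNorm f p muOmega := by
  have hk : GaussBound (wKernel w t) (3584 / t ^ (1 + 0 : ℝ)) (8 * t) := by
    rw [add_zero, Real.rpow_one]
    exact hw.gaussBound ht
  refine (hk.eLpNorm_le_of_scaling (by norm_num) ht hp hpq hf).trans ?_
  rw [zero_add]
  gcongr
  norm_num

/-! ### Compatibility with the weak divergence -/

theorem exists_abs_deriv_smoothTransition_le :
    ∃ M, 0 ≤ M ∧ ∀ s, |deriv Real.smoothTransition s| ≤ M := by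
  have hc : Continuous (deriv Real.smoothTransition) :=
    (Real.smoothTransition.contDiff (n := 1)).continuous_deriv le_rfl
  obtain ⟨M, hM⟩ := (isCompact_Icc (a := (0 : ℝ)) (b := 1)).exists_bound_of_continuousOn
    hc.continuousOn
  have hM0 : 0 ≤ M := (norm_nonneg _).trans (hM 0 ⟨le_rfl, zero_le_one⟩)
  refine ⟨M, hM0, fun s => ?_⟩
  by_cases hs : s ∈ Set.Icc (0 : ℝ) 1
  · exact hM s hs
  · have : deriv Real.smoothTransition s = 0 := by
      rw [Set.mem_Icc, not_and_or, not_le, not_le] at hs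
      rcases hs with hs | hs
      · have : Real.smoothTransition =ᶠ[𝓝 s] fun _ => 0 := by
          filter_upwards [Iio_mem_nhds hs] with r hr
          exact Real.smoothTransition.zero_of_nonpos (le_of_lt hr)
        rw [this.deriv_eq, deriv_const]
      · have : Real.smoothTransition =ᶠ[𝓝 s] fun _ => 1 := by
          filter_upwards [Ioi_mem_nhds hs] with r hr
          exact Real.smoothTransition.one_of_one_le (le_of_lt hr)
        rw [this.deriv_eq, deriv_const]
    rw [this, abs_zero]
    exact hM0

theorem deriv_smoothTransition_of_one_lt {s : ℝ} (hs : 1 < s) :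
    deriv Real.smoothTransition s = 0 := by
  have : Real.smoothTransition =ᶠ[𝓝 s] fun _ => 1 := by
    filter_upwards [Ioi_mem_nhds hs] with r hr
    exact Real.smoothTransition.one_of_one_le (le_of_lt hr)
  rw [this.deriv_eq, deriv_const]

/-- A cutoff that vanishes near the axis and at infinity, and tends to `1` as `N → ∞`. -/
def cutoff (N : ℝ) (y : ℝ × ℝ) : ℝ :=
  Real.smoothTransition (N * y.1 - 1) *
    Real.smoothTransition (2 - (y.1 ^ 2 + y.2 ^ 2) / N ^ 2)

/-- The radial derivative of `cutoff`. -/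
def drCutoff (N : ℝ) (y : ℝ × ℝ) : ℝ :=
  deriv Real.smoothTransition (N * y.1 - 1) * N *
      Real.smoothTransition (2 - (y.1 ^ 2 + y.2 ^ 2) / N ^ 2) +
    Real.smoothTransition (N * y.1 - 1) *
      (deriv Real.smoothTransition (2 - (y.1 ^ 2 + y.2 ^ 2) / N ^ 2) * -(2 * y.1 / N ^ 2))

/-- The vertical derivative of `cutoff`. -/
def dzCutoff (N : ℝ) (y : ℝ × ℝ) : ℝ :=
  Real.smoothTransition (N * y.1 - 1) *
    (deriv Real.smoothTransition (2 - (y.1 ^ 2 + y.2 ^ 2) / N ^ 2) * -(2 * y.2 / N ^ 2))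

theorem hasDerivAt_smoothTransition (s : ℝ) :
    HasDerivAt Real.smoothTransition (deriv Real.smoothTransition s) s :=
  ((Real.smoothTransition.contDiff (n := 1)).differentiable one_ne_zero s).hasDerivAt

theorem hasDerivAt_cutoff_fst (N : ℝ) (y : ℝ × ℝ) :
    HasDerivAt (fun s => cutoff N (s, y.2)) (drCutoff N y) y.1 := by
  have h1 : HasDerivAt (fun s : ℝ => N * s - 1) N y.1 := by
    simpa using ((hasDerivAt_id y.1).const_mul N).sub_const 1
  have h2 : HasDerivAt (fun s : ℝ => 2 - (s ^ 2 + y.2 ^ 2) / N ^ 2) (-(2 * y.1 / N ^ 2)) y.1 := by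
    simpa using ((((hasDerivAt_id y.1).pow 2).add_const (y.2 ^ 2)).div_const (N ^ 2)).const_sub 2
  exact ((hasDerivAt_smoothTransition _).comp y.1 h1).mul
    ((hasDerivAt_smoothTransition _).comp y.1 h2)

theorem hasDerivAt_cutoff_snd (N : ℝ) (y : ℝ × ℝ) :
    HasDerivAt (fun s => cutoff N (y.1, s)) (dzCutoff N y) y.2 := by
  have h2 : HasDerivAt (fun s : ℝ => 2 - (y.1 ^ 2 + s ^ 2) / N ^ 2) (-(2 * y.2 / N ^ 2)) y.2 := by
    simpa using ((((hasDerivAt_id y.2).pow 2).const_add (y.1 ^ 2)).div_const (N ^ 2)).const_sub 2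
  exact ((hasDerivAt_smoothTransition _).comp y.2 h2).const_mul
    (Real.smoothTransition (N * y.1 - 1))

theorem continuous_drCutoff (N : ℝ) : Continuous (drCutoff N) := by
  have hc : Continuous (deriv Real.smoothTransition) :=
    (Real.smoothTransition.contDiff (n := 1)).continuous_deriv le_rfl
  have := Real.smoothTransition.continuous
  unfold drCutoff
  fun_prop

theorem continuous_dzCutoff (N : ℝ) : Continuous (dzCutoff N) := by
  have hc : Continuous (deriv Real.smoothTransition) :=
    (Real.smoothTransition.contDiff (n := 1)).continuous_deriv le_rfl
  have := Real.smoothTransition.continuous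
  unfold dzCutoff
  fun_prop

theorem contDiff_cutoff (N : ℝ) : ContDiff ℝ 1 (cutoff N) := by
  have := Real.smoothTransition.contDiff (n := 1)
  unfold cutoff
  fun_prop

theorem abs_cutoff_le (N : ℝ) (y : ℝ × ℝ) : |cutoff N y| ≤ 1 := by
  have h1 := Real.smoothTransition.nonneg (N * y.1 - 1)
  have h2 := Real.smoothTransition.nonneg (2 - (y.1 ^ 2 + y.2 ^ 2) / N ^ 2)
  rw [cutoff, abs_of_nonneg (mul_nonneg h1 h2)]
  exact mul_le_one₀ (Real.smoothTransition.le_one _) h2 (Real.smoothTransition.le_one _)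

/-- The kernel is not compactly supported in `Ω`; this truncation makes it admissible in the weak
divergence. -/
theorem isTest_mul_cutoff {ψ : ℝ × ℝ → ℝ} (hψ : ContDiff ℝ 1 ψ) {N : ℝ} (hN : 0 < N) :
    IsTest fun y => ψ y * cutoff N y := by
  set K : Set (ℝ × ℝ) := {y | 1 / N ≤ y.1} ∩ {y | y.1 ^ 2 + y.2 ^ 2 ≤ 2 * N ^ 2}
  have hKc : IsClosed K :=
    (isClosed_le continuous_const continuous_fst).inter
      (isClosed_le (by fun_prop) continuous_const)
  have hKb : Bornology.IsBounded K := by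
    refine (Metric.isBounded_closedBall (x := (0 : ℝ × ℝ)) (r := 2 * N)).subset ?_
    rintro y ⟨_, hy⟩
    rw [Set.mem_ofPred_eq] at hy
    rw [mem_closedBall_zero_iff, Prod.norm_def]
    exact max_le (abs_le_of_sq_le_sq (by nlinarith [sq_nonneg y.2]) (by positivity))
      (abs_le_of_sq_le_sq (by nlinarith [sq_nonneg y.1]) (by positivity))
  have hK : IsCompact K := Metric.isCompact_of_isClosed_isBounded hKc hKb
  have hsupp : ∀ y, y ∉ K → ψ y * cutoff N y = 0 := by
    intro y hy
    rw [Set.mem_inter_iff, not_and_or, Set.mem_ofPred_eq, Set.mem_ofPred_eq, not_le, not_le] at hy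
    rw [cutoff]
    rcases hy with hy | hy
    · rw [lt_div_iff₀ hN] at hy
      rw [Real.smoothTransition.zero_of_nonpos (by linarith), zero_mul, mul_zero]
    · rw [Real.smoothTransition.zero_of_nonpos (x := 2 - _), mul_zero, mul_zero]
      rw [sub_nonpos, le_div_iff₀ (by positivity)]
      exact hy.le
  refine ⟨hψ.mul (contDiff_cutoff N), HasCompactSupport.intro hK (fun {y} hy => hsupp y hy), ?_⟩
  have h1 : tsupport (fun y => ψ y * cutoff N y) ⊆ K := by
    refine closure_minimal (fun y hy => ?_) hKc
    by_contra h
    exact hy (hsupp y h)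
  intro y hy
  have h2 : 1 / N ≤ y.1 := (h1 hy).1
  exact lt_of_lt_of_le (by positivity) h2

/-- The large factor `N` is present only where `N r ≤ 2`, so it is at most `2/r` there. The bound is
thus uniform in `N`. -/
theorem abs_drCutoff_le {M : ℝ} (hM0 : 0 ≤ M) (hM : ∀ s, |deriv Real.smoothTransition s| ≤ M)
    {N : ℝ} (hN : 1 ≤ N) {y : ℝ × ℝ} (hy : y ∈ Omega) :
    |drCutoff N y| ≤ 2 * M * (1 / y.1 + y.1) := by
  have hy0 : 0 < y.1 := hy
  have h1 : |deriv Real.smoothTransition (N * y.1 - 1) * N| ≤ 2 * M / y.1 := by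
    rw [abs_mul, abs_of_pos (show 0 < N by linarith), le_div_iff₀ hy0]
    rcases le_or_gt (N * y.1) 2 with h | h
    · calc _ = |deriv Real.smoothTransition (N * y.1 - 1)| * (N * y.1) := by ring
        _ ≤ M * 2 := by
          gcongr
          exact hM _
        _ = _ := by ring
    · rw [deriv_smoothTransition_of_one_lt (by linarith), abs_zero, zero_mul, zero_mul]
      positivity
  have h2 : |-(2 * y.1 / N ^ 2)| ≤ 2 * y.1 := by
    rw [abs_neg, abs_of_nonneg (by positivity)]
    exact div_le_self (by positivity) (by nlinarith)
  have b1 := Real.smoothTransition.nonneg (N * y.1 - 1)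
  have b2 := Real.smoothTransition.nonneg (2 - (y.1 ^ 2 + y.2 ^ 2) / N ^ 2)
  refine (abs_add_le _ _).trans ?_
  rw [abs_mul _ (Real.smoothTransition (2 - _)), abs_mul (Real.smoothTransition _) (_ * _),
    abs_mul (deriv _ (2 - _)), abs_of_nonneg b1, abs_of_nonneg b2]
  calc _ ≤ 2 * M / y.1 * 1 + 1 * (M * (2 * y.1)) := by
        gcongr
        · exact Real.smoothTransition.le_one _
        · exact Real.smoothTransition.le_one _
        · exact hM _
    _ = _ := by ring

theorem abs_dzCutoff_le {M : ℝ} (hM0 : 0 ≤ M) (hM : ∀ s, |deriv Real.smoothTransition s| ≤ M)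
    {N : ℝ} (hN : 1 ≤ N) (y : ℝ × ℝ) : |dzCutoff N y| ≤ 2 * M * |y.2| := by
  have h2 : |-(2 * y.2 / N ^ 2)| ≤ 2 * |y.2| := by
    rw [abs_neg, abs_div, abs_mul, abs_of_pos (show (0 : ℝ) < 2 by norm_num),
      abs_of_pos (show (0 : ℝ) < N ^ 2 by positivity)]
    exact div_le_self (by positivity) (by nlinarith)
  have b1 := Real.smoothTransition.nonneg (N * y.1 - 1)
  rw [dzCutoff, abs_mul, abs_mul, abs_of_nonneg b1]
  calc _ ≤ 1 * (M * (2 * |y.2|)) := by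
        gcongr
        · exact Real.smoothTransition.le_one _
        · exact hM _
    _ = _ := by ring

/-- For large `N` both transitions are evaluated beyond `1`, where they are locally constant. -/
theorem eventually_cutoff_eq {y : ℝ × ℝ} (hy : y ∈ Omega) :
    ∀ᶠ N in atTop, cutoff N y = 1 ∧ drCutoff N y = 0 ∧ dzCutoff N y = 0 := by
  have hy0 : 0 < y.1 := hy
  filter_upwards [eventually_gt_atTop (2 / y.1), eventually_gt_atTop (y.1 ^ 2 + y.2 ^ 2),
    eventually_ge_atTop 1] with N h1 h2 h3
  rw [div_lt_iff₀ hy0] at h1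
  have h4 : (y.1 ^ 2 + y.2 ^ 2) / N ^ 2 < 1 := by
    rw [div_lt_one (by positivity)]
    nlinarith
  have a1 := Real.smoothTransition.one_of_one_le (show 1 ≤ N * y.1 - 1 by linarith)
  have a2 := Real.smoothTransition.one_of_one_le
    (show 1 ≤ 2 - (y.1 ^ 2 + y.2 ^ 2) / N ^ 2 by linarith)
  have a3 := deriv_smoothTransition_of_one_lt (show 1 < N * y.1 - 1 by linarith)
  have a4 := deriv_smoothTransition_of_one_lt
    (show 1 < 2 - (y.1 ^ 2 + y.2 ^ 2) / N ^ 2 by linarith)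
  simp [cutoff, drCutoff, dzCutoff, a1, a2, a3, a4]

theorem GaussBound.measurable_right {k : ℝ × ℝ → ℝ × ℝ → ℝ} {M b : ℝ} (hk : GaussBound k M b)
    (x : ℝ × ℝ) : Measurable (k x) :=
  hk.meas.comp measurable_prodMk_left

theorem abs_wKernel_mul_le {w : ℝ → ℝ} (hw : IsWeight w) {t : ℝ} (ht : 0 < t) {x y : ℝ × ℝ}
    (hx : x ∈ Omega) (hy : y ∈ Omega) {a b : ℝ} (hab : |a - b| ≤ √t * (1 + sqDist x y / t)) :
    |wKernel w t x y| * |b| ≤ 57344 / t * (|a| + √t) * gauss (16 * t) x y := by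
  have hv : 0 ≤ sqDist x y / t := div_nonneg (sqDist_nonneg _ _) ht.le
  have h1 := abs_wKernel_le hw.le_one ht hx hy
  have h2 : |b| ≤ (|a| + √t) * (1 + sqDist x y / t) := by
    have h3 := abs_sub_abs_le_abs_sub b a
    rw [abs_sub_comm] at h3
    nlinarith [mul_nonneg (abs_nonneg a) hv]
  have h4 := one_add_mul_gauss_le ht x y
  have hg := gauss_pos (8 * t) x y
  calc _ ≤ 3584 / t * gauss (8 * t) x y * ((|a| + √t) * (1 + sqDist x y / t)) := by gcongr
    _ = 3584 / t * (|a| + √t) * ((1 + sqDist x y / t) * gauss (8 * t) x y) := by ring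
    _ ≤ 3584 / t * (|a| + √t) * (16 * gauss (16 * t) x y) := by gcongr
    _ = _ := by ring

/-- The radial derivative of the truncated kernel, with the zeroth order term of `div`. -/
def radCut (w : ℝ → ℝ) (κ t : ℝ) (x : ℝ × ℝ) (N : ℝ) (y : ℝ × ℝ) : ℝ :=
  radKernel w κ t x y * cutoff N y - wKernel w t x y * drCutoff N y

/-- The vertical derivative of the truncated kernel. -/
def vertCut (w : ℝ → ℝ) (t : ℝ) (x : ℝ × ℝ) (N : ℝ) (y : ℝ × ℝ) : ℝ :=
  -dzKernel w t x y * cutoff N y - wKernel w t x y * dzCutoff N y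

/-- A majorant independent of `N` for dominated convergence. The factor `1/r'` from the cutoff is
absorbed by `abs_wKernel_div_le`, and the factors `r'` and `|z'|` by doubling the variance. -/
theorem exists_abs_cut_le {w : ℝ → ℝ} (hw : IsWeight w) {κ : ℝ} (hκ : |κ| ≤ 1) {t : ℝ}
    (ht : 0 < t) {x : ℝ × ℝ} (hx : x ∈ Omega) :
    ∃ C, ∀ N, 1 ≤ N → ∀ y ∈ Omega, |radCut w κ t x N y| ≤ C * gauss (16 * t) x y ∧
      |vertCut w t x N y| ≤ C * gauss (16 * t) x y := by
  obtain ⟨M, hM0, hM⟩ := exists_abs_deriv_smoothTransition_le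
  set c₁ := 7168 / t ^ (1 + 1 / 2 : ℝ)
  set c₂ := 57344 / t * (|x.1| + √t)
  set c₃ := 57344 / t * (|x.2| + √t)
  have hc₁ : 0 ≤ c₁ := by positivity
  have hc₂ : 0 ≤ c₂ := by positivity
  have hc₃ : 0 ≤ c₃ := by positivity
  refine ⟨c₁ + 2 * M * (c₁ + c₂ + c₃), fun N hN y hy => ?_⟩
  have hy0 : 0 < y.1 := hy
  have hG := gauss_pos (16 * t) x y
  have hmono := gauss_mono (x := x) (y := y) (show 0 < 8 * t by positivity)
    (show 8 * t ≤ 16 * t by linarith)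
  have a1 : |radKernel w κ t x y| ≤ c₁ * gauss (16 * t) x y :=
    ((gaussBound_radKernel hw hκ ht).le x hx y hy).trans (by gcongr)
  have a2 : |-dzKernel w t x y| ≤ c₁ * gauss (16 * t) x y :=
    ((gaussBound_dzKernel hw ht).le x hx y hy).trans (by gcongr)
  have a3 : |wKernel w t x y| * (1 / y.1) ≤ c₁ * gauss (16 * t) x y := by
    have h := abs_wKernel_div_le hw.le_one ht hx hy
    rw [abs_div, abs_of_pos hy0, mul_sqrt_eq_rpow ht] at h
    rw [mul_one_div]
    refine h.trans ?_
    have := gauss_pos (8 * t) x y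
    simp only [c₁]
    gcongr
    norm_num
  have a4 := abs_wKernel_mul_le hw ht hx hy (abs_fst_sub_le ht x y)
  have a5 := abs_wKernel_mul_le hw ht hx hy (abs_snd_sub_le ht x y)
  rw [abs_of_pos hy0] at a4
  have b1 := abs_cutoff_le N y
  have b2 := abs_drCutoff_le hM0 hM hN hy
  have b3 := abs_dzCutoff_le hM0 hM hN y
  set G := gauss (16 * t) x y
  constructor
  · rw [radCut]
    refine (abs_sub _ _).trans ?_
    rw [abs_mul, abs_mul]
    calc _ ≤ c₁ * G * 1 + |wKernel w t x y| * (2 * M * (1 / y.1 + y.1)) := by gcongr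
      _ = c₁ * G + 2 * M * (|wKernel w t x y| * (1 / y.1) + |wKernel w t x y| * y.1) := by ring
      _ ≤ c₁ * G + 2 * M * (c₁ * G + c₂ * G) := by gcongr
      _ ≤ c₁ * G + 2 * M * (c₁ * G + c₂ * G + c₃ * G) := by
          refine add_le_add le_rfl (mul_le_mul_of_nonneg_left ?_ (by positivity))
          have := mul_nonneg hc₃ hG.le
          linarith
      _ = _ := by ring
  · rw [vertCut]
    refine (abs_sub _ _).trans ?_
    rw [abs_mul, abs_mul (wKernel w t x y)]
    calc _ ≤ c₁ * G * 1 + |wKernel w t x y| * (2 * M * |y.2|) := by gcongr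
      _ = c₁ * G + 2 * M * (|wKernel w t x y| * |y.2|) := by ring
      _ ≤ c₁ * G + 2 * M * (c₃ * G) := by gcongr
      _ ≤ c₁ * G + 2 * M * (c₁ * G + c₂ * G + c₃ * G) := by
          refine add_le_add le_rfl (mul_le_mul_of_nonneg_left ?_ (by positivity))
          have := mul_nonneg hc₁ hG.le
          have := mul_nonneg hc₂ hG.le
          linarith
      _ = _ := by ring

theorem dr_mul_cutoff {w : ℝ → ℝ} (hw : IsWeight w) {t : ℝ} (ht : 0 < t) (x : ℝ × ℝ) (N : ℝ)
    (y : ℝ × ℝ) : dr (fun y => wKernel w t x y * cutoff N y) y =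
      drKernel w t x y * cutoff N y + wKernel w t x y * drCutoff N y :=
  ((hasDerivAt_wKernel_fst hw.cont hw.le_one ht x y).fun_mul (hasDerivAt_cutoff_fst N y)).deriv

theorem dz_mul_cutoff (w : ℝ → ℝ) {t : ℝ} (ht : 0 < t) (x : ℝ × ℝ) (N : ℝ)
    (y : ℝ × ℝ) : dz (fun y => wKernel w t x y * cutoff N y) y =
      dzKernel w t x y * cutoff N y + wKernel w t x y * dzCutoff N y :=
  ((hasDerivAt_wKernel_snd w ht x y).fun_mul (hasDerivAt_cutoff_snd N y)).deriv

/-- The weak divergence may be tested against the kernel. -/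
theorem integral_divIntegrand_eq {w : ℝ → ℝ} (hw : IsWeight w) {κ : ℝ} (hκ : |κ| ≤ 1) {t : ℝ}
    (ht : 0 < t) {p m : ℝ≥0∞} (hp : 1 ≤ p) (hm : 1 ≤ m) {fr fz g : ℝ × ℝ → ℝ}
    (hr : MemLp fr p muOmega) (hz : MemLp fz p muOmega) (hg : MemLp g m muOmega)
    (h : ∀ φ, IsTest φ → ∫ y, g y * φ y ∂muOmega =
      ∫ y, (-(fr y * dr φ y + fz y * dz φ y) + κ * (fr y / y.1 * φ y)) ∂muOmega)
    {x : ℝ × ℝ} (hx : x ∈ Omega) :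
    ∫ y, (radKernel w κ t x y * fr y + -dzKernel w t x y * fz y) ∂muOmega =
      ∫ y, wKernel w t x y * g y ∂muOmega := by
  have hwx : Continuous (wKernel w t x) := (contDiff_wKernel hw.cont hw.le_one t x).continuous
  have hrm : Measurable (radKernel w κ t x) :=
    (gaussBound_radKernel hw hκ ht).measurable_right x
  have hzm : Measurable fun y => -dzKernel w t x y :=
    (gaussBound_dzKernel hw ht).measurable_right x
  obtain ⟨C, hC⟩ := exists_abs_cut_le hw hκ ht hx
  have hlimL : Tendsto (fun N => ∫ y, g y * (wKernel w t x y * cutoff N y) ∂muOmega) atTop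
      (𝓝 (∫ y, wKernel w t x y * g y ∂muOmega)) := by
    refine tendsto_integral_filter_of_dominated_convergence
      (fun y => ‖wKernel w t x y * g y‖) ?_ ?_ ?_ ?_
    · exact Eventually.of_forall fun N => hg.1.mul
        (hwx.mul (contDiff_cutoff N).continuous).aestronglyMeasurable
    · refine Eventually.of_forall fun N => Eventually.of_forall fun y => ?_
      rw [show g y * (wKernel w t x y * cutoff N y) = wKernel w t x y * g y * cutoff N y by ring,
        norm_mul _ (cutoff N y)]
      exact mul_le_of_le_one_right (norm_nonneg _) (abs_cutoff_le N y)
    · exact ((hw.gaussBound ht).integrable hm hg hx).norm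
    · filter_upwards [ae_mem_Omega] with y hy
      refine tendsto_const_nhds.congr' ?_
      filter_upwards [eventually_cutoff_eq hy] with N hN
      rw [hN.1]; ring
  have hlimR : Tendsto (fun N => ∫ y, (radCut w κ t x N y * fr y + vertCut w t x N y * fz y)
      ∂muOmega) atTop
      (𝓝 (∫ y, (radKernel w κ t x y * fr y + -dzKernel w t x y * fz y) ∂muOmega)) := by
    have hb : 0 < 16 * t := by positivity
    refine tendsto_integral_filter_of_dominated_convergence
      (fun y => C * (gauss (16 * t) x y * |fr y|) + C * (gauss (16 * t) x y * |fz y|)) ?_ ?_ ?_ ?_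
    · refine Eventually.of_forall fun N => ?_
      have hcm := (contDiff_cutoff N).continuous.measurable
      have m1 : Measurable (radCut w κ t x N) :=
        (hrm.mul hcm).sub (hwx.measurable.mul (continuous_drCutoff N).measurable)
      have m2 : Measurable (vertCut w t x N) :=
        (hzm.mul hcm).sub (hwx.measurable.mul (continuous_dzCutoff N).measurable)
      exact (m1.aestronglyMeasurable.mul hr.1).add (m2.aestronglyMeasurable.mul hz.1)
    · filter_upwards [eventually_ge_atTop 1] with N hN
      filter_upwards [ae_mem_Omega] with y hy
      obtain ⟨h1, h2⟩ := hC N hN y hy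
      refine (norm_add_le _ _).trans ?_
      rw [norm_mul, norm_mul, ← mul_assoc, ← mul_assoc]
      exact add_le_add (mul_le_mul_of_nonneg_right h1 (norm_nonneg _))
        (mul_le_mul_of_nonneg_right h2 (norm_nonneg _))
    · exact ((integrable_gauss_mul hb hp hr hx).const_mul C).add
        ((integrable_gauss_mul hb hp hz hx).const_mul C)
    · filter_upwards [ae_mem_Omega] with y hy
      refine tendsto_const_nhds.congr' ?_
      filter_upwards [eventually_cutoff_eq hy] with N hN
      rw [radCut, vertCut, hN.1, hN.2.1, hN.2.2]; ring
  -- For every `N > 0` the two sequences coincide, by testing the weak divergence with the truncated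
  -- kernel.
  refine tendsto_nhds_unique hlimR (hlimL.congr' ?_)
  filter_upwards [eventually_gt_atTop 0] with N hN
  rw [h _ (isTest_mul_cutoff (contDiff_wKernel hw.cont hw.le_one t x) hN)]
  refine integral_congr_ae (Eventually.of_forall fun y => ?_)
  simp only [dr_mul_cutoff hw ht, dz_mul_cutoff w ht, radCut, vertCut, radKernel]
  ring

theorem S1div_eq_of_isWeakDivStar {t : ℝ} (ht : 0 < t) {p m : ℝ≥0∞} (hp : 1 ≤ p) (hm : 1 ≤ m)
    {fr fz g : ℝ × ℝ → ℝ} (hr : MemLp fr p muOmega) (hz : MemLp fz p muOmega)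
    (hg : MemLp g m muOmega) (h : IsWeakDivStar fr fz g) {x : ℝ × ℝ} (hx : x ∈ Omega) :
    S1div t fr fz x = S1 t g x := by
  rw [S1div, integral_congr_ae (S1divIntegrand_ae_eq ht fr fz hx), S1_eq ht g hx]
  refine integral_divIntegrand_eq isWeight_cosWeight (by simp) ht hp hm hr hz hg (fun φ hφ => ?_) hx
  simpa using h φ hφ

theorem S2div_eq_of_isWeakDiv {t : ℝ} (ht : 0 < t) {p m : ℝ≥0∞} (hp : 1 ≤ p) (hm : 1 ≤ m)
    {fr fz g : ℝ × ℝ → ℝ} (hr : MemLp fr p muOmega) (hz : MemLp fz p muOmega)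
    (hg : MemLp g m muOmega) (h : IsWeakDiv fr fz g) {x : ℝ × ℝ} (hx : x ∈ Omega) :
    S2div t fr fz x = S2 t g x := by
  rw [S2div, integral_congr_ae (S2divIntegrand_ae_eq ht fr fz hx), S2_eq ht g hx]
  refine integral_divIntegrand_eq isWeight_oneWeight (by simp) ht hp hm hr hz hg (fun φ hφ => ?_) hx
  simpa using h φ hφ

/-! ### The semigroup on `L^p(Ω) × L^p(Ω)` -/

section semigroup

variable {p : ℝ≥0∞} [hp : Fact (1 ≤ p)]

theorem S1_congr_ae {t : ℝ} (ht : 0 < t) {f g : ℝ × ℝ → ℝ} (h : f =ᵐ[muOmega] g) (x : ℝ × ℝ) :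
    S1 t f x = S1 t g x := by
  rw [S1, S1, if_neg ht.ne', if_neg ht.ne']
  refine integral_congr_ae ?_
  filter_upwards [h] with y hy
  rw [hy]

theorem S2_congr_ae {t : ℝ} (ht : 0 < t) {f g : ℝ × ℝ → ℝ} (h : f =ᵐ[muOmega] g) (x : ℝ × ℝ) :
    S2 t f x = S2 t g x := by
  rw [S2, S2, if_neg ht.ne', if_neg ht.ne']
  refine integral_congr_ae ?_
  filter_upwards [h] with y hy
  rw [hy]

theorem evolOp_zero {w : ℝ → ℝ} (hw : IsWeight w) :
    evolOp hw p 0 = ContinuousLinearMap.id ℝ _ := evolOp_of_nonpos hw le_rfl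

theorem evolOp_cosWeight_ae_eq {t : ℝ} (ht : 0 ≤ t) (u : Lp ℝ p muOmega) :
    evolOp isWeight_cosWeight p t u =ᵐ[muOmega] S1 t u := by
  rcases ht.eq_or_lt with rfl | ht
  · rw [evolOp_zero, ContinuousLinearMap.id_apply]
    exact Eventually.of_forall fun x => (if_pos rfl).symm
  · exact (evolOp_ae_eq _ ht u).trans (S1_ae_eq ht u).symm

theorem evolOp_oneWeight_ae_eq {t : ℝ} (ht : 0 ≤ t) (u : Lp ℝ p muOmega) :
    evolOp isWeight_oneWeight p t u =ᵐ[muOmega] S2 t u := by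
  rcases ht.eq_or_lt with rfl | ht
  · rw [evolOp_zero, ContinuousLinearMap.id_apply]
    exact Eventually.of_forall fun x => (if_pos rfl).symm
  · exact (evolOp_ae_eq _ ht u).trans (S2_ae_eq ht u).symm

theorem evolOp_cosWeight_add {s t : ℝ} (hs : 0 ≤ s) (ht : 0 ≤ t) :
    evolOp isWeight_cosWeight p (s + t) =
      (evolOp isWeight_cosWeight p s).comp (evolOp isWeight_cosWeight p t) := by
  rcases hs.eq_or_lt with rfl | hs
  · rw [zero_add, evolOp_zero, ContinuousLinearMap.id_comp]
  rcases ht.eq_or_lt with rfl | ht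
  · rw [add_zero, evolOp_zero, ContinuousLinearMap.comp_id]
  refine ContinuousLinearMap.ext fun u => Lp.ext ?_
  filter_upwards [evolOp_cosWeight_ae_eq (add_pos hs ht).le u,
    evolOp_cosWeight_ae_eq hs.le (evolOp isWeight_cosWeight p t u), ae_mem_Omega] with x h1 h2 hx
  rw [h1, ContinuousLinearMap.comp_apply, h2, S1_congr_ae hs (evolOp_cosWeight_ae_eq ht.le u),
    S1_add hs ht hp.out (Lp.memLp u) hx]

theorem evolOp_oneWeight_add {s t : ℝ} (hs : 0 ≤ s) (ht : 0 ≤ t) :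
    evolOp isWeight_oneWeight p (s + t) =
      (evolOp isWeight_oneWeight p s).comp (evolOp isWeight_oneWeight p t) := by
  rcases hs.eq_or_lt with rfl | hs
  · rw [zero_add, evolOp_zero, ContinuousLinearMap.id_comp]
  rcases ht.eq_or_lt with rfl | ht
  · rw [add_zero, evolOp_zero, ContinuousLinearMap.comp_id]
  refine ContinuousLinearMap.ext fun u => Lp.ext ?_
  filter_upwards [evolOp_oneWeight_ae_eq (add_pos hs ht).le u,
    evolOp_oneWeight_ae_eq hs.le (evolOp isWeight_oneWeight p t u), ae_mem_Omega] with x h1 h2 hx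
  rw [h1, ContinuousLinearMap.comp_apply, h2, S2_congr_ae hs (evolOp_oneWeight_ae_eq ht.le u),
    S2_add hs ht hp.out (Lp.memLp u) hx]

/-- The pair `(𝕊₁(t), 𝕊₂(t))` as an operator on `L^p(Ω) × L^p(Ω)`. -/
def pairOp (p : ℝ≥0∞) [Fact (1 ≤ p)] (t : ℝ≥0) :
    (Lp ℝ p muOmega × Lp ℝ p muOmega) →L[ℝ] (Lp ℝ p muOmega × Lp ℝ p muOmega) :=
  (evolOp isWeight_cosWeight p t).prodMap (evolOp isWeight_oneWeight p t)

theorem isOperatorSemigroup_pairOp : IsOperatorSemigroup (pairOp p) where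
  zero := by
    unfold pairOp
    rw [NNReal.coe_zero, evolOp_zero, evolOp_zero]
    rfl
  add s t := by
    unfold pairOp
    rw [NNReal.coe_add, evolOp_cosWeight_add s.coe_nonneg t.coe_nonneg,
      evolOp_oneWeight_add s.coe_nonneg t.coe_nonneg]
    rfl

theorem continuous_pairOp (hp' : p ≠ ∞) (u : Lp ℝ p muOmega × Lp ℝ p muOmega) :
    Continuous fun t => pairOp p t u :=
  ((continuous_evolOp_of_tendsto _ (tendsto_evolOp_cosWeight hp' u.1)).comp
    NNReal.continuous_coe).prodMk
  ((continuous_evolOp_of_tendsto _ (tendsto_evolOp_oneWeight hp' u.2)).comp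
    NNReal.continuous_coe)

theorem continuousOn_pairOp (u : Lp ℝ p muOmega × Lp ℝ p muOmega) :
    ContinuousOn (fun t => pairOp p t u) (Set.Ioi 0) := by
  intro t ht
  have ht0 : (0 : ℝ) < t := ht
  exact (((continuousAt_evolOp isWeight_cosWeight ht0 u.1).comp
    NNReal.continuous_coe.continuousAt).prodMk
    ((continuousAt_evolOp isWeight_oneWeight ht0 u.2).comp
      NNReal.continuous_coe.continuousAt)).continuousWithinAt

end semigroup

end AxisymHeat

end

theorem proposition2p7 :
    -- `𝕊₂(t)` is the heat flow of `ℝ³` on axisymmetric functions, and `𝕊₁(t)`, the flow of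
    -- `Δ - 1/r²`, is the heat flow of `ℝ³` on fields `ω e_θ` with `ω` axisymmetric
    (∀ (p : ℝ≥0∞), 1 ≤ p → ∀ f : ℝ × ℝ → ℝ, MemLp f p AxisymHeat.muOmega →
      ∀ t : ℝ, 0 < t →
        (∀ x ∈ AxisymHeat.Omega,
          Integrable (fun y => AxisymHeat.K1 t x y * f y) AxisymHeat.muOmega ∧
          Integrable (fun y => AxisymHeat.K2 t x y * f y) AxisymHeat.muOmega) ∧
        ∀ x : AxisymHeat.E3, 0 < (AxisymHeat.cyl x).1 →
          AxisymHeat.S1 t f (AxisymHeat.cyl x) • AxisymHeat.eTheta x =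
            AxisymHeat.heatFlow t
              (fun y => f (AxisymHeat.cyl y) • AxisymHeat.eTheta y) x ∧
          AxisymHeat.S2 t f (AxisymHeat.cyl x) =
            AxisymHeat.heatFlow t (fun y => f (AxisymHeat.cyl y)) x) ∧
    -- semigroup of bounded operators on `L^p(Ω) × L^p(Ω)`, strongly continuous
    (∀ (p : ℝ≥0∞) [Fact (1 ≤ p)],
      ∃ T : ℝ≥0 →
          (Lp ℝ p AxisymHeat.muOmega × Lp ℝ p AxisymHeat.muOmega) →L[ℝ]
            (Lp ℝ p AxisymHeat.muOmega × Lp ℝ p AxisymHeat.muOmega),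
        (∀ (t : ℝ≥0) (u : Lp ℝ p AxisymHeat.muOmega × Lp ℝ p AxisymHeat.muOmega),
          (T t u).1 =ᵐ[AxisymHeat.muOmega] AxisymHeat.S1 t u.1 ∧
          (T t u).2 =ᵐ[AxisymHeat.muOmega] AxisymHeat.S2 t u.2) ∧
        AxisymHeat.IsOperatorSemigroup T ∧
        (p ≠ ∞ → ∀ u, Continuous fun t => T t u) ∧
        (∀ u, ContinuousOn (fun t => T t u) (Set.Ioi 0))) ∧
    -- `𝕊₁(t) div⋆ f` and `𝕊₂(t) div f` are well defined for `f` in `L^p`, and are `𝕊₁(t)`, `𝕊₂(t)`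
    -- applied to the divergence of `f` when that is a function in some `L^m`
    (∀ (p : ℝ≥0∞), 1 ≤ p → ∀ fr fz : ℝ × ℝ → ℝ,
      MemLp fr p AxisymHeat.muOmega → MemLp fz p AxisymHeat.muOmega →
      ∀ t : ℝ, 0 < t → ∀ x ∈ AxisymHeat.Omega,
        Integrable (AxisymHeat.S1divIntegrand t fr fz x) AxisymHeat.muOmega ∧
        Integrable (AxisymHeat.S2divIntegrand t fr fz x) AxisymHeat.muOmega ∧
        ∀ (m : ℝ≥0∞), 1 ≤ m → ∀ g : ℝ × ℝ → ℝ, MemLp g m AxisymHeat.muOmega →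
          (AxisymHeat.IsWeakDivStar fr fz g →
            AxisymHeat.S1div t fr fz x = AxisymHeat.S1 t g x) ∧
          (AxisymHeat.IsWeakDiv fr fz g →
            AxisymHeat.S2div t fr fz x = AxisymHeat.S2 t g x)) ∧
    -- the three `L^p → L^q` estimates, with one absolute constant
    ∃ C : ℝ, 0 < C ∧ ∀ p q : ℝ≥0∞, 1 ≤ p → p ≤ q → ∀ t : ℝ, 0 < t →
      (∀ f g : ℝ × ℝ → ℝ, MemLp f p AxisymHeat.muOmega → MemLp g p AxisymHeat.muOmega →
        MemLp (AxisymHeat.S1 t f) q AxisymHeat.muOmega ∧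
        MemLp (AxisymHeat.S2 t g) q AxisymHeat.muOmega ∧
        eLpNorm (AxisymHeat.S1 t f) q AxisymHeat.muOmega +
            eLpNorm (AxisymHeat.S2 t g) q AxisymHeat.muOmega ≤
          ENNReal.ofReal (C / t ^ (1 / p.toReal - 1 / q.toReal)) *
            (eLpNorm f p AxisymHeat.muOmega + eLpNorm g p AxisymHeat.muOmega)) ∧
      (∀ fr fz : ℝ × ℝ → ℝ, MemLp fr p AxisymHeat.muOmega → MemLp fz p AxisymHeat.muOmega →
        MemLp (AxisymHeat.S1div t fr fz) q AxisymHeat.muOmega ∧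
        eLpNorm (AxisymHeat.S1div t fr fz) q AxisymHeat.muOmega ≤
          ENNReal.ofReal (C / t ^ (1 / 2 + 1 / p.toReal - 1 / q.toReal)) *
            (eLpNorm fr p AxisymHeat.muOmega + eLpNorm fz p AxisymHeat.muOmega)) ∧
      (∀ fr fz : ℝ × ℝ → ℝ, MemLp fr p AxisymHeat.muOmega → MemLp fz p AxisymHeat.muOmega →
        MemLp (AxisymHeat.S2div t fr fz) q AxisymHeat.muOmega ∧
        eLpNorm (AxisymHeat.S2div t fr fz) q AxisymHeat.muOmega ≤
          ENNReal.ofReal (C / t ^ (1 / 2 + 1 / p.toReal - 1 / q.toReal)) *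
            (eLpNorm fr p AxisymHeat.muOmega + eLpNorm fz p AxisymHeat.muOmega)) := by
  open AxisymHeat in
  refine ⟨fun p hp f hf t ht => ⟨fun x hx => ⟨?_, ?_⟩, fun x hx =>
      ⟨(heatFlow_swirl hp hf ht hx).2, (heatFlow_scalar hp hf ht hx).2⟩⟩,
    fun p _ => ⟨pairOp p, fun t u => ⟨evolOp_cosWeight_ae_eq t.coe_nonneg u.1,
      evolOp_oneWeight_ae_eq t.coe_nonneg u.2⟩, isOperatorSemigroup_pairOp, continuous_pairOp,
      continuousOn_pairOp⟩,
    fun p hp fr fz hr hz t ht x hx => ⟨?_, ?_, fun m hm g hg =>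
      ⟨fun h => S1div_eq_of_isWeakDivStar ht hp hm hr hz hg h hx,
        fun h => S2div_eq_of_isWeakDiv ht hp hm hr hz hg h hx⟩⟩,
    -- `186368 = 26 · 7168`, where `26` bounds `(8π)^(1-θ)` with `θ = 1/p - 1/q`, and `7168` is the
    -- constant in the majorants of the differentiated kernels; the kernels themselves need only
    -- half of it.
    186368, by norm_num, fun p q hp hpq t ht => ⟨fun f g hf hg =>
      ⟨memLp_S1 ht hp hpq hf, memLp_S2 ht hp hpq hg, ?_⟩, fun fr fz hr hz => ?_,
      fun fr fz hr hz => ?_⟩⟩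
  · refine (integrable_congr ?_).2 ((isWeight_cosWeight.gaussBound ht).integrable hp hf hx)
    filter_upwards [ae_mem_Omega] with y hy
    rw [K1_eq ht hx hy]
  · refine (integrable_congr ?_).2 ((isWeight_oneWeight.gaussBound ht).integrable hp hf hx)
    filter_upwards [ae_mem_Omega] with y hy
    rw [K2_eq ht hx hy]
  · exact (integrable_congr (S1divIntegrand_ae_eq ht fr fz hx)).2
      (integrable_divIntegrand isWeight_cosWeight (by simp) ht hp hr hz hx)
  · exact (integrable_congr (S2divIntegrand_ae_eq ht fr fz hx)).2
      (integrable_divIntegrand isWeight_oneWeight (by simp) ht hp hr hz hx)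
  · rw [eLpNorm_congr_ae (S1_ae_eq ht f), eLpNorm_congr_ae (S2_ae_eq ht g), mul_add]
    exact add_le_add (wOp_estimate isWeight_cosWeight ht hp hpq hf)
      (wOp_estimate isWeight_oneWeight ht hp hpq hg)
  · exact divOp_estimate isWeight_cosWeight (κ := 0) (by simp) ht hp hr hz
      (fun x hx => integral_congr_ae (S1divIntegrand_ae_eq ht fr fz hx)) hpq
  · exact divOp_estimate isWeight_oneWeight (κ := 1) (by simp) ht hp hr hz
      (fun x hx => integral_congr_ae (S2divIntegrand_ae_eq ht fr fz hx)) hpq
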